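/- Let $\Omega\subset\mathbb R^d$ ($d\ge 1$) be a bounded open set with a polyhedral boundary, $\mathcal D\subset\mathbb R^p$ open, and let $f_1,\dots,f_d:\mathcal D\to\mathbb R^p$ be $C^1$ and Lipschitz continuous; write $f(a)\cdot n=\sum_j n_jf_j(a)$. Fix $k\ge 0$ and consider a family of residual distribution schemes with parameters $h>0$, as follows. *Meshes and finite elements.* Each mesh $\mathcal T_h$ of $\Omega$ consists of simplices $K$, conformal or not, with simplicial faces; $\Gamma$ denotes the faces on $\partial\Omega$. The family is regular (shape regular and quasi-uniform): for some $c>0$, $\operatorname{diam}K\le h$, $|K|\ge c\,h^d$ and $|e|\ge c\,h^{d-1}$ for all elements $K$ and faces $e$. The basis functions $\varphi_\sigma$, $\sigma\in K$, are the images, in barycentric coordinates, of one fixed basis of $\mathbb P^k$ with sum $1$, such that on each facet the basis functions that do not vanish identically there are linearly independent (e.g. the Lagrange or the Bézier basis); $\sigma\in\Gamma$ means that $\varphi_\sigma\not\equiv0$ on $\Gamma$. $V_h$ is the space of functions $v=\sum_\sigma v_\sigma\varphi_\sigma$ (continuous or discontinuous across faces, according to the identification of the degrees of freedom). *Fluxes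 and residuals.* $\hat f_n(a,b)$ is a numerical flux: consistent ($\hat f_n(a,a)=f(a)\cdot n$), conservative ($\hat f_{-n}(b,a)=-\hat f_n(a,b)$) and Lipschitz continuous on $\mathcal D\times\mathcal D$, uniformly in the unit vector $n$. $\mathcal F_n(a,b)$ is a boundary flux that is Lipschitz continuous in $a$, uniformly in $b$ and $n$, and upwind: $\mathcal F_n(a,b)=f(a)\cdot n$ whenever $(\nabla_uf(a)\cdot n)^-(a-b)=0$, where $A^-$ is the negative part of a real-diagonalisable matrix $A$. $\oint$ denotes numerical integration over elements and faces, $\oint_S g=|S|\sum_q\omega_q\,g(x_q)$ with points $x_q\in S$, $\sum_q|\omega_q|$ bounded uniformly in $S$ and $h$, and the same rule seen from both sides of a face. The residuals satisfy, for all $u^h\in V_h^p$ with values in $\mathcal D$, $$\sum_{\sigma\in K}\Phi^K_\sigma(u^h)=\oint_{\partial K}\hat f_n\big(u^h_{|K},u^h_{|K^-}\big)\,d\gamma,\qquad \sum_{\sigma\in\Gamma}\Phi^\Gamma_\sigma(u^h)=\oint_\Gamma\big(\mathcal F_n(u^h,u_b)-f(u^h)\cdot n\big)\,d\gamma,$$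 where $u^h_{|K^-}$ is the restriction to the element on the other side of the face, and $u^h_{|K^-}=u^h_{|K}$ on boundary faces. The weak truncation error of $u^h\in V_h^p$ tested with $\varphi=\sum_\sigma\varphi_\sigma^{\mathrm{dof}}\varphi_\sigma\in V_h$ (coefficients $\varphi_\sigma^{\mathrm{dof}}\in\mathbb R$) is $$\mathcal E(u^h,\varphi)=\sum_\sigma\varphi_\sigma^{\mathrm{dof}}\Big[\sum_{K\ni\sigma}\Phi^K_\sigma(u^h)+\sum_{\Gamma\ni\sigma}\Phi^\Gamma_\sigma(u^h)\Big]\in\mathbb R^p .$$ *Assumptions.* 1. $u:\overline\Omega\to\mathcal D$ is a smooth steady solution: $u$ and all $f_j(u)$ are $C^{k+1}$ on $\overline\Omega$, $\operatorname{div}f(u)=0$ in $\Omega$, and $(\nabla_uf(u)\cdot n)^-(u-u_b)=0$ on $\partial\Omega$, with boundary data $u_b:\partial\Omega\to\mathcal D$ and $n$ the outward unit normal of each boundary face. 2. $\pi_h(u)\in V_h^p$ has values in $\mathcal D$ and $\sup_K|\pi_h(u)-u|=O(h^{k+1})$ uniformly in $K$. 3. For every $\psi\in C^{k+1}(\overline\Omega)$,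 uniformly in the elements $K$ and the faces $e$, $\int_K\psi\,dx=\oint_K\psi\,dx+O(h^{d+k+1})$ and $\int_e\psi\,d\gamma=\oint_e\psi\,d\gamma+O(h^{d+k})$. 4. $\Phi^K_\sigma(\pi_h(u))=O(h^{k+d})$ and $\Phi^\Gamma_\sigma(\pi_h(u))=O(h^{k+d-1})$, uniformly. Then there is a constant $C$, independent of $h$ and $\varphi$, such that for every member of the family and every continuous $\varphi\in V_h$ with $\varphi=0$ on $\partial\Omega$ $$|\mathcal E(\pi_h(u),\varphi)|\le C\,\|\varphi\|_{H^1(\Omega)}\,h^{k+1}.$$ Moreover, with the same $C$, for every continuous $\varphi\in V_h$ (without a boundary condition), $$|\mathcal E(\pi_h(u),\varphi)|\le C\big(\|\varphi\|_{H^1(\Omega)}+M\big)h^{k+1}$$ whenever $M\ge0$ bounds $|\varphi|$ on $\partial\Omega$ and the Lipschitz constant of $\varphi$ on each boundary face. (The family is arbitrary, so $C$ depends only on $\Omega$, $f$, $\hat f$, $\mathcal F$, $u$, $u_b$, the reference element and the constants in the assumptions.) -/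

import Mathlib

open MeasureTheory Set
open scoped BigOperators

/-- The Euclidean space `ℝ^d` of the space variable. -/
abbrev Pt (d : ℕ) : Type := EuclideanSpace ℝ (Fin d)

/-- The Euclidean space `ℝ^p` of the conserved quantities. -/
abbrev St (p : ℕ) : Type := EuclideanSpace ℝ (Fin p)

/-- The closed simplex spanned by a family of points. -/
def simplexSet {d n : ℕ} (v : Fin n → Pt d) : Set (Pt d) :=
  convexHull ℝ (Set.range v)

/-! ### The hyperbolic problem -/

/-- The normal flux `f(a) · n = ∑ j, n_j f_j(a)`. -/
noncomputable def normalFlux {d p : ℕ} (f : Fin d → St p → St p) (n : Pt d) (a : St p) : St p :=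
  ∑ j, n j • f j a

/-- The normal Jacobian `∇_u f(a) · n = ∑ j, n_j Df_j(a)`. -/
noncomputable def normalJacobian {d p : ℕ} (f : Fin d → St p → St p) (n : Pt d) (a : St p) :
    St p →L[ℝ] St p :=
  ∑ j, n j • fderiv ℝ (f j) a

/-- `B = A⁻`: the operator `A` is diagonalisable over `ℝ`, and in a basis of eigenvectors, with
eigenvalues `ev i`, the operator `B` is diagonal with entries `min (ev i) 0`. -/
def IsNegativePart {p : ℕ} (A B : St p →L[ℝ] St p) : Prop :=
  ∃ (b : Module.Basis (Fin p) ℝ (St p)) (ev : Fin p → ℝ),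
    ∀ i, A (b i) = ev i • b i ∧ B (b i) = min (ev i) 0 • b i

/-- `u` satisfies `div f(u) = 0` pointwise in `Ω`. -/
def IsSteadySolution {d p : ℕ} (Ω : Set (Pt d)) (f : Fin d → St p → St p)
    (u : Pt d → St p) : Prop :=
  ∀ x ∈ Ω, ∑ j, fderiv ℝ (fun y => f j (u y)) x (EuclideanSpace.single j (1 : ℝ)) = 0

/-- A numerical flux `fhat n a b` on the state space `D`: it is consistent with `f`, it changes
sign when it is seen from the other side of a face, and it is Lipschitz continuous in the states,
uniformly in the unit vector `n`. -/
structure IsNumericalFlux {d p : ℕ} (D : Set (St p)) (f : Fin d → St p → St p)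
    (fhat : Pt d → St p → St p → St p) : Prop where
  consistent : ∀ n : Pt d, ‖n‖ = 1 → ∀ a ∈ D, fhat n a a = normalFlux f n a
  conservative : ∀ n : Pt d, ‖n‖ = 1 → ∀ a ∈ D, ∀ b ∈ D, fhat (-n) b a = -fhat n a b
  lipschitz : ∃ L : ℝ, ∀ n : Pt d, ‖n‖ = 1 → ∀ a ∈ D, ∀ b ∈ D, ∀ a' ∈ D, ∀ b' ∈ D,
    ‖fhat n a b - fhat n a' b'‖ ≤ L * (‖a - a'‖ + ‖b - b'‖)

/-- An upwind flux for the boundary: it equals `f(a) · n` as soon as the boundary state `b`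
does not differ from `a` along the incoming characteristics, i.e. `(∇f(a) · n)⁻ (a - b) = 0`,
and it is Lipschitz continuous in the inner state. The flux
`f(a) · n + (∇f(a) · n)⁻ (b - a)`, which is `(∇f(a) · n)⁺ a + (∇f(a) · n)⁻ b` if
`f(a) · n = (∇f(a) · n) a`, has the first property. -/
structure IsUpwindBoundaryFlux {d p : ℕ} (D : Set (St p)) (f : Fin d → St p → St p)
    (fbd : Pt d → St p → St p → St p) : Prop where
  upwind : ∀ n : Pt d, ‖n‖ = 1 → ∀ a ∈ D, ∀ b ∈ D, ∀ B : St p →L[ℝ] St p,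
    IsNegativePart (normalJacobian f n a) B → B (a - b) = 0 → fbd n a b = normalFlux f n a
  lipschitz : ∃ L : ℝ, ∀ n : Pt d, ‖n‖ = 1 → ∀ a ∈ D, ∀ a' ∈ D, ∀ b ∈ D,
    ‖fbd n a b - fbd n a' b‖ ≤ L * ‖a - a'‖

/-! ### Finite elements -/

/-- The barycentric coordinates of a point `ξ` of the reference simplex
`{ξ | 0 ≤ ξ_j, ∑ ξ_j ≤ 1}`. -/
noncomputable def refBary {d : ℕ} (ξ : Fin d → ℝ) : Fin (d + 1) → ℝ :=
  Fin.cons (1 - ∑ j, ξ j) ξ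

/-- A reference finite element of degree `k`: shape functions which are a basis of the polynomials
of degree at most `k` and sum up to one, such that on (the hyperplane of) every facet the shape
functions that do not vanish identically there are linearly independent. The Lagrange and the
Bézier (Bernstein) shape functions are examples. -/
structure RefElement (d k : ℕ) where
  Idx : Type
  [fintypeIdx : Fintype Idx]
  shape : Module.Basis Idx ℝ (MvPolynomial.restrictTotalDegree (Fin d) ℝ k)
  sum_shape : ∑ i, (shape i : MvPolynomial (Fin d) ℝ) = 1
  facet_independent : ∀ (l : Fin (d + 1)) (c : Idx → ℝ),
    (∀ ξ : Fin d → ℝ, refBary ξ l = 0 →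
      ∑ i, c i * MvPolynomial.eval ξ (shape i : MvPolynomial (Fin d) ℝ) = 0) →
    ∀ i, (∃ ξ : Fin d → ℝ, refBary ξ l = 0 ∧
      MvPolynomial.eval ξ (shape i : MvPolynomial (Fin d) ℝ) ≠ 0) → c i = 0

attribute [instance] RefElement.fintypeIdx

/-- A simplicial mesh of `Ω`, not necessarily conformal. The faces are `(d-1)`-simplices: the
inner ones are shared by the elements `left f` and `K` with `right f = some K`, the boundary ones
(`right f = none`) belong to `left f` only. `normal f` is the unit normal that points out of
`left f`. In a conformal mesh the faces are the facets of the elements. -/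
structure Mesh {d : ℕ} (Ω : Set (Pt d)) where
  Elem : Type
  [fintypeElem : Fintype Elem]
  Face : Type
  [fintypeFace : Fintype Face]
  vert : Elem → AffineBasis (Fin (d + 1)) ℝ (Pt d)
  faceVert : Face → Fin d → Pt d
  faceVert_indep : ∀ f, AffineIndependent ℝ (faceVert f)
  left : Face → Elem
  right : Face → Option Elem
  normal : Face → Pt d
  closure_eq : closure Ω = ⋃ K, simplexSet (vert K)
  disjoint_interior : ∀ K K', K ≠ K' →
    Disjoint (interior (simplexSet (vert K))) (interior (simplexSet (vert K')))
  left_ne_right : ∀ f, right f ≠ some (left f)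
  frontier_elem : ∀ K, frontier (simplexSet (vert K)) =
    ⋃ f ∈ {f | left f = K ∨ right f = some K}, simplexSet (faceVert f)
  frontier_domain : frontier Ω = ⋃ f ∈ {f | right f = none}, simplexSet (faceVert f)
  face_overlap : ∀ f f', f ≠ f' →
    (Measure.euclideanHausdorffMeasure (d - 1) : Measure (Pt d))
      (simplexSet (faceVert f) ∩ simplexSet (faceVert f')) = 0
  norm_normal : ∀ f, ‖normal f‖ = 1
  normal_left : ∀ f, ∀ x ∈ simplexSet (faceVert f), ∀ y ∈ simplexSet (vert (left f)),
    inner ℝ (normal f) (y - x) ≤ 0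
  normal_right : ∀ f K, right f = some K →
    ∀ x ∈ simplexSet (faceVert f), ∀ y ∈ simplexSet (vert K), 0 ≤ inner ℝ (normal f) (y - x)

attribute [instance] Mesh.fintypeElem Mesh.fintypeFace

namespace Mesh

variable {d : ℕ} {Ω : Set (Pt d)}

/-- The closed simplex `K`. -/
def cell (M : Mesh Ω) (K : M.Elem) : Set (Pt d) := simplexSet (M.vert K)

/-- The closed `(d-1)`-simplex `f`. -/
def face (M : Mesh Ω) (f : M.Face) : Set (Pt d) := simplexSet (M.faceVert f)

/-- The `(d-1)`-dimensional surface measure (the counting measure for `d = 1`). -/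
noncomputable def surface (d : ℕ) : Measure (Pt d) :=
  Measure.euclideanHausdorffMeasure (d - 1)

open Classical in
/-- The faces of which the boundary of `K` consists. -/
noncomputable def facesOf (M : Mesh Ω) (K : M.Elem) : Finset M.Face :=
  Finset.univ.filter fun f => M.left f = K ∨ M.right f = some K

open Classical in
/-- The boundary faces `Γ ⊂ ∂Ω`. -/
noncomputable def bdryFaces (M : Mesh Ω) : Finset M.Face :=
  Finset.univ.filter fun f => M.right f = none

open Classical in
/-- The unit normal on the face `f` of `K` that points out of `K`. -/
noncomputable def outNormal (M : Mesh Ω) (K : M.Elem) (f : M.Face) : Pt d :=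
  if M.left f = K then M.normal f else -M.normal f

open Classical in
/-- The element on the other side of the face `f` of `K`; for a boundary face it is `K` itself. -/
noncomputable def across (M : Mesh Ω) (K : M.Elem) (f : M.Face) : M.Elem :=
  if M.left f = K then (M.right f).getD K else M.left f

end Mesh

/-- A quadrature rule with its points in `s`. -/
structure QuadRule {d : ℕ} (s : Set (Pt d)) where
  size : ℕ
  node : Fin size → Pt d
  weight : Fin size → ℝ
  node_mem : ∀ q, node q ∈ s

/-- `∑ q, ω_q g(x_q)`. -/
noncomputable def QuadRule.apply {d : ℕ} {s : Set (Pt d)} (Q : QuadRule s)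
    {F : Type*} [AddCommGroup F] [Module ℝ F] (g : Pt d → F) : F :=
  ∑ q, Q.weight q • g (Q.node q)

/-- A residual distribution scheme of degree `k` on `Ω` for `p` unknowns: the mesh parameter `h`,
the mesh, the degrees of freedom with the local numbering `dof K` of those of `K`, one quadrature
rule for each element and each face (the same seen from both sides), and the element and boundary
residuals `Φ_σ^K(U)`, `Φ_σ^Γ(U)`, which depend on the coefficients `U` of a finite element function.
Nothing is prescribed on which local degrees of freedom of different elements are identified:
identifying none gives the discontinuous finite element space, identifying those that sit at the
same point gives the continuous one. -/
structure Scheme {d k : ℕ} (Ω : Set (Pt d)) (R : RefElement d k) (p : ℕ) where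
  h : ℝ
  mesh : Mesh Ω
  Dof : Type
  [fintypeDof : Fintype Dof]
  dof : mesh.Elem → R.Idx → Dof
  dof_injective : ∀ K, Function.Injective (dof K)
  elemQuad : ∀ K, QuadRule (mesh.cell K)
  faceQuad : ∀ f, QuadRule (mesh.face f)
  elemRes : (Dof → St p) → mesh.Elem → Dof → St p
  bdryRes : (Dof → St p) → mesh.Face → Dof → St p

attribute [instance] Scheme.fintypeDof

namespace Scheme

variable {d k p : ℕ} {Ω : Set (Pt d)} {R : RefElement d k}

/-- The `i`-th basis function of the element `K`: the shape function in the barycentric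
coordinates of `K`. -/
noncomputable def basisFun (S : Scheme Ω R p) (K : S.mesh.Elem) (i : R.Idx) (x : Pt d) : ℝ :=
  MvPolynomial.eval (fun j : Fin d => (S.mesh.vert K).coord j.succ x)
    (R.shape i : MvPolynomial (Fin d) ℝ)

/-- The restriction to `K` of the finite element function with the coefficients `v`. -/
noncomputable def eval (S : Scheme Ω R p) {F : Type*} [AddCommGroup F] [Module ℝ F]
    (v : S.Dof → F) (K : S.mesh.Elem) (x : Pt d) : F :=
  ∑ i, S.basisFun K i x • v (S.dof K i)

open Classical in
/-- The degrees of freedom `σ ∈ K`. -/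
noncomputable def dofsElem (S : Scheme Ω R p) (K : S.mesh.Elem) : Finset S.Dof :=
  Finset.univ.filter fun σ => ∃ i, S.dof K i = σ

open Classical in
/-- The degrees of freedom `σ ∈ Γ` of a boundary face: those of its element whose basis function
does not vanish identically on `Γ`. -/
noncomputable def dofsBdry (S : Scheme Ω R p) (Γ : S.mesh.Face) : Finset S.Dof :=
  Finset.univ.filter fun σ => ∃ i, S.dof (S.mesh.left Γ) i = σ ∧
    ∃ x ∈ S.mesh.face Γ, S.basisFun (S.mesh.left Γ) i x ≠ 0

/-- The numerical integral over `K`. -/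
noncomputable def elemInt (S : Scheme Ω R p) {F : Type*} [AddCommGroup F] [Module ℝ F]
    (K : S.mesh.Elem) (g : Pt d → F) : F :=
  (volume : Measure (Pt d)).real (S.mesh.cell K) • (S.elemQuad K).apply g

/-- The numerical integral over the face `f`. -/
noncomputable def faceInt (S : Scheme Ω R p) {F : Type*} [AddCommGroup F] [Module ℝ F]
    (f : S.mesh.Face) (g : Pt d → F) : F :=
  (Mesh.surface d).real (S.mesh.face f) • (S.faceQuad f).apply g

/-- The finite element function with the coefficients `U` takes its values in `D`. -/
def ValuesIn (S : Scheme Ω R p) (D : Set (St p)) (U : S.Dof → St p) : Prop :=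
  ∀ K, ∀ x ∈ S.mesh.cell K, S.eval U K x ∈ D

/-- The conservation relations: for every finite element function `U` with values in `D`, the
residuals of an element sum up to the numerical integral of the numerical flux over its boundary,
and those of a boundary face to the numerical integral of `fbd n U u_b - f(U) · n`. -/
def IsConservative (S : Scheme Ω R p) (D : Set (St p)) (f : Fin d → St p → St p)
    (fhat fbd : Pt d → St p → St p → St p) (ub : Pt d → St p) : Prop :=
  ∀ U : S.Dof → St p, S.ValuesIn D U →
    (∀ K, ∑ σ ∈ S.dofsElem K, S.elemRes U K σ =
      ∑ e ∈ S.mesh.facesOf K, S.faceInt e fun x =>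
        fhat (S.mesh.outNormal K e) (S.eval U K x) (S.eval U (S.mesh.across K e) x)) ∧
    (∀ Γ ∈ S.mesh.bdryFaces, ∑ σ ∈ S.dofsBdry Γ, S.bdryRes U Γ σ =
      S.faceInt Γ fun x =>
        fbd (S.mesh.normal Γ) (S.eval U (S.mesh.left Γ) x) (ub x)
          - normalFlux f (S.mesh.normal Γ) (S.eval U (S.mesh.left Γ) x))

open Classical in
/-- The weak truncation error
`𝓔(U, φ) = ∑ σ, φ_σ (∑_{K ∋ σ} Φ_σ^K(U) + ∑_{Γ ∋ σ} Φ_σ^Γ(U))`. -/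
noncomputable def truncationError (S : Scheme Ω R p) (U : S.Dof → St p) (v : S.Dof → ℝ) : St p :=
  ∑ σ, v σ • (∑ K with σ ∈ S.dofsElem K, S.elemRes U K σ
    + ∑ Γ ∈ S.mesh.bdryFaces with σ ∈ S.dofsBdry Γ, S.bdryRes U Γ σ)

/-- The function `φ` is the finite element function with the coefficients `v` on every closed
element. In particular it is single-valued on the faces, i.e. continuous on `closure Ω`. -/
def IsContinuousFE (S : Scheme Ω R p) (φ : Pt d → ℝ) (v : S.Dof → ℝ) : Prop :=
  ∀ K, ∀ x ∈ S.mesh.cell K, φ x = S.eval v K x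

/-- `M ≥ 0` bounds `|φ|` on `∂Ω` and the Lipschitz constant of `φ` on every boundary face. -/
def IsBoundaryBound (S : Scheme Ω R p) (φ : Pt d → ℝ) (M : ℝ) : Prop :=
  0 ≤ M ∧ (∀ x ∈ frontier Ω, |φ x| ≤ M) ∧
  ∀ Γ ∈ S.mesh.bdryFaces, ∀ x ∈ S.mesh.face Γ, ∀ y ∈ S.mesh.face Γ, |φ x - φ y| ≤ M * ‖x - y‖

end Scheme

/-- The norm of `H¹(Ω)`, for functions `φ` whose weak gradient is the almost everywhere classical
one (such as continuous piecewise polynomials). -/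
noncomputable def h1Norm {d : ℕ} (Ω : Set (Pt d)) (φ : Pt d → ℝ) : ℝ :=
  Real.sqrt ((∫ x in Ω, (φ x) ^ 2) + ∫ x in Ω, ‖fderiv ℝ φ x‖ ^ 2)

/-! ### Families of schemes -/

section Families

variable {d k p : ℕ} {Ω : Set (Pt d)} {R : RefElement d k} {ι : Type*}

/-- The meshes are regular (shape regular and quasi-uniform), with mesh parameter `h`: elements
have diameter at most `h`, volume at least `c h^d`, and faces have area at least `c h^(d-1)`. -/
def IsRegularFamily (S : ι → Scheme Ω R p) : Prop :=
  ∃ c : ℝ, 0 < c ∧ ∀ i, 0 < (S i).h ∧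
    (∀ K, Metric.diam ((S i).mesh.cell K) ≤ (S i).h ∧
      c * (S i).h ^ d ≤ (volume : Measure (Pt d)).real ((S i).mesh.cell K)) ∧
    ∀ f, c * (S i).h ^ (d - 1) ≤ (Mesh.surface d).real ((S i).mesh.face f)

/-- The quadrature weights are bounded: `∑ q, |ω_q| ≤ W` for all elements and faces. -/
def HasBoundedWeights (S : ι → Scheme Ω R p) : Prop :=
  ∃ W : ℝ, ∀ i, (∀ K, ∑ q, |((S i).elemQuad K).weight q| ≤ W) ∧
    ∀ f, ∑ q, |((S i).faceQuad f).weight q| ≤ W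

/-- The quadrature rules are of order `k + 1`: for every `ψ` of class `C^(k+1)` on `closure Ω` the
errors are `O(h^(d+k+1))` on elements and `O(h^(d+k))` on faces. -/
def HasQuadratureOrder (S : ι → Scheme Ω R p) : Prop :=
  ∀ ψ : Pt d → ℝ, ContDiffOn ℝ ((k + 1 : ℕ) : WithTop ℕ∞) ψ (closure Ω) →
    ∃ C : ℝ, ∀ i,
      (∀ K, |(∫ x in (S i).mesh.cell K, ψ x) - (S i).elemInt K ψ| ≤ C * (S i).h ^ (d + k + 1)) ∧
      ∀ f, |(∫ x in (S i).mesh.face f, ψ x ∂(Mesh.surface d)) - (S i).faceInt f ψ|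
        ≤ C * (S i).h ^ (d + k)

/-- The finite element functions `U i` approximate `u` with order `k + 1`. -/
def IsAccurate (S : ι → Scheme Ω R p) (u : Pt d → St p) (U : ∀ i, (S i).Dof → St p) : Prop :=
  ∃ C : ℝ, ∀ i, ∀ K, ∀ x ∈ (S i).mesh.cell K,
    ‖(S i).eval (U i) K x - u x‖ ≤ C * (S i).h ^ (k + 1)

/-- `Φ_σ^K(U) = O(h^(k+d))` and `Φ_σ^Γ(U) = O(h^(k+d-1))`. -/
def HasResidualOrder (S : ι → Scheme Ω R p) (U : ∀ i, (S i).Dof → St p) : Prop :=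
  ∃ C : ℝ, ∀ i,
    (∀ K, ∀ σ ∈ (S i).dofsElem K, ‖(S i).elemRes (U i) K σ‖ ≤ C * (S i).h ^ (k + d)) ∧
    ∀ Γ ∈ (S i).mesh.bdryFaces, ∀ σ ∈ (S i).dofsBdry Γ,
      ‖(S i).bdryRes (U i) Γ σ‖ ≤ C * (S i).h ^ (k + d - 1)

/-- The boundary condition `(∇f(u) · n)⁻ (u - u_b) = 0` on `∂Ω`, where `n` is the outward unit
normal of a boundary face. -/
def SatisfiesBoundaryCondition (S : ι → Scheme Ω R p) (f : Fin d → St p → St p)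
    (u ub : Pt d → St p) : Prop :=
  ∀ i, ∀ Γ ∈ (S i).mesh.bdryFaces, ∀ x ∈ (S i).mesh.face Γ,
    ∃ B : St p →L[ℝ] St p,
      IsNegativePart (normalJacobian f ((S i).mesh.normal Γ) (u x)) B ∧ B (u x - ub x) = 0

end Families

/-! A single residual is only O(h^(k+d)), and there are about h^(-d) elements, so a termwise
estimate loses one power of h. That power comes back through conservation, which allows constants to
be subtracted from the test function.

Write d = m + 1. On a face e of K let r(K, e) be the numerical integral of the numerical flux of U
minus the exact integral of f(u)·n (`Scheme.fluxDefect`). By the divergence theorem the exact fluxes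
of a steady solution through ∂K add up to zero (`IsSteadySolution.sum_face_integral_eq_zero`), so
the residuals of K add up to the sum of the r(K, e). Consistency, accuracy and the quadrature order
give r(K, e) = O(h^(k+d)) (`exists_fluxDefect_bound`), and conservativity makes the defects from the
two sides of an inner face opposite (`Scheme.fluxDefect_right`). Hence for any numbers c_K and a_e
the error regroups (`Scheme.truncationError_eq_sum`) into the element terms ∑ (v_σ - c_K) Φ_σ^K + ∑
(c_K - a_e) r(K, e) and boundary terms. Here c_K and a_e are values of φ at a vertex of K and of e.

In the element terms the differences are at most a constant times h^(1-d/2) times the L² norm of ∇φ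
on K. This is a scaled Poincaré inequality on the finite-dimensional local space
(`RefElement.exists_coeff_sub_le`). Each element contributes h^(k+1) · h^(d/2) ‖∇φ‖_K, and
Cauchy–Schwarz with O(h^(-d)) elements gives h^(k+1) times the H¹ norm (`Scheme.sum_gradNorm_le`).

There are O(h^(-m)) boundary faces. On each of them the coefficients differ from a_Γ by O(M h)
(`Scheme.exists_bdry_coeff_le`), which compensates for the weaker bound on the boundary residuals.
The sum of these residuals is O(h^(k+d)) by the upwind property (`exists_bdryRes_sum_bound`). The
total is O(M h^(k+1)), and zero boundary values are the case M = 0.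

Faces need not be whole facets. `Mesh.exists_facet` places each face in one facet and identifies its
normal, and `Mesh.integral_facet_eq_sum` tiles the facets by faces. -/

/-! ### Simplices as images of the reference simplex -/

/-- The closed reference simplex of `ℝ^n`. -/
def refSimplex (n : ℕ) : Set (Pt n) := {x | (∀ j, 0 ≤ x j) ∧ ∑ j, x j ≤ 1}

lemma sum_refBary {n : ℕ} (ξ : Fin n → ℝ) : ∑ i, refBary ξ i = 1 := by
  simp [refBary, Fin.sum_univ_succ]

lemma mem_refSimplex {n : ℕ} {x : Pt n} : x ∈ refSimplex n ↔ ∀ i, 0 ≤ refBary x.ofLp i := by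
  rw [Fin.forall_fin_succ]
  simp [refSimplex, refBary, and_comm]

lemma convex_refSimplex (n : ℕ) : Convex ℝ (refSimplex n) := by
  rintro x ⟨hx, hx'⟩ y ⟨hy, hy'⟩ a b ha hb hab
  refine ⟨fun j => ?_, ?_⟩
  · have := hx j; have := hy j
    simp only [PiLp.add_apply, PiLp.smul_apply, smul_eq_mul]; positivity
  · simp only [PiLp.add_apply, PiLp.smul_apply, smul_eq_mul, Finset.sum_add_distrib,
      ← Finset.mul_sum]
    nlinarith

lemma isClosed_refSimplex (n : ℕ) : IsClosed (refSimplex n) := by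
  refine IsClosed.inter ?_ ?_
  · exact isClosed_le (f := fun (_ : Pt n) (_ : Fin n) => (0 : ℝ)) (g := fun x => x.ofLp)
      (by fun_prop) (by fun_prop)
  · exact isClosed_le (f := fun x : Pt n => ∑ j, x j) (g := fun _ => 1) (by fun_prop) (by fun_prop)

lemma isCompact_refSimplex (n : ℕ) : IsCompact (refSimplex n) := by
  refine Metric.isCompact_of_isClosed_isBounded (isClosed_refSimplex n) ?_
  refine (Metric.isBounded_closedBall (x := (0 : Pt n)) (r := 1)).subset fun x hx => ?_
  rw [mem_closedBall_zero_iff, EuclideanSpace.norm_eq, Real.sqrt_le_one]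
  have h1 : ∀ j, x j ≤ 1 := fun j =>
    (Finset.single_le_sum (fun i _ => hx.1 i) (Finset.mem_univ j)).trans hx.2
  refine (Finset.sum_le_sum fun j _ => ?_).trans hx.2
  have := hx.1 j; have := h1 j
  rw [Real.norm_eq_abs, sq_abs]; nlinarith

lemma interior_refSimplex_nonempty (n : ℕ) : (interior (refSimplex n)).Nonempty := by
  refine ⟨WithLp.toLp 2 fun _ => 1 / ((n : ℝ) + 1), mem_interior.2
    ⟨(⋂ j, {x | 0 < x j}) ∩ {x | ∑ j, x j < 1}, ?_, ?_, ?_, ?_⟩⟩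
  · exact fun x hx => ⟨fun j => (mem_iInter.1 hx.1 j).le, hx.2.le⟩
  · refine IsOpen.inter (isOpen_iInter_of_finite fun j =>
      isOpen_lt (f := fun _ => 0) (g := fun x : Pt n => x j) (by fun_prop) (by fun_prop)) ?_
    exact isOpen_lt (f := fun x : Pt n => ∑ j, x j) (g := fun _ => 1) (by fun_prop) (by fun_prop)
  · refine mem_iInter.2 fun j => ?_
    change (0 : ℝ) < 1 / ((n : ℝ) + 1)
    positivity
  · change ∑ _ : Fin n, 1 / ((n : ℝ) + 1) < 1
    simp only [Finset.sum_const, Finset.card_univ, Fintype.card_fin, nsmul_eq_mul]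
    rw [mul_one_div, div_lt_one (by positivity)]; linarith

/-- From an interior point a small step in any direction stays in the simplex: the direction -e_j
makes x_j ≥ 0 strict, and e_j makes the bound on the sum strict. -/
lemma pos_of_mem_interior_refSimplex {n : ℕ} {x : Pt n} (hx : x ∈ interior (refSimplex n)) :
    (∀ j, 0 < x j) ∧ ∑ j, x j < 1 := by
  have key : ∀ y : Pt n, ∃ t : ℝ, 0 < t ∧ x + t • y ∈ refSimplex n := by
    intro y
    have hc : Filter.Tendsto (fun t : ℝ => x + t • y) (nhds 0) (nhds x) := by
      have : Continuous fun t : ℝ => x + t • y := by fun_prop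
      simpa using this.tendsto 0
    have h1 := hc.eventually (mem_interior_iff_mem_nhds.1 hx)
    obtain ⟨ε, hε, h2⟩ := Metric.eventually_nhds_iff.1 h1
    refine ⟨ε / 2, by positivity, h2 ?_⟩
    rw [Real.dist_eq, sub_zero, abs_of_pos (by positivity)]; linarith
  constructor
  · intro j
    obtain ⟨t, ht, h⟩ := key (-EuclideanSpace.single j 1)
    have := h.1 j
    simp at this
    linarith
  · rcases isEmpty_or_nonempty (Fin n) with hn | ⟨⟨j⟩⟩
    · simp
    obtain ⟨t, ht, h⟩ := key (EuclideanSpace.single j 1)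
    have := h.2
    simp only [PiLp.add_apply, PiLp.smul_apply, smul_eq_mul, Finset.sum_add_distrib,
      ← Finset.mul_sum] at this
    simp at this
    linarith

lemma measurableSet_refSimplex (n : ℕ) : MeasurableSet (refSimplex n) :=
  (isClosed_refSimplex n).measurableSet

lemma volume_refSimplex_ne_top (n : ℕ) : volume (refSimplex n) ≠ ⊤ :=
  (isCompact_refSimplex n).measure_lt_top.ne

lemma volume_real_refSimplex_pos (n : ℕ) : 0 < (volume : Measure (Pt n)).real (refSimplex n) :=
  ENNReal.toReal_pos (Measure.measure_pos_of_nonempty_interior _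
    (interior_refSimplex_nonempty n)).ne' (volume_refSimplex_ne_top n)

variable {n d : ℕ}

/-- The linear map that sends the unit vectors to the edges `v j - v 0`. -/
def edgeMap (v : Fin (n + 1) → Pt d) : Pt n →ₗ[ℝ] Pt d where
  toFun x := ∑ j, x j • (v j.succ - v 0)
  map_add' x y := by simp [add_smul, Finset.sum_add_distrib]
  map_smul' c x := by simp [mul_smul, Finset.smul_sum]

lemma edgeMap_apply (v : Fin (n + 1) → Pt d) (x : Pt n) :
    edgeMap v x = ∑ j, x j • (v j.succ - v 0) := rfl

@[simp] lemma edgeMap_single (v : Fin (n + 1) → Pt d) (j : Fin n) :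
    edgeMap v (EuclideanSpace.single j 1) = v j.succ - v 0 := by
  rw [edgeMap_apply, Finset.sum_eq_single j] <;> simp +contextual

/-- The affine map that sends the vertices of the reference simplex to `v`. -/
def simplexMap (v : Fin (n + 1) → Pt d) (x : Pt n) : Pt d := v 0 + edgeMap v x

lemma continuous_simplexMap (v : Fin (n + 1) → Pt d) : Continuous (simplexMap v) :=
  continuous_const.add (LinearMap.continuous_of_finiteDimensional _)

lemma simplexMap_eq_sum (v : Fin (n + 1) → Pt d) (x : Pt n) :
    simplexMap v x = ∑ i, refBary x.ofLp i • v i := by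
  simp [simplexMap, edgeMap_apply, refBary, Fin.sum_univ_succ, smul_sub, sub_smul,
    Finset.sum_sub_distrib, Finset.sum_smul]
  abel

lemma simplexSet_eq_image (v : Fin (n + 1) → Pt d) :
    simplexSet v = simplexMap v '' refSimplex n := by
  apply Subset.antisymm
  · refine convexHull_min ?_ ?_
    · rintro _ ⟨i, rfl⟩
      refine Fin.cases ⟨0, by simp [refSimplex], by simp [simplexMap]⟩ (fun j => ?_) i
      refine ⟨EuclideanSpace.single j 1, ⟨fun i => ?_, by simp⟩, by simp [simplexMap]⟩
      by_cases h : i = j <;> simp [h]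
    · have := ((convex_refSimplex n).linear_image (edgeMap v)).translate (v 0)
      rwa [image_image] at this
  · rintro _ ⟨x, hx, rfl⟩
    rw [simplexMap_eq_sum]
    exact (convex_convexHull ℝ _).sum_mem (fun i _ => mem_refSimplex.1 hx i) (sum_refBary _)
      fun i _ => subset_convexHull _ _ (mem_range_self i)

lemma isCompact_simplexSet (v : Fin n → Pt d) : IsCompact (simplexSet v) :=
  (finite_range v).isCompact_convexHull ℝ

lemma measurableSet_simplexSet (v : Fin n → Pt d) : MeasurableSet (simplexSet v) :=
  (isCompact_simplexSet v).isClosed.measurableSet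

open scoped MeasureTheory in
-- The area formula for the linear part; the translation by the first vertex is an isometry.
lemma hausdorff_simplexMap_image (v : Fin (n + 1) → Pt d) (s : Set (Pt n)) :
    (μHE[n] : Measure (Pt d)) (simplexMap v '' s) =
      ENNReal.ofReal (edgeMap v).normDet * volume s := by
  have h := (edgeMap v).euclideanHausdorffMeasure_image_eq_normDet_mul_volume s
  rw [finrank_euclideanSpace_fin] at h
  rw [← h]
  have : simplexMap v '' s = (fun x => v 0 + x) '' (edgeMap v '' s) := by
    rw [image_image]; rfl
  rw [this]
  exact (IsometryEquiv.addLeft (v 0)).isometry.euclideanHausdorffMeasure_image _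

open scoped MeasureTheory in
lemma hausdorff_simplexSet (v : Fin (n + 1) → Pt d) :
    (μHE[n] : Measure (Pt d)).real (simplexSet v) =
      (edgeMap v).normDet * (volume : Measure (Pt n)).real (refSimplex n) := by
  rw [simplexSet_eq_image, measureReal_def, hausdorff_simplexMap_image, ENNReal.toReal_mul,
    ENNReal.toReal_ofReal (LinearMap.normDet_nonneg _), measureReal_def]

open scoped MeasureTheory in
lemma hausdorff_simplexSet_ne_top (v : Fin (n + 1) → Pt d) :
    (μHE[n] : Measure (Pt d)) (simplexSet v) ≠ ⊤ := by
  rw [simplexSet_eq_image, hausdorff_simplexMap_image]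
  exact ENNReal.mul_ne_top ENNReal.ofReal_ne_top (volume_refSimplex_ne_top n)

open scoped MeasureTheory in
/-- The surface measure on an `n`-simplex is a multiple of the image of the Lebesgue measure. -/
lemma hausdorff_restrict_simplexSet (v : Fin (n + 1) → Pt d) :
    (μHE[n] : Measure (Pt d)).restrict (simplexSet v) =
      ENNReal.ofReal (edgeMap v).normDet •
        (volume.restrict (refSimplex n)).map (simplexMap v) := by
  ext A hA
  rw [Measure.restrict_apply hA, Measure.smul_apply,
    Measure.map_apply (continuous_simplexMap v).measurable hA,
    Measure.restrict_apply ((continuous_simplexMap v).measurable hA), smul_eq_mul,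
    ← hausdorff_simplexMap_image, simplexSet_eq_image, image_preimage_inter]

open scoped MeasureTheory in
lemma integral_simplexSet {E : Type*} [NormedAddCommGroup E] [NormedSpace ℝ E]
    (v : Fin (n + 1) → Pt d) (hv : Function.Injective (simplexMap v)) (g : Pt d → E) :
    ∫ x in simplexSet v, g x ∂(μHE[n] : Measure (Pt d)) =
      (edgeMap v).normDet • ∫ x in refSimplex n, g (simplexMap v x) := by
  have he : MeasurableEmbedding (simplexMap v) :=
    (continuous_simplexMap v).measurableEmbedding hv
  rw [hausdorff_restrict_simplexSet v, integral_smul_measure, he.integral_map,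
    ENNReal.toReal_ofReal (LinearMap.normDet_nonneg _)]

/-! ### Barycentric coordinates and facets of a simplex -/

section Cells

variable {d : ℕ} (b : AffineBasis (Fin (d + 1)) ℝ (Pt d))

lemma coord_sum (w : Fin (d + 1) → ℝ) (hw : ∑ i, w i = 1) (i : Fin (d + 1)) :
    b.coord i (∑ j, w j • b j) = w i := by
  rw [← Finset.univ.affineCombination_eq_linear_combination _ _ hw]
  exact b.coord_apply_combination_of_mem (Finset.mem_univ i) hw

lemma coord_simplexMap (x : Pt d) (i : Fin (d + 1)) :
    b.coord i (simplexMap b x) = refBary x.ofLp i := by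
  rw [simplexMap_eq_sum, coord_sum b _ (sum_refBary _)]

/-- The barycentric coordinates of `x`, without the one of the first vertex. -/
noncomputable def refCoord (x : Pt d) : Pt d := WithLp.toLp 2 fun j => b.coord j.succ x

lemma refBary_refCoord (x : Pt d) (i : Fin (d + 1)) :
    refBary (refCoord b x).ofLp i = b.coord i x := by
  have h := b.sum_coord_apply_eq_one x
  rw [Fin.sum_univ_succ] at h
  refine Fin.cases ?_ (fun j => ?_) i
  · simp [refBary, refCoord]; linarith
  · simp [refBary, refCoord]

lemma simplexMap_refCoord (x : Pt d) : simplexMap b (refCoord b x) = x :=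
  b.ext_elem fun i => by rw [coord_simplexMap, refBary_refCoord]

lemma refCoord_simplexMap (x : Pt d) : refCoord b (simplexMap b x) = x := by
  ext j
  simp [refCoord, coord_simplexMap, refBary]

lemma simplexMap_injective : Function.Injective (simplexMap b) :=
  Function.LeftInverse.injective (refCoord_simplexMap b)

lemma mem_cell {x : Pt d} : x ∈ simplexSet b ↔ ∀ i, 0 ≤ b.coord i x := by
  rw [simplexSet, b.convexHull_eq_nonneg_coord]; rfl

lemma mem_interior_cell {x : Pt d} : x ∈ interior (simplexSet b) ↔ ∀ i, 0 < b.coord i x := by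
  rw [simplexSet, b.interior_convexHull]; rfl

lemma convex_simplexSet {n : ℕ} (v : Fin n → Pt d) : Convex ℝ (simplexSet v) :=
  convex_convexHull ℝ _

lemma mem_frontier_cell {x : Pt d} :
    x ∈ frontier (simplexSet b) ↔ x ∈ simplexSet b ∧ ∃ l, b.coord l x = 0 := by
  rw [(isCompact_simplexSet _).isClosed.frontier_eq, mem_sdiff, mem_interior_cell]
  refine and_congr_right fun h => ?_
  rw [mem_cell] at h
  push Not
  exact exists_congr fun l => ⟨fun hl => le_antisymm hl (h l), fun hl => hl.le⟩

lemma refCoord_mem {x : Pt d} (hx : x ∈ simplexSet b) : refCoord b x ∈ refSimplex d := by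
  rw [mem_refSimplex]
  intro i
  rw [refBary_refCoord]
  exact (mem_cell b).1 hx i

lemma simplexMap_mem {x : Pt d} (hx : x ∈ refSimplex d) : simplexMap b x ∈ simplexSet b := by
  rw [simplexSet_eq_image]; exact mem_image_of_mem _ hx

lemma simplexMap_mem_interior {x : Pt d} (hx : ∀ i, 0 < refBary x.ofLp i) :
    simplexMap b x ∈ interior (simplexSet b) := by
  rw [mem_interior_cell]
  intro i
  rw [coord_simplexMap]; exact hx i

lemma interior_cell_nonempty : (interior (simplexSet b)).Nonempty :=
  interior_convexHull_nonempty_iff_affineSpan_eq_top.2 b.tot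

lemma coord_add (i : Fin (d + 1)) (x v : Pt d) :
    b.coord i (x + v) = b.coord i x + (b.coord i).linear v := by
  have := (b.coord i).map_vadd x v
  simp only [vadd_eq_add] at this
  rw [add_comm x, this, add_comm]

lemma sum_coord_linear (v : Pt d) : ∑ i, (b.coord i).linear v = 0 := by
  have h := b.sum_coord_apply_eq_one (0 + v)
  simp only [coord_add, Finset.sum_add_distrib, b.sum_coord_apply_eq_one] at h
  linarith

/-- The gradients of the barycentric coordinates other than the first form the dual basis of the
edges at the first vertex. This turns a sum of derivatives along edges into a divergence. -/
lemma sum_coord_linear_smul_edge (v : Pt d) :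
    ∑ j : Fin d, (b.coord j.succ).linear v • (b j.succ - b 0) = v := by
  have h : simplexMap b (refCoord b (b 0 + v)) = b 0 + v := simplexMap_refCoord b _
  rw [simplexMap, add_right_inj, edgeMap_apply] at h
  simp only [refCoord, coord_add, b.coord_apply_ne (Fin.succ_ne_zero _), zero_add] at h
  exact h

/-- The gradient of a barycentric coordinate. -/
noncomputable def coordGrad (l : Fin (d + 1)) : Pt d :=
  (InnerProductSpace.toDual ℝ (Pt d)).symm (LinearMap.toContinuousLinearMap (b.coord l).linear)

lemma inner_coordGrad (l : Fin (d + 1)) (x : Pt d) :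
    inner ℝ (coordGrad b l) x = (b.coord l).linear x := by
  rw [coordGrad, InnerProductSpace.toDual_symm_apply]; rfl

lemma coordGrad_apply (l : Fin (d + 1)) (j : Fin d) :
    coordGrad b l j = (b.coord l).linear (EuclideanSpace.single j 1) := by
  rw [← inner_coordGrad, EuclideanSpace.inner_single_right]; simp

end Cells

/-! ### Facets of a simplex, their areas and heights -/

section Facets

variable {m : ℕ} (b : AffineBasis (Fin (m + 2)) ℝ (Pt (m + 1)))

lemma coordGrad_ne_zero (l : Fin (m + 2)) : coordGrad b l ≠ 0 := by
  intro h
  have h1 := coord_add b l (b (l.succAbove 0)) (b l - b (l.succAbove 0))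
  rw [add_sub_cancel, b.coord_apply_eq, b.coord_apply_ne (Fin.succAbove_ne l 0).symm,
    ← inner_coordGrad, h, inner_zero_left] at h1
  norm_num at h1

/-- The vertices of the facet opposite to the vertex `l`. -/
noncomputable def facetVert (l : Fin (m + 2)) : Fin (m + 1) → Pt (m + 1) := fun i => b (l.succAbove i)

lemma simplexMap_facet_eq_sum (l : Fin (m + 2)) (s : Pt m) :
    simplexMap (facetVert b l) s =
      ∑ i, (l.insertNth 0 (refBary s.ofLp) : Fin (m + 2) → ℝ) i • b i := by
  rw [simplexMap_eq_sum, Fin.sum_univ_succAbove _ l]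
  simp [facetVert]

lemma coord_simplexMap_facet (l : Fin (m + 2)) (s : Pt m) (i : Fin (m + 2)) :
    b.coord i (simplexMap (facetVert b l) s) =
      (l.insertNth 0 (refBary s.ofLp) : Fin (m + 2) → ℝ) i := by
  rw [simplexMap_facet_eq_sum, coord_sum]
  rw [Fin.sum_univ_succAbove _ l]
  simp [sum_refBary]

/-- The inverse of `simplexMap (facetVert b l)` on its range. -/
noncomputable def facetCoord (l : Fin (m + 2)) (x : Pt (m + 1)) : Pt m :=
  WithLp.toLp 2 fun i => b.coord (l.succAbove i.succ) x

lemma facetCoord_simplexMap (l : Fin (m + 2)) (s : Pt m) :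
    facetCoord b l (simplexMap (facetVert b l) s) = s := by
  ext i
  simp [facetCoord, coord_simplexMap_facet, refBary]

lemma simplexMap_facet_injective (l : Fin (m + 2)) :
    Function.Injective (simplexMap (facetVert b l)) :=
  Function.LeftInverse.injective (facetCoord_simplexMap b l)

lemma refBary_facetCoord (l : Fin (m + 2)) {x : Pt (m + 1)} (hx : b.coord l x = 0)
    (i : Fin (m + 1)) : refBary (facetCoord b l x).ofLp i = b.coord (l.succAbove i) x := by
  have h := b.sum_coord_apply_eq_one x
  rw [Fin.sum_univ_succAbove _ l, Fin.sum_univ_succ, hx] at h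
  refine Fin.cases ?_ (fun j => ?_) i
  · simp only [refBary, facetCoord, Fin.cons_zero]; linarith
  · simp [refBary, facetCoord]

lemma simplexMap_facetCoord (l : Fin (m + 2)) {x : Pt (m + 1)} (hx : b.coord l x = 0) :
    simplexMap (facetVert b l) (facetCoord b l x) = x := by
  refine b.ext_elem fun i => ?_
  rw [coord_simplexMap_facet]
  rcases Fin.eq_self_or_eq_succAbove l i with rfl | ⟨j, rfl⟩
  · simp [hx]
  · simp [refBary_facetCoord b l hx]

lemma mem_facet {l : Fin (m + 2)} {x : Pt (m + 1)} :
    x ∈ simplexSet (facetVert b l) ↔ x ∈ simplexSet b ∧ b.coord l x = 0 := by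
  rw [simplexSet_eq_image, mem_cell]
  constructor
  · rintro ⟨s, hs, rfl⟩
    rw [mem_refSimplex] at hs
    simp only [coord_simplexMap_facet]
    refine ⟨fun i => ?_, by simp⟩
    rcases Fin.eq_self_or_eq_succAbove l i with rfl | ⟨j, rfl⟩
    · simp
    · simpa using hs j
  · rintro ⟨h, hl⟩
    refine ⟨facetCoord b l x, ?_, simplexMap_facetCoord b l hl⟩
    rw [mem_refSimplex]
    intro i
    rw [refBary_facetCoord b l hl]; exact h _

lemma facet_subset_cell (l : Fin (m + 2)) : simplexSet (facetVert b l) ⊆ simplexSet b :=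
  fun _ hx => ((mem_facet b).1 hx).1

lemma frontier_cell_eq : frontier (simplexSet b) = ⋃ l, simplexSet (facetVert b l) := by
  ext x
  simp [mem_frontier_cell, mem_facet]

open scoped MeasureTheory in
-- In the coordinates of the facet `l`, the other facet lies in the zero set of the affine function
-- given by the coordinate `l'`. This is a proper affine subspace because the vertex `l'` is not in
-- it, hence a null set.
lemma hausdorff_facet_inter {l l' : Fin (m + 2)} (h : l ≠ l') :
    (μHE[m] : Measure (Pt (m + 1)))
      (simplexSet (facetVert b l) ∩ simplexSet (facetVert b l')) = 0 := by
  let A : Pt m →ᵃ[ℝ] ℝ :=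
    (b.coord l').comp ((AffineMap.const ℝ (Pt m) (facetVert b l 0)) +
      (edgeMap (facetVert b l)).toAffineMap)
  have hA : ∀ s, A s = b.coord l' (simplexMap (facetVert b l) s) := fun s => rfl
  let Z : AffineSubspace ℝ (Pt m) := (AffineSubspace.mk' (0 : ℝ) ⊥).comap A
  have hZ : ∀ s, s ∈ Z ↔ b.coord l' (simplexMap (facetVert b l) s) = 0 := by
    intro s
    rw [← hA, AffineSubspace.mem_comap, AffineSubspace.mem_mk']
    simp
  have h0 : volume (Z : Set (Pt m)) = 0 := by
    refine Measure.addHaar_affineSubspace _ _ fun htop => ?_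
    have h1 : facetCoord b l (b l') ∈ Z := htop ▸ AffineSubspace.mem_top _ _ _
    rw [hZ, simplexMap_facetCoord b l (b.coord_apply_ne h), b.coord_apply_eq] at h1
    exact one_ne_zero h1
  refine measure_mono_null (t := simplexMap (facetVert b l) '' Z) ?_ ?_
  · rintro x ⟨hx, hx'⟩
    rw [mem_facet] at hx hx'
    refine ⟨facetCoord b l x, ?_, simplexMap_facetCoord b l hx.2⟩
    rw [SetLike.mem_coe, hZ, simplexMap_facetCoord b l hx.2]; exact hx'.2
  · rw [hausdorff_simplexMap_image, h0, mul_zero]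

open scoped MeasureTheory in
/-- The volume of a simplex is, up to a constant that depends on the dimension only, the area of
a facet times the height over it. -/
lemma volume_cell_eq (l : Fin (m + 2)) :
    volume (simplexSet b) = ‖(‖coordGrad b l‖ ^ 2)⁻¹ • coordGrad b l‖ₑ *
      ((∫⁻ y : ℝ, (Ico 0 1).indicator (fun y => ENNReal.ofReal (|1 - y| ^ m)) y) *
        μHE[m] (simplexSet (facetVert b l))) := by
  set g := coordGrad b l with hg
  have hg0 : g ≠ 0 := coordGrad_ne_zero b l
  -- Along this multiple of the gradient the coordinate `l` grows at unit rate, so the slice at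
  -- height y is the level set where the coordinate equals y. The length of the vector is the height
  -- of the simplex.
  have hv : (‖g‖ ^ 2)⁻¹ • g ≠ 0 := by simp [hg0]
  set p := b (l.succAbove 0) with hp
  have key := EuclideanGeometry.euclideanHausdorffMeasure_eq_lintegral p hv
    (measurableSet_simplexSet b)
  rw [finrank_euclideanSpace_fin, EuclideanSpace.euclideanHausdorffMeasure_eq_volume] at key
  rw [key, ← lintegral_mul_const'']
  · congr 1
    refine lintegral_congr_ae ?_
    -- The slice at y = 1 is the apex, which has positive measure when `m = 0`; it is discarded as a
    -- single value of y.
    have hne : ∀ᵐ y : ℝ, y ≠ 1 := by simp [ae_iff]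
    filter_upwards [hne] with y hy
    have hmem : ∀ z, z ∈ AffineSubspace.mk' (y • (‖g‖ ^ 2)⁻¹ • g +ᵥ p)
        (Submodule.span ℝ {(‖g‖ ^ 2)⁻¹ • g})ᗮ ↔ b.coord l z = y := by
      intro z
      rw [AffineSubspace.mem_mk', Submodule.mem_orthogonal_singleton_iff_inner_right]
      have h1 : b.coord l z = (b.coord l).linear (z - p) := by
        have := coord_add b l p (z - p)
        rwa [add_sub_cancel, hp, b.coord_apply_ne (Fin.succAbove_ne l 0).symm, zero_add] at this
      have h2 : z -ᵥ (y • (‖g‖ ^ 2)⁻¹ • g +ᵥ p) = (z - p) - (y * (‖g‖ ^ 2)⁻¹) • g := by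
        rw [vsub_eq_sub, vadd_eq_add, smul_smul]; abel
      have hgn : ‖g‖ ≠ 0 := norm_ne_zero_iff.2 hg0
      rw [h2, inner_smul_left, inner_sub_right, inner_smul_right, real_inner_self_eq_norm_sq,
        hg, inner_coordGrad, ← h1, ← hg]
      simp only [map_inv₀, conj_trivial, mul_eq_zero, inv_eq_zero]
      field_simp
      rw [or_iff_right (by simpa using hgn), sub_eq_zero]
    by_cases hy' : y ∈ Ico (0 : ℝ) 1
    · rw [indicator_of_mem hy']
      have hy1 : (0 : ℝ) < 1 - y := by linarith [hy'.2]
      -- The slice at height y is the facet shrunk towards the opposite vertex by the factor 1 - y,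
      -- so its area scales with the power m of this factor.
      have := euclideanHausdorffMeasure_homothety_image (P := Pt (m + 1)) (𝕜 := ℝ) m (b l)
        hy1.ne' (simplexSet (facetVert b l))
      rw [ENNReal.smul_def, ENNReal.coe_pow, ← enorm_eq_nnnorm, Real.enorm_eq_ofReal_abs,
        smul_eq_mul] at this
      rw [ENNReal.ofReal_pow (abs_nonneg _), ← this]
      congr 1
      have hcoord : ∀ (c : ℝ) (f : Pt (m + 1)) (i : Fin (m + 2)),
          b.coord i (AffineMap.homothety (b l) c f) =
            c * b.coord i f + (1 - c) * b.coord i (b l) := by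
        intro c f i
        rw [AffineMap.homothety_eq_lineMap, AffineMap.apply_lineMap, AffineMap.lineMap_apply]
        simp; ring
      ext z
      rw [mem_inter_iff, SetLike.mem_coe, hmem]
      constructor
      · rintro ⟨hz, hzy⟩
        rw [mem_cell] at hz
        refine ⟨AffineMap.homothety (b l) (1 - y)⁻¹ z, ?_, ?_⟩
        · have hl : b.coord l (AffineMap.homothety (b l) (1 - y)⁻¹ z) = 0 := by
            rw [hcoord, b.coord_apply_eq, hzy]; field_simp; ring
          rw [mem_facet, mem_cell]
          refine ⟨fun i => ?_, hl⟩
          by_cases hi : i = l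
          · rw [hi, hl]
          · rw [hcoord, b.coord_apply_ne hi, mul_zero, add_zero]
            exact mul_nonneg (inv_nonneg.2 hy1.le) (hz i)
        · refine b.ext_elem fun i => ?_
          rw [hcoord, hcoord]; field_simp; ring
      · rintro ⟨f, hf, rfl⟩
        rw [mem_facet, mem_cell] at hf
        rw [mem_cell]
        refine ⟨fun i => ?_, by rw [hcoord, hf.2, b.coord_apply_eq]; ring⟩
        by_cases hi : i = l
        · rw [hcoord, hi, hf.2, b.coord_apply_eq]; linarith [hy'.1]
        · rw [hcoord, b.coord_apply_ne hi, mul_zero, add_zero]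
          exact mul_nonneg hy1.le (hf.1 i)
    · rw [indicator_of_notMem hy', zero_mul]
      convert! measure_empty (μ := (μHE[m] : Measure (Pt (m + 1))))
      rw [eq_empty_iff_forall_notMem]
      rintro z ⟨hz, hz'⟩
      rw [SetLike.mem_coe, hmem] at hz'
      rw [mem_cell] at hz
      have h1 := hz l
      have h2 : b.coord l z ≤ 1 := by
        rw [← b.sum_coord_apply_eq_one z]
        exact Finset.single_le_sum (fun i _ => hz i) (Finset.mem_univ l)
      rw [hz'] at h1 h2
      exact hy' ⟨h1, lt_of_le_of_ne h2 hy⟩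
  · exact ((by fun_prop : Measurable fun y : ℝ => ENNReal.ofReal (|1 - y| ^ m)).indicator
      measurableSet_Ico).aemeasurable

/-- The surface densities of the parametrisations of the facets are proportional to the norms
of the gradients of the barycentric coordinates. -/
lemma exists_normDet_facet :
    ∃ κ : ℝ, 0 < κ ∧ ∀ l, (edgeMap (facetVert b l)).normDet = κ * ‖coordGrad b l‖ := by
  set c := ∫⁻ y : ℝ, (Ico 0 1).indicator (fun y => ENNReal.ofReal (|1 - y| ^ m)) y with hc
  have hpos : 0 < (volume : Measure (Pt (m + 1))).real (simplexSet b) :=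
    ENNReal.toReal_pos (Measure.measure_pos_of_nonempty_interior _
      (interior_cell_nonempty b)).ne' (isCompact_simplexSet _).measure_lt_top.ne
  -- The left side does not depend on `l`; solving for the density of the facet shows that the
  -- factor in front of the gradient norm is common to all facets.
  have key : ∀ l, (volume : Measure (Pt (m + 1))).real (simplexSet b) =
      ‖coordGrad b l‖⁻¹ * (c.toReal * ((edgeMap (facetVert b l)).normDet *
        (volume : Measure (Pt m)).real (refSimplex m))) := by
    intro l
    have hn : ‖coordGrad b l‖ ≠ 0 := norm_ne_zero_iff.2 (coordGrad_ne_zero b l)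
    rw [measureReal_def, volume_cell_eq b l, ← hc, ENNReal.toReal_mul, ENNReal.toReal_mul,
      ← measureReal_def, hausdorff_simplexSet, toReal_enorm, norm_smul]
    congr 1
    simp only [norm_inv, norm_pow, norm_norm]
    field_simp
  have h0 := key 0
  have hT := volume_real_refSimplex_pos m
  have hc0 : c.toReal ≠ 0 := by
    intro h
    rw [h, zero_mul, mul_zero] at h0
    exact hpos.ne' h0
  have hcp : 0 < c.toReal := lt_of_le_of_ne ENNReal.toReal_nonneg hc0.symm
  refine ⟨(volume : Measure (Pt (m + 1))).real (simplexSet b) /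
    (c.toReal * (volume : Measure (Pt m)).real (refSimplex m)), by positivity, fun l => ?_⟩
  have hn : ‖coordGrad b l‖ ≠ 0 := norm_ne_zero_iff.2 (coordGrad_ne_zero b l)
  rw [key l]
  field_simp

end Facets

/-! ### The divergence theorem on a simplex -/

section Divergence

variable {m : ℕ} {E : Type*} [NormedAddCommGroup E] [NormedSpace ℝ E]

/-- The point of `ℝ^(m+1)` with the `j`-th coordinate `t` and the other coordinates `s`. -/
noncomputable def insertCoord (j : Fin (m + 1)) (t : ℝ) (s : Pt m) : Pt (m + 1) :=
  WithLp.toLp 2 (j.insertNth t s.ofLp)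

lemma insertCoord_eq (j : Fin (m + 1)) (t : ℝ) (s : Pt m) :
    insertCoord j t s = insertCoord j 0 s + t • EuclideanSpace.single j (1 : ℝ) := by
  ext i
  rcases Fin.eq_self_or_eq_succAbove j i with rfl | ⟨i, rfl⟩ <;> simp [insertCoord]

lemma sum_insertCoord (j : Fin (m + 1)) (t : ℝ) (s : Pt m) :
    ∑ i, insertCoord j t s i = t + ∑ i, s i := by
  rw [Fin.sum_univ_succAbove _ j]; simp [insertCoord]

lemma insertCoord_mem_refSimplex (j : Fin (m + 1)) (t : ℝ) (s : Pt m) :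
    insertCoord j t s ∈ refSimplex (m + 1) ↔
      s ∈ refSimplex m ∧ t ∈ Icc 0 (1 - ∑ i, s i) := by
  have h : (∀ i, 0 ≤ insertCoord j t s i) ↔ 0 ≤ t ∧ ∀ i, 0 ≤ s i := by
    rw [Fin.forall_iff_succAbove j]; simp [insertCoord]
  rw [refSimplex, refSimplex, mem_ofPred_eq, mem_ofPred_eq, h, sum_insertCoord, mem_Icc]
  constructor
  · rintro ⟨⟨h1, h2⟩, h3⟩
    exact ⟨⟨h2, by linarith⟩, h1, by linarith⟩
  · rintro ⟨⟨h1, h2⟩, h3, h4⟩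
    exact ⟨⟨h3, h1⟩, by linarith⟩

lemma measurePreserving_insertCoord (j : Fin (m + 1)) :
    MeasurePreserving (fun z : ℝ × Pt m => insertCoord j z.1 z.2) := by
  have h1 : MeasurePreserving (Prod.map id (WithLp.ofLp (p := 2)) : ℝ × Pt m → ℝ × (Fin m → ℝ)) :=
    (MeasurePreserving.id volume).prod (PiLp.volume_preserving_ofLp (Fin m))
  exact (PiLp.volume_preserving_toLp (Fin (m + 1))).comp
    ((volume_preserving_piFinSuccAbove (fun _ => ℝ) j).symm.comp h1)

lemma measurableEmbedding_insertCoord (j : Fin (m + 1)) :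
    MeasurableEmbedding (fun z : ℝ × Pt m => insertCoord j z.1 z.2) :=
  (measurePreserving_insertCoord j).measurable.measurableEmbedding fun z z' h => by
    have h0 : ∀ i, insertCoord j z.1 z.2 i = insertCoord j z'.1 z'.2 i := fun i => by
      simp only [h]
    rw [Fin.forall_iff_succAbove j] at h0
    simp only [insertCoord, Fin.insertNth_apply_same, Fin.insertNth_apply_succAbove] at h0
    exact Prod.ext h0.1 (by ext i; exact h0.2 i)

lemma continuous_insertCoord (j : Fin (m + 1)) (s : Pt m) :
    Continuous fun t => insertCoord j t s := by
  rw [funext fun t => insertCoord_eq j t s]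
  fun_prop

/-- Fubini with the coordinate `j` singled out: the slice over s is the interval from 0 to 1 - ∑ s_i
if s lies in the lower-dimensional reference simplex, and is empty otherwise. -/
lemma integral_refSimplex_succ (j : Fin (m + 1)) (g : Pt (m + 1) → E)
    (hg : IntegrableOn g (refSimplex (m + 1))) :
    ∫ x in refSimplex (m + 1), g x =
      ∫ s in refSimplex m, ∫ t in (0 : ℝ)..(1 - ∑ i, s i), g (insertCoord j t s) := by
  have hi := hg.integrable_indicator (measurableSet_refSimplex _)
  rw [← integral_indicator (measurableSet_refSimplex _),
    ← (measurePreserving_insertCoord j).integral_comp (measurableEmbedding_insertCoord j),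
    Measure.volume_eq_prod, integral_prod_symm, ← integral_indicator (measurableSet_refSimplex _)]
  · refine integral_congr_ae (Filter.Eventually.of_forall fun s => ?_)
    by_cases hs : s ∈ refSimplex m
    · have h1 : 0 ≤ 1 - ∑ i, s i := by linarith [hs.2]
      simp only [indicator_of_mem hs]
      rw [intervalIntegral.integral_of_le h1, ← integral_Icc_eq_integral_Ioc,
        ← integral_indicator measurableSet_Icc]
      refine integral_congr_ae (Filter.Eventually.of_forall fun t => ?_)
      simp only [indicator, insertCoord_mem_refSimplex, hs, true_and]
    · simp only [indicator_of_notMem hs]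
      simp [indicator, insertCoord_mem_refSimplex, hs]
  · rw [← Measure.volume_eq_prod]
    exact (measurePreserving_insertCoord j).integrable_comp_of_integrable hi

lemma volume_frontier_refSimplex (n : ℕ) : volume (frontier (refSimplex n)) = 0 :=
  (convex_refSimplex n).addHaar_frontier _

lemma ae_mem_interior_refSimplex (n : ℕ) :
    ∀ᵐ s ∂(volume.restrict (refSimplex n)), s ∈ interior (refSimplex n) := by
  rw [ae_restrict_iff' (measurableSet_refSimplex n)]
  have h : ∀ᵐ s : Pt n, s ∉ frontier (refSimplex n) := by
    rw [ae_iff]; simpa using volume_frontier_refSimplex n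
  filter_upwards [h] with s hs hs'
  by_contra h
  exact hs ⟨subset_closure hs', h⟩

/-- The fundamental theorem of calculus on every segment parallel to the axis `j`. Differentiability
is known only inside the simplex, so s is taken in the interior of its simplex, which covers almost
every s. -/
lemma integral_refSimplex_partialDeriv [CompleteSpace E] (j : Fin (m + 1))
    (G G' : Pt (m + 1) → E) (hG : ContinuousOn G (refSimplex (m + 1)))
    (hG' : ContinuousOn G' (refSimplex (m + 1)))
    (hd : ∀ x : Pt (m + 1), (∀ i, 0 < refBary x.ofLp i) →
      HasLineDerivAt ℝ G (G' x) x (EuclideanSpace.single j 1)) :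
    ∫ x in refSimplex (m + 1), G' x =
      ∫ s in refSimplex m,
        (G (insertCoord j (1 - ∑ i, s i) s) - G (insertCoord j 0 s)) := by
  rw [integral_refSimplex_succ j G' (hG'.integrableOn_compact (isCompact_refSimplex _))]
  refine integral_congr_ae ?_
  filter_upwards [ae_mem_interior_refSimplex m] with s hs
  have hs1 : s ∈ refSimplex m := interior_subset hs
  obtain ⟨hs2, hs3⟩ := pos_of_mem_interior_refSimplex hs
  have h1 : 0 ≤ 1 - ∑ i, s i := by linarith
  have hmaps : MapsTo (fun t => insertCoord j t s) (Icc 0 (1 - ∑ i, s i))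
      (refSimplex (m + 1)) := fun t ht => (insertCoord_mem_refSimplex j t s).2 ⟨hs1, ht⟩
  refine intervalIntegral.integral_eq_sub_of_hasDerivAt_of_le (f := fun t => G (insertCoord j t s))
    h1 (hG.comp (continuous_insertCoord j s).continuousOn hmaps) ?_ ?_
  · intro t ht
    have h2 := hd (insertCoord j t s) (by
      have h : ∀ i, 0 < insertCoord j t s i := by
        rw [Fin.forall_iff_succAbove j]
        simpa [insertCoord] using ⟨ht.1, hs2⟩
      have h' := sum_insertCoord j t s
      rw [Fin.forall_fin_succ]
      refine ⟨?_, h⟩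
      rw [refBary, Fin.cons_zero, h']
      linarith [ht.2])
    have h3 : HasDerivAt (fun τ => G (insertCoord j t s + τ • EuclideanSpace.single j 1))
      (G' (insertCoord j t s)) (t - t) := by rw [sub_self]; exact h2
    have h4 := h3.comp_sub_const t t
    refine h4.congr_of_eventuallyEq (Filter.Eventually.of_forall fun τ => ?_)
    simp only
    rw [insertCoord_eq j τ, insertCoord_eq j t, add_assoc, ← add_smul]
    simp
  · apply ContinuousOn.intervalIntegrable
    rw [uIcc_of_le h1]
    exact hG'.comp (continuous_insertCoord j s).continuousOn hmaps

open scoped MeasureTheory in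
lemma integrableOn_simplexSet {H : Type*} [NormedAddCommGroup H] {d n : ℕ}
    (v : Fin (n + 1) → Pt d) {g : Pt d → H}
    (hg : ContinuousOn g (simplexSet v)) :
    IntegrableOn g (simplexSet v) (μHE[n] : Measure (Pt d)) := by
  obtain ⟨C, hC⟩ := (isCompact_simplexSet v).exists_bound_of_continuousOn hg
  exact IntegrableOn.of_bound (hausdorff_simplexSet_ne_top v).lt_top
    (hg.aestronglyMeasurable_of_isCompact (isCompact_simplexSet v) (measurableSet_simplexSet v)) C
    ((ae_restrict_iff' (measurableSet_simplexSet v)).2 (Filter.Eventually.of_forall hC))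

variable (b : AffineBasis (Fin (m + 2)) ℝ (Pt (m + 1)))

lemma simplexMap_insertCoord (j : Fin (m + 1)) (t : ℝ) (s : Pt m) :
    simplexMap b (insertCoord j t s) =
      b 0 + (t • (b j.succ - b 0) + ∑ i, s i • (b (j.succAbove i).succ - b 0)) := by
  rw [simplexMap, edgeMap_apply, Fin.sum_univ_succAbove _ j]
  simp [insertCoord]

lemma simplexMap_insertCoord_zero (j : Fin (m + 1)) (s : Pt m) :
    simplexMap b (insertCoord j 0 s) = simplexMap (facetVert b j.succ) s := by
  rw [simplexMap_insertCoord, simplexMap, edgeMap_apply]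
  simp [facetVert]

/-- The vertices of the facet opposite to the vertex `0`, starting with the vertex `j + 1`. -/
noncomputable def topVert (j : Fin (m + 1)) : Fin (m + 1) → Pt (m + 1) :=
  Fin.cons (b j.succ) fun i => b (j.succAbove i).succ

lemma simplexMap_insertCoord_top (j : Fin (m + 1)) (s : Pt m) :
    simplexMap b (insertCoord j (1 - ∑ i, s i) s) = simplexMap (topVert b j) s := by
  rw [simplexMap_insertCoord, simplexMap, edgeMap_apply]
  simp only [topVert, Fin.cons_zero, Fin.cons_succ, smul_sub, sub_smul, Finset.sum_sub_distrib,
    Finset.sum_smul, one_smul]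
  abel

lemma simplexMap_topVert_injective (j : Fin (m + 1)) :
    Function.Injective (simplexMap (topVert b j)) := by
  intro s s' h
  rw [← simplexMap_insertCoord_top, ← simplexMap_insertCoord_top] at h
  have h1 := (measurableEmbedding_insertCoord j).injective
    (a₁ := (1 - ∑ i, s i, s)) (a₂ := (1 - ∑ i, s' i, s')) (simplexMap_injective b h)
  exact congrArg Prod.snd h1

lemma simplexSet_topVert (j : Fin (m + 1)) :
    simplexSet (topVert b j) = simplexSet (facetVert b 0) := by
  rw [simplexSet, simplexSet]
  congr 1
  ext x
  simp only [mem_range, facetVert, Fin.succAbove_zero]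
  rw [Fin.exists_fin_succ, Fin.exists_iff_succAbove (p := j)]
  simp [topVert]

open scoped MeasureTheory in
-- Both vertex lists span the same simplex, and its area determines the density.
lemma normDet_topVert (j : Fin (m + 1)) :
    (edgeMap (topVert b j)).normDet = (edgeMap (facetVert b 0)).normDet := by
  have h1 := hausdorff_simplexSet (topVert b j)
  rw [simplexSet_topVert, hausdorff_simplexSet] at h1
  exact (mul_right_cancel₀ (volume_real_refSimplex_pos m).ne' h1).symm

open scoped MeasureTheory in
/-- The divergence theorem for divergence-free fields on a simplex. -/
theorem sum_facet_integral_eq_zero [CompleteSpace E] (F : Fin (m + 1) → Pt (m + 1) → E)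
    (F' : Fin (m + 1) → Pt (m + 1) → Pt (m + 1) →L[ℝ] E)
    (hF : ∀ i, ContinuousOn (F i) (simplexSet b)) (hF' : ∀ i, ContinuousOn (F' i) (simplexSet b))
    (hd : ∀ i, ∀ x ∈ interior (simplexSet b), HasFDerivAt (F i) (F' i x) x)
    (hdiv : ∀ x ∈ interior (simplexSet b),
      ∑ i, F' i x (EuclideanSpace.single i (1 : ℝ)) = 0) :
    ∑ l, ∫ x in simplexSet (facetVert b l), ∑ i, (‖coordGrad b l‖⁻¹ * coordGrad b l i) • F i x
      ∂(μHE[m] : Measure (Pt (m + 1))) = 0 := by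
  obtain ⟨κ, hκ, hdet⟩ := exists_normDet_facet b
  -- `G l` is the component of F along the gradient of the coordinate `l`. The factor in `I l`
  -- normalises this gradient, so `I l (G l)` is the flux through the facet `l` up to sign.
  set G : Fin (m + 2) → Pt (m + 1) → E := fun l x => ∑ i, coordGrad b l i • F i x with hGdef
  have hn : ∀ l, ‖coordGrad b l‖ ≠ 0 := fun l => norm_ne_zero_iff.2 (coordGrad_ne_zero b l)
  have hGc : ∀ l, ContinuousOn (G l) (simplexSet b) := fun l =>
    continuousOn_finsetSum _ fun i _ => (hF i).const_smul _
  set I : Fin (m + 2) → (Pt (m + 1) → E) → E := fun l g =>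
    ‖coordGrad b l‖⁻¹ • ∫ x in simplexSet (facetVert b l), g x ∂(μHE[m] : Measure (Pt (m + 1)))
    with hI
  have hI1 : ∀ l g, ∫ s in refSimplex m, g (simplexMap (facetVert b l) s) = κ⁻¹ • I l g := by
    intro l g
    have := hn l
    rw [hI]
    simp only
    rw [integral_simplexSet _ (simplexMap_facet_injective b l), hdet, smul_smul, smul_smul]
    rw [show κ⁻¹ * ‖coordGrad b l‖⁻¹ * (κ * ‖coordGrad b l‖) = 1 by field_simp, one_smul]
  have hI2 : ∀ j g, ∫ s in refSimplex m, g (simplexMap (topVert b j) s) = κ⁻¹ • I 0 g := by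
    intro j g
    have := hn 0
    rw [hI]
    simp only
    rw [← simplexSet_topVert b j, integral_simplexSet _ (simplexMap_topVert_injective b j),
      normDet_topVert, hdet, smul_smul, smul_smul]
    rw [show κ⁻¹ * ‖coordGrad b 0‖⁻¹ * (κ * ‖coordGrad b 0‖) = 1 by field_simp, one_smul]
  have hmaps : MapsTo (simplexMap b) (refSimplex (m + 1)) (simplexSet b) :=
    fun x hx => simplexMap_mem b hx
  -- `D j` is the derivative of `G j.succ` along the edge from the vertex 0 to the vertex j + 1,
  -- i.e. the partial derivative `j` after pulling back to the reference simplex.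
  set D : Fin (m + 1) → Pt (m + 1) → E := fun j x =>
    ∑ i, coordGrad b j.succ i • F' i (simplexMap b x) (b j.succ - b 0) with hD
  have hDc : ∀ j, ContinuousOn (D j) (refSimplex (m + 1)) := fun j =>
    continuousOn_finsetSum _ fun i _ => (((hF' i).comp (continuous_simplexMap b).continuousOn
      hmaps).clm_apply continuousOn_const).const_smul _
  -- The segments in direction `j` start on the facet opposite to j + 1 and end on the facet
  -- opposite to 0.
  have hstep : ∀ j, ∫ x in refSimplex (m + 1), D j x =
      κ⁻¹ • I 0 (G j.succ) - κ⁻¹ • I j.succ (G j.succ) := by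
    intro j
    rw [integral_refSimplex_partialDeriv j (fun x => G j.succ (simplexMap b x)) (D j)
      ((hGc _).comp (continuous_simplexMap b).continuousOn hmaps) (hDc j)]
    · simp only [simplexMap_insertCoord_top, simplexMap_insertCoord_zero]
      rw [integral_sub, hI1, hI2]
      · refine ContinuousOn.integrableOn_compact (isCompact_refSimplex m) ?_
        refine (hGc _).comp (continuous_simplexMap _).continuousOn fun s hs => ?_
        apply facet_subset_cell b 0
        rw [← simplexSet_topVert b j, simplexSet_eq_image]
        exact mem_image_of_mem _ hs
      · refine ContinuousOn.integrableOn_compact (isCompact_refSimplex m) ?_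
        refine (hGc _).comp (continuous_simplexMap _).continuousOn fun s hs => ?_
        apply facet_subset_cell b j.succ
        rw [simplexSet_eq_image]
        exact mem_image_of_mem _ hs
    · intro x hx
      have hx' := simplexMap_mem_interior b hx
      have h1 : HasFDerivAt (simplexMap b) (LinearMap.toContinuousLinearMap (edgeMap b)) x :=
        ((LinearMap.toContinuousLinearMap (edgeMap b)).hasFDerivAt).const_add (b 0)
      have h2 : HasFDerivAt (fun x => G j.succ (simplexMap b x))
          (∑ i, coordGrad b j.succ i • (F' i (simplexMap b x)).comp
            (LinearMap.toContinuousLinearMap (edgeMap b))) x :=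
        HasFDerivAt.fun_sum fun i _ => (((hd i _ hx').comp x h1).const_smul _)
      have h3 := h2.hasLineDerivAt (EuclideanSpace.single j 1)
      convert! h3 using 1
      simp [hD]
  -- By duality of gradients and edges the `D j` add up to the divergence of F.
  have hsum : ∑ j, ∫ x in refSimplex (m + 1), D j x = 0 := by
    rw [← integral_finsetSum _ fun j _ => (hDc j).integrableOn_compact (isCompact_refSimplex _)]
    refine integral_eq_zero_of_ae ?_
    filter_upwards [ae_mem_interior_refSimplex (m + 1)] with x hx
    obtain ⟨h1, h2⟩ := pos_of_mem_interior_refSimplex hx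
    have hx' : simplexMap b x ∈ interior (simplexSet b) := by
      refine simplexMap_mem_interior b ?_
      rw [Fin.forall_fin_succ]
      exact ⟨by simp [refBary]; linarith, h1⟩
    simp only [hD, Pi.zero_apply]
    rw [Finset.sum_comm, ← hdiv _ hx']
    refine Finset.sum_congr rfl fun i _ => ?_
    conv_rhs => rw [← sum_coord_linear_smul_edge b (EuclideanSpace.single i 1)]
    simp only [map_sum, map_smul, coordGrad_apply]
  simp_rw [hstep, ← smul_sub, ← Finset.smul_sum] at hsum
  have hsum' := (smul_eq_zero.1 hsum).resolve_left (inv_ne_zero hκ.ne')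
  -- The gradients of all barycentric coordinates sum to zero, so the contributions on the facet
  -- opposite to 0 combine into the missing term with a minus sign.
  have hI0 : ∑ j : Fin (m + 1), I 0 (G j.succ) = - I 0 (G 0) := by
    simp only [hI]
    rw [← Finset.smul_sum, ← integral_finsetSum, ← smul_neg, ← integral_neg]
    · congr 2
      ext x
      simp only [hGdef]
      rw [Finset.sum_comm, ← Finset.sum_neg_distrib]
      refine Finset.sum_congr rfl fun i _ => ?_
      rw [← Finset.sum_smul, ← neg_smul]
      congr 1
      have := sum_coord_linear b (EuclideanSpace.single i 1)
      rw [Fin.sum_univ_succ] at this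
      simp only [coordGrad_apply]
      linarith
    · exact fun j _ => integrableOn_simplexSet _ ((hGc _).mono (facet_subset_cell b 0))
  have hfin : ∑ l, I l (G l) = 0 := by
    rw [Finset.sum_sub_distrib, hI0] at hsum'
    rw [Fin.sum_univ_succ, ← neg_eq_zero, ← hsum']
    abel
  rw [← hfin]
  refine Finset.sum_congr rfl fun l _ => ?_
  simp only [hI, hGdef]
  rw [← integral_smul]
  simp only [Finset.smul_sum, smul_smul]

end Divergence

/-! ### Faces of a mesh -/

namespace Mesh

section General

variable {d : ℕ} {Ω : Set (Pt d)} (M : Mesh Ω)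

lemma mem_facesOf {K : M.Elem} {e : M.Face} :
    e ∈ M.facesOf K ↔ M.left e = K ∨ M.right e = some K := by
  simp [facesOf]

lemma mem_bdryFaces {e : M.Face} : e ∈ M.bdryFaces ↔ M.right e = none := by
  simp [bdryFaces]

lemma face_subset_frontier {K : M.Elem} {e : M.Face} (h : e ∈ M.facesOf K) :
    M.face e ⊆ frontier (M.cell K) := by
  intro x hx
  change x ∈ frontier (simplexSet (M.vert K))
  rw [M.frontier_elem K]
  exact mem_iUnion₂.2 ⟨e, (M.mem_facesOf).1 h, hx⟩

lemma isClosed_cell (K : M.Elem) : IsClosed (M.cell K) := (isCompact_simplexSet _).isClosed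

lemma face_subset_cell {K : M.Elem} {e : M.Face} (h : e ∈ M.facesOf K) :
    M.face e ⊆ M.cell K :=
  (M.face_subset_frontier h).trans (M.isClosed_cell K).frontier_subset

lemma cell_subset_closure (K : M.Elem) : M.cell K ⊆ closure Ω := by
  rw [M.closure_eq]; exact subset_iUnion (fun K => simplexSet (M.vert K)) K

lemma face_subset_domain_frontier {e : M.Face} (h : e ∈ M.bdryFaces) :
    M.face e ⊆ frontier Ω := by
  intro x hx
  rw [M.frontier_domain]
  exact mem_iUnion₂.2 ⟨e, (M.mem_bdryFaces).1 h, hx⟩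

lemma left_mem (e : M.Face) : e ∈ M.facesOf (M.left e) := (M.mem_facesOf).2 (Or.inl rfl)

lemma outNormal_left (e : M.Face) : M.outNormal (M.left e) e = M.normal e := by
  simp [outNormal]

lemma outNormal_right {e : M.Face} {K : M.Elem} (h : M.right e = some K) :
    M.outNormal K e = -M.normal e := by
  have : M.left e ≠ K := fun h' => M.left_ne_right e (h' ▸ h)
  simp [outNormal, this]

lemma across_left_of_right {e : M.Face} {K : M.Elem} (h : M.right e = some K) :
    M.across (M.left e) e = K := by
  simp [across, h]

lemma across_left_of_bdry {e : M.Face} (h : M.right e = none) :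
    M.across (M.left e) e = M.left e := by
  simp [across, h]

lemma across_right {e : M.Face} {K : M.Elem} (h : M.right e = some K) :
    M.across K e = M.left e := by
  have : M.left e ≠ K := fun h' => M.left_ne_right e (h' ▸ h)
  simp [across, this]

lemma mem_facesOf_across {e : M.Face} {K : M.Elem} (h : e ∈ M.facesOf K) :
    e ∈ M.facesOf (M.across K e) := by
  rw [mem_facesOf] at h
  rcases h with rfl | h
  · rcases hr : M.right e with _ | K
    · rw [M.across_left_of_bdry hr]; exact M.left_mem e
    · rw [M.across_left_of_right hr, mem_facesOf]; exact Or.inr hr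
  · rw [M.across_right h]; exact M.left_mem e

lemma norm_outNormal (K : M.Elem) (e : M.Face) : ‖M.outNormal K e‖ = 1 := by
  unfold outNormal
  split_ifs <;> simp [M.norm_normal]

lemma inner_outNormal {K : M.Elem} {e : M.Face} (h : e ∈ M.facesOf K) {x y : Pt d}
    (hx : x ∈ M.face e) (hy : y ∈ M.cell K) : inner ℝ (M.outNormal K e) (y - x) ≤ 0 := by
  rw [mem_facesOf] at h
  rcases h with rfl | h
  · rw [M.outNormal_left]; exact M.normal_left e x hx y hy
  · rw [M.outNormal_right h, inner_neg_left, neg_nonpos]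
    exact M.normal_right e K h x hx y hy

/-- Cells are only known to lie in `closure Ω`, so a slit of Ω inside a cell has to be excluded. A
point of such a slit would lie on a boundary face, hence on the frontier of some cell. That cell is
either `K` itself, or its interior would meet the interior of `K`. -/
lemma interior_cell_subset (K : M.Elem) : interior (M.cell K) ⊆ Ω := by
  intro x hx
  by_contra hxΩ
  have hcl : x ∈ closure Ω := M.cell_subset_closure K (interior_subset hx)
  have hfr : x ∈ frontier Ω := ⟨hcl, fun h => hxΩ (interior_subset h)⟩
  rw [M.frontier_domain] at hfr
  obtain ⟨e, he, hxe⟩ := mem_iUnion₂.1 hfr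
  have hL := M.face_subset_frontier (M.left_mem e) hxe
  by_cases hK : M.left e = K
  · rw [hK] at hL; exact hL.2 hx
  · have hcl : x ∈ closure (interior (simplexSet (M.vert (M.left e)))) := by
      rw [(convex_simplexSet _).closure_interior_eq_closure_of_nonempty_interior
        (interior_cell_nonempty _)]
      exact frontier_subset_closure hL
    obtain ⟨y, hy1, hy2⟩ := mem_closure_iff.1 hcl _ isOpen_interior hx
    exact (disjoint_left.1 (M.disjoint_interior _ _ hK) hy2) hy1

end General

/-! ### Faces inside facets and the divergence theorem on an element -/

section Succ

variable {m : ℕ} {Ω : Set (Pt (m + 1))} (M : Mesh Ω)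

lemma measurableSet_face (e : M.Face) : MeasurableSet (M.face e) :=
  measurableSet_simplexSet _

lemma surface_face_ne_top (e : M.Face) : surface (m + 1) (M.face e) ≠ ⊤ :=
  hausdorff_simplexSet_ne_top (n := m) (M.faceVert e)

/-- A face of positive area lies in one of the facets of the element, and its normal is the normal
of this facet. -/
lemma exists_facet {K : M.Elem} {e : M.Face} (h : e ∈ M.facesOf K)
    (hpos : 0 < (surface (m + 1)).real (M.face e)) :
    ∃ l, M.face e ⊆ simplexSet (facetVert (M.vert K) l) ∧
      M.outNormal K e = -(‖coordGrad (M.vert K) l‖⁻¹ • coordGrad (M.vert K) l) := by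
  set b := M.vert K with hb
  set n := M.outNormal K e with hn
  have hvert : ∀ i, b i ∈ M.cell K := fun i => subset_convexHull ℝ _ (mem_range_self i)
  -- A convex combination of the nonpositive numbers n·(b_i - x) that vanishes. On the face every
  -- term must therefore vanish, so a vertex off the supporting hyperplane has zero coordinate
  -- there.
  have hdecomp : ∀ x : Pt (m + 1), ∑ i, b.coord i x * inner ℝ n (b i - x) = 0 := by
    intro x
    have h1 : ∑ i, b.coord i x • (b i - x) = 0 := by
      simp only [smul_sub, Finset.sum_sub_distrib]
      rw [b.linear_combination_coord_eq_self x, ← Finset.sum_smul, b.sum_coord_apply_eq_one,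
        one_smul, sub_self]
    have := congrArg (fun v => inner ℝ n v) h1
    simpa [inner_sum, inner_smul_right] using this
  have hne : (M.face e).Nonempty := by
    by_contra hne
    rw [not_nonempty_iff_eq_empty] at hne
    simp [hne] at hpos
  obtain ⟨x₀, hx₀⟩ := hne
  have hzero : ∀ x ∈ M.face e, ∀ i, inner ℝ n (b i - x) ≠ 0 → b.coord i x = 0 := by
    intro x hx i hi
    have hx' := (mem_cell b).1 (M.face_subset_cell h hx)
    have hnp : ∀ j ∈ Finset.univ, b.coord j x * inner ℝ n (b j - x) ≤ 0 := fun j _ =>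
      mul_nonpos_of_nonneg_of_nonpos (hx' j) (M.inner_outNormal h hx (hvert j))
    have := (Finset.sum_eq_zero_iff_of_nonpos hnp).1 (hdecomp x) i (Finset.mem_univ i)
    exact (mul_eq_zero.1 this).resolve_right hi
  have hconst : ∀ x ∈ M.face e, inner ℝ n x = inner ℝ n x₀ := by
    intro x hx
    have h1 := M.inner_outNormal h hx (M.face_subset_cell h hx₀)
    have h2 := M.inner_outNormal h hx₀ (M.face_subset_cell h hx)
    rw [← hn, inner_sub_right] at h1 h2
    linarith
  have hex : ∃ l, inner ℝ n (b l - x₀) ≠ 0 := by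
    by_contra hall
    push Not at hall
    have hn0 : ∀ v : Pt (m + 1), inner ℝ n v = 0 := by
      intro v
      rw [← sum_coord_linear_smul_edge b v, inner_sum]
      refine Finset.sum_eq_zero fun j _ => ?_
      rw [inner_smul_right, ← sub_sub_sub_cancel_right _ _ x₀, inner_sub_right, hall, hall]
      simp
    have := M.norm_outNormal K e
    rw [← hn, inner_self_eq_zero.1 (hn0 n)] at this
    simp at this
  obtain ⟨l, hl⟩ := hex
  have hsub : ∀ i, inner ℝ n (b i - x₀) ≠ 0 → M.face e ⊆ simplexSet (facetVert b i) := by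
    intro i hi x hx
    refine (mem_facet b).2 ⟨M.face_subset_cell h hx, hzero x hx i ?_⟩
    rw [inner_sub_right, hconst x hx, ← inner_sub_right]; exact hi
  -- Two vertices off the hyperplane would put the face into the intersection of two facets, which
  -- has no area.
  have huniq : ∀ i, i ≠ l → inner ℝ n (b i - x₀) = 0 := by
    intro i hi
    by_contra h1
    have h2 := measure_mono_null (subset_inter (hsub i h1) (hsub l hl))
      (hausdorff_facet_inter b hi)
    change surface (m + 1) (M.face e) = 0 at h2
    simp [measureReal_def, h2] at hpos
  refine ⟨l, hsub l hl, ?_⟩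
  set a := inner ℝ n (b l - x₀) with ha
  have ha0 : a < 0 := lt_of_le_of_ne (M.inner_outNormal h hx₀ (hvert l)) hl
  -- Pairing with n is zero at all vertices except `l`, relative to x₀, so n is a multiple of the
  -- gradient of the coordinate `l`; the factor is negative because n points outwards.
  have hna : n = a • coordGrad b l := by
    refine ext_inner_right ℝ fun v => ?_
    rw [inner_smul_left, inner_coordGrad]
    have h1 : ∀ j : Fin (m + 2), inner ℝ n (b j - x₀) = if j = l then a else 0 := by
      intro j
      split_ifs with hj
      · rw [hj]
      · exact huniq j hj
    have h2 : v = ∑ i, (b.coord i).linear v • (b i - x₀) := by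
      conv_lhs => rw [← sum_coord_linear_smul_edge b v]
      simp only [smul_sub, Finset.sum_sub_distrib, ← Finset.sum_smul, sum_coord_linear]
      rw [Fin.sum_univ_succ (fun i => (b.coord i).linear v • b i)]
      have h3 := sum_coord_linear b v
      rw [Fin.sum_univ_succ] at h3
      rw [eq_neg_of_add_eq_zero_right h3, neg_smul, zero_smul]
      abel
    conv_lhs => rw [h2]
    simp only [inner_sum, inner_smul_right, h1]
    simp [mul_comm]
  have hnorm := M.norm_outNormal K e
  rw [← hn, hna, norm_smul, Real.norm_eq_abs, abs_of_neg ha0] at hnorm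
  have hg0 : ‖coordGrad b l‖ ≠ 0 := norm_ne_zero_iff.2 (coordGrad_ne_zero b l)
  rw [hna, ← neg_smul]
  congr 1
  field_simp
  linarith

/-- A facet of an element is tiled by the faces that lie in it. -/
lemma integral_facet_eq_sum {E : Type*} [NormedAddCommGroup E] [NormedSpace ℝ E] (K : M.Elem)
    (lf : M.Face → Fin (m + 2))
    (hlf : ∀ e ∈ M.facesOf K, M.face e ⊆ simplexSet (facetVert (M.vert K) (lf e)))
    (l : Fin (m + 2)) {g : Pt (m + 1) → E}
    (hg : ContinuousOn g (simplexSet (facetVert (M.vert K) l))) :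
    ∫ x in simplexSet (facetVert (M.vert K) l), g x ∂(surface (m + 1)) =
      ∑ e ∈ M.facesOf K with lf e = l, ∫ x in M.face e, g x ∂(surface (m + 1)) := by
  set b := M.vert K with hb
  set A := (M.facesOf K).filter fun e => lf e = l with hA
  have hAsub : (⋃ e : A, M.face e) ⊆ simplexSet (facetVert b l) := by
    refine iUnion_subset fun e => ?_
    have := (Finset.mem_filter.1 e.2)
    rw [← this.2]; exact hlf _ this.1
  -- The faces cover the whole frontier. A point of the facet that is missed by the faces labelled
  -- `l` lies on a face labelled differently, hence in the null intersection of two facets.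
  have hae : (simplexSet (facetVert b l) : Set (Pt (m + 1))) =ᵐ[surface (m + 1)]
      ⋃ e : A, M.face e := by
    refine Filter.EventuallyLE.antisymm ?_ hAsub.eventuallyLE
    rw [ae_le_set]
    refine measure_mono_null (t := ⋃ l' : {l' // l ≠ l'},
      simplexSet (facetVert b l) ∩ simplexSet (facetVert b l')) ?_ ?_
    · rintro x ⟨hx, hx'⟩
      have hfr : x ∈ frontier (simplexSet b) := by
        rw [frontier_cell_eq]; exact mem_iUnion.2 ⟨l, hx⟩
      rw [hb, M.frontier_elem K] at hfr
      obtain ⟨e, he, hxe⟩ := mem_iUnion₂.1 hfr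
      have he' : e ∈ M.facesOf K := (M.mem_facesOf).2 he
      have hle : l ≠ lf e := by
        intro hle
        exact hx' (mem_iUnion.2 ⟨⟨e, Finset.mem_filter.2 ⟨he', hle.symm⟩⟩, hxe⟩)
      exact mem_iUnion.2 ⟨⟨lf e, hle⟩, hx, hlf e he' hxe⟩
    · exact measure_iUnion_null fun l' => hausdorff_facet_inter b l'.2
  rw [setIntegral_congr_set hae, integral_iUnion_ae]
  · rw [tsum_fintype, Finset.sum_coe_sort A fun e => ∫ x in M.face e, g x ∂(surface (m + 1))]
  · exact fun e => (M.measurableSet_face e).nullMeasurableSet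
  · intro e e' hee
    exact M.face_overlap _ _ fun h => hee (Subtype.ext h)
  · exact (integrableOn_simplexSet _ hg).mono_set hAsub

/-- The divergence theorem on an element whose boundary consists of the faces of the mesh. -/
theorem sum_face_integral_eq_zero {E : Type*} [NormedAddCommGroup E] [NormedSpace ℝ E]
    [CompleteSpace E] (hpos : ∀ e, 0 < (surface (m + 1)).real (M.face e)) (K : M.Elem)
    (F : Fin (m + 1) → Pt (m + 1) → E)
    (F' : Fin (m + 1) → Pt (m + 1) → Pt (m + 1) →L[ℝ] E)
    (hF : ∀ i, ContinuousOn (F i) (M.cell K)) (hF' : ∀ i, ContinuousOn (F' i) (M.cell K))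
    (hd : ∀ i, ∀ x ∈ interior (M.cell K), HasFDerivAt (F i) (F' i x) x)
    (hdiv : ∀ x ∈ interior (M.cell K),
      ∑ i, F' i x (EuclideanSpace.single i (1 : ℝ)) = 0) :
    ∑ e ∈ M.facesOf K, ∫ x in M.face e, ∑ i, M.outNormal K e i • F i x ∂(surface (m + 1)) = 0 := by
  classical
  -- Faces that do not belong to `K` receive the dummy label 0, so that the labelling is defined on
  -- all faces.
  have hex : ∀ e, ∃ l, e ∈ M.facesOf K → (M.face e ⊆ simplexSet (facetVert (M.vert K) l) ∧
      M.outNormal K e = -(‖coordGrad (M.vert K) l‖⁻¹ • coordGrad (M.vert K) l)) := by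
    intro e
    by_cases h : e ∈ M.facesOf K
    · obtain ⟨l, hl⟩ := M.exists_facet h (hpos e)
      exact ⟨l, fun _ => hl⟩
    · exact ⟨0, fun h' => absurd h' h⟩
  choose lf hlf using hex
  have h0 := sum_facet_integral_eq_zero (M.vert K) F F' hF hF' hd hdiv
  rw [← neg_eq_zero, ← Finset.sum_neg_distrib, ← h0,
    ← Finset.sum_fiberwise (M.facesOf K) lf]
  refine Finset.sum_congr rfl fun l _ => ?_
  have h1 := M.integral_facet_eq_sum K lf (fun e he => (hlf e he).1) l
    (g := fun x => ∑ i, (‖coordGrad (M.vert K) l‖⁻¹ * coordGrad (M.vert K) l i) • F i x)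
    (continuousOn_finsetSum _ fun i _ =>
      ((hF i).mono (facet_subset_cell (M.vert K) l)).const_smul _)
  refine Eq.trans ?_ h1.symm
  refine Finset.sum_congr rfl fun e he => ?_
  obtain ⟨he1, he2⟩ := Finset.mem_filter.1 he
  rw [← integral_neg]
  congr 1
  ext x
  rw [(hlf e he1).2, he2, ← Finset.sum_neg_distrib]
  refine Finset.sum_congr rfl fun i _ => ?_
  simp

end Succ

end Mesh

/-! ### Areas and numbers of faces -/

/-- The square of the density is the Gram determinant of the edges. Its entries are at most h², so
the Leibniz expansion bounds it by n! h^(2n). -/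
lemma normDet_edgeMap_le {n d : ℕ} (v : Fin (n + 1) → Pt d) {h : ℝ} (hh : 0 ≤ h)
    (hv : ∀ j : Fin n, ‖v j.succ - v 0‖ ≤ h) :
    (edgeMap v).normDet ≤ (n.factorial : ℝ) * h ^ n := by
  have h1 := (edgeMap v).normDet_sq_eq_det_gram (EuclideanSpace.basisFun (Fin n) ℝ)
  have h2 := Matrix.det_le (abv := AbsoluteValue.abs) (x := h ^ 2)
    (A := Matrix.gram ℝ (fun j => edgeMap v (EuclideanSpace.basisFun (Fin n) ℝ j))) (by
      intro i j
      rw [Matrix.gram_apply, AbsoluteValue.abs_apply]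
      simp only [EuclideanSpace.basisFun_apply, edgeMap_single]
      refine (abs_real_inner_le_norm _ _).trans ?_
      rw [sq]
      exact mul_le_mul (hv i) (hv j) (norm_nonneg _) hh)
  rw [← h1, Fintype.card_fin, nsmul_eq_mul] at h2
  have h3 : (1 : ℝ) ≤ n.factorial := by exact_mod_cast n.factorial_pos
  refine le_of_sq_le_sq ?_ (by positivity)
  refine (le_abs_self _).trans (h2.trans ?_)
  rw [mul_pow, ← pow_mul, ← pow_mul, mul_comm 2 n]
  gcongr
  nlinarith

namespace Mesh

lemma convex_cell {d : ℕ} {Ω : Set (Pt d)} (M : Mesh Ω) (K : M.Elem) : Convex ℝ (M.cell K) :=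
  convex_simplexSet _

lemma norm_sub_le_diam {d : ℕ} {Ω : Set (Pt d)} (M : Mesh Ω) {K : M.Elem} {x y : Pt d}
    (hx : x ∈ M.cell K) (hy : y ∈ M.cell K) : ‖x - y‖ ≤ Metric.diam (M.cell K) := by
  rw [← dist_eq_norm]
  exact Metric.dist_le_diam_of_mem (isCompact_simplexSet _).isBounded hx hy

lemma vert_mem {d : ℕ} {Ω : Set (Pt d)} (M : Mesh Ω) (K : M.Elem) (i : Fin (d + 1)) :
    M.vert K i ∈ M.cell K := subset_convexHull ℝ _ (mem_range_self i)

lemma faceVert_mem {d : ℕ} {Ω : Set (Pt d)} (M : Mesh Ω) (e : M.Face) (i : Fin d) :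
    M.faceVert e i ∈ M.face e := subset_convexHull ℝ _ (mem_range_self i)

lemma aedisjoint_cell {d : ℕ} {Ω : Set (Pt d)} (M : Mesh Ω) {K K' : M.Elem} (h : K ≠ K') :
    AEDisjoint volume (M.cell K) (M.cell K') := by
  have h0 : ∀ K, volume (frontier (M.cell K)) = 0 := fun K => (M.convex_cell K).addHaar_frontier _
  refine measure_mono_null (t := frontier (M.cell K) ∪ frontier (M.cell K')) ?_
    (measure_union_null (h0 K) (h0 K'))
  rintro x ⟨hx, hx'⟩
  by_contra hc
  rw [mem_union, not_or] at hc
  have h1 : x ∈ interior (M.cell K) := by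
    by_contra h1; exact hc.1 ⟨subset_closure hx, h1⟩
  have h2 : x ∈ interior (M.cell K') := by
    by_contra h2; exact hc.2 ⟨subset_closure hx', h2⟩
  exact disjoint_left.1 (M.disjoint_interior _ _ h) h1 h2

lemma sum_volume_cell {d : ℕ} {Ω : Set (Pt d)} (M : Mesh Ω) :
    ∑ K, (volume : Measure (Pt d)).real (M.cell K) =
      (volume : Measure (Pt d)).real (closure Ω) := by
  rw [M.closure_eq, ← measureReal_biUnion_finset₀ (fun K _ K' _ h => M.aedisjoint_cell h)
    (fun K _ => (measurableSet_simplexSet _).nullMeasurableSet)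
    (fun K _ => (isCompact_simplexSet _).measure_lt_top.ne)]
  simp [cell]

section Succ

variable {m : ℕ} {Ω : Set (Pt (m + 1))} (M : Mesh Ω)

/-- The boundary faces lie on the frontiers of finitely many convex cells, which are null sets. -/
lemma volume_domain_frontier (M : Mesh Ω) : volume (frontier Ω) = 0 := by
  rw [M.frontier_domain]
  refine (measure_biUnion_null_iff (Set.to_countable _)).2 fun e _ => ?_
  exact measure_mono_null (M.face_subset_frontier (M.left_mem e))
    ((M.convex_cell _).addHaar_frontier _)

lemma integral_domain_eq_sum {g : Pt (m + 1) → ℝ}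
    (hg : ∀ K, IntegrableOn g (M.cell K)) :
    ∫ x in Ω, g x = ∑ K, ∫ x in M.cell K, g x := by
  have hae : (Ω : Set (Pt (m + 1))) =ᵐ[volume] ⋃ K, M.cell K := by
    have hcl : (⋃ K, M.cell K) = closure Ω := M.closure_eq.symm
    rw [hcl]
    refine Filter.EventuallyLE.antisymm subset_closure.eventuallyLE ?_
    rw [ae_le_set]
    refine measure_mono_null ?_ M.volume_domain_frontier
    exact fun x hx => ⟨hx.1, fun h => hx.2 (interior_subset h)⟩
  rw [setIntegral_congr_set hae, integral_iUnion_ae]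
  · rw [tsum_fintype]
  · exact fun K => (measurableSet_simplexSet _).nullMeasurableSet
  · exact fun K K' h => M.aedisjoint_cell h
  · rw [integrableOn_finite_iUnion]; exact hg

lemma surface_simplex_le {d : ℕ} (v : Fin (m + 1) → Pt d) {h : ℝ} (hh : 0 ≤ h)
    (hv : ∀ j : Fin m, ‖v j.succ - v 0‖ ≤ h) :
    (Measure.euclideanHausdorffMeasure m : Measure (Pt d)).real (simplexSet v) ≤
      (m.factorial * (volume : Measure (Pt m)).real (refSimplex m)) * h ^ m := by
  rw [hausdorff_simplexSet]
  have := mul_le_mul_of_nonneg_right (normDet_edgeMap_le v hh hv)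
    (volume_real_refSimplex_pos m).le
  linarith

lemma surface_facet_le (K : M.Elem) {h : ℝ} (hK : Metric.diam (M.cell K) ≤ h)
    (l : Fin (m + 2)) :
    (surface (m + 1)).real (simplexSet (facetVert (M.vert K) l)) ≤
      (m.factorial * (volume : Measure (Pt m)).real (refSimplex m)) * h ^ m :=
  surface_simplex_le _ (Metric.diam_nonneg.trans hK) fun _ =>
    (M.norm_sub_le_diam (M.vert_mem K _) (M.vert_mem K _)).trans hK

lemma surface_face_le (e : M.Face) {h : ℝ} (hK : Metric.diam (M.cell (M.left e)) ≤ h) :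
    (surface (m + 1)).real (M.face e) ≤
      (m.factorial * (volume : Measure (Pt m)).real (refSimplex m)) * h ^ m :=
  surface_simplex_le _ (Metric.diam_nonneg.trans hK) fun _ =>
    (M.norm_sub_le_diam (M.face_subset_cell (M.left_mem e) (M.faceVert_mem e _))
      (M.face_subset_cell (M.left_mem e) (M.faceVert_mem e _))).trans hK

lemma sum_surface_face (A : Finset M.Face) :
    ∑ e ∈ A, (surface (m + 1)).real (M.face e) =
      (surface (m + 1)).real (⋃ e ∈ A, M.face e) := by
  exact (measureReal_biUnion_finset₀ (fun e _ e' _ h => M.face_overlap e e' h)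
    (fun e _ => (M.measurableSet_face e).nullMeasurableSet)
    (fun e _ => M.surface_face_ne_top e)).symm

/-- An area count, needed because a facet may be split into many faces: these have area at least c
h^m, overlap in null sets, and fit into m + 2 facets of area at most a constant times h^m. -/
lemma card_facesOf_le {c h : ℝ} (hh : 0 < h) (hc : 0 < c) (K : M.Elem)
    (hK : Metric.diam (M.cell K) ≤ h)
    (hf : ∀ e, c * h ^ m ≤ (surface (m + 1)).real (M.face e)) :
    ((M.facesOf K).card : ℝ) ≤
      (m + 2) * (m.factorial * (volume : Measure (Pt m)).real (refSimplex m)) / c := by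
  have h1 : ((M.facesOf K).card : ℝ) * (c * h ^ m) ≤
      ∑ e ∈ M.facesOf K, (surface (m + 1)).real (M.face e) := by
    rw [← nsmul_eq_mul]
    exact Finset.card_nsmul_le_sum _ _ _ fun e _ => hf e
  have h2 : (surface (m + 1)).real (⋃ e ∈ M.facesOf K, M.face e) ≤
      (surface (m + 1)).real (⋃ l ∈ Finset.univ, simplexSet (facetVert (M.vert K) l)) := by
    refine measureReal_mono ?_ ?_
    · refine iUnion₂_subset fun e he => (M.face_subset_frontier he).trans ?_
      rw [cell, frontier_cell_eq]; simp
    · exact ((measure_biUnion_finset_le _ _).trans_lt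
        (ENNReal.sum_lt_top.2 fun l _ => (hausdorff_simplexSet_ne_top _).lt_top)).ne
  have h3 := (M.sum_surface_face (M.facesOf K)).trans_le
    (h2.trans (measureReal_biUnion_finset_le _ _))
  have h4 := Finset.sum_le_sum fun l (_ : l ∈ Finset.univ) => M.surface_facet_le K hK l
  rw [Finset.sum_const, nsmul_eq_mul, Finset.card_univ, Fintype.card_fin] at h4
  rw [le_div_iff₀ hc]
  have h5 := h1.trans (h3.trans h4)
  have hp : 0 < h ^ m := by positivity
  push_cast at h5
  refine le_of_mul_le_mul_right ?_ hp
  calc _ = ((M.facesOf K).card : ℝ) * (c * h ^ m) := by ring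
    _ ≤ _ := h5
    _ = _ := by ring

/-- The boundary faces tile ∂Ω, so their number is O(h^(-m)) with a constant given by the area of
∂Ω. -/
lemma card_bdryFaces_mul_le {c h : ℝ}
    (hf : ∀ e, c * h ^ m ≤ (surface (m + 1)).real (M.face e)) :
    (M.bdryFaces.card : ℝ) * (c * h ^ m) ≤ (surface (m + 1)).real (frontier Ω) := by
  have h1 : (M.bdryFaces.card : ℝ) * (c * h ^ m) ≤
      ∑ e ∈ M.bdryFaces, (surface (m + 1)).real (M.face e) := by
    rw [← nsmul_eq_mul]
    exact Finset.card_nsmul_le_sum _ _ _ fun e _ => hf e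
  refine h1.trans (le_of_eq ?_)
  rw [M.sum_surface_face, M.frontier_domain]
  simp [mem_bdryFaces, face]

end Succ

end Mesh

/-! ### Inequalities on the reference element -/

/-- The vertices of the reference simplex. -/
noncomputable def refVert (d : ℕ) : Fin (d + 1) → Pt d :=
  Fin.cons 0 fun j => EuclideanSpace.single j 1

lemma refBary_sum_refVert {d : ℕ} (w : Fin (d + 1) → ℝ) (hw : ∑ i, w i = 1)
    (i : Fin (d + 1)) : refBary (∑ i, w i • refVert d i).ofLp i = w i := by
  have h : ∀ j : Fin d, (∑ i, w i • refVert d i).ofLp j = w j.succ := by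
    intro j
    rw [Fin.sum_univ_succ]
    simp [refVert, Pi.single_apply]
  rw [Fin.sum_univ_succ] at hw
  refine Fin.cases ?_ (fun j => ?_) i
  · simp only [refBary, Fin.cons_zero, h]; linarith
  · simp only [refBary, Fin.cons_succ, h]

lemma eq_of_refBary_eq {d : ℕ} {x y : Pt d} (h : ∀ i, refBary x.ofLp i = refBary y.ofLp i) :
    x = y := by
  ext j
  simpa [refBary] using h j.succ

/-- The parametrisation of the facet opposite to the vertex `l` of the reference simplex. -/
noncomputable def facetRef {m : ℕ} (l : Fin (m + 2)) (s : Pt m) : Pt (m + 1) :=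
  simplexMap (fun i => refVert (m + 1) (l.succAbove i)) s

lemma refBary_facetRef {m : ℕ} (l : Fin (m + 2)) (s : Pt m) (i : Fin (m + 2)) :
    refBary (facetRef l s).ofLp i = (l.insertNth 0 (refBary s.ofLp) : Fin (m + 2) → ℝ) i := by
  have h : facetRef l s =
      ∑ i, (l.insertNth 0 (refBary s.ofLp) : Fin (m + 2) → ℝ) i • refVert (m + 1) i := by
    rw [facetRef, simplexMap_eq_sum, Fin.sum_univ_succAbove _ l]
    simp
  rw [h, refBary_sum_refVert]
  rw [Fin.sum_univ_succAbove _ l]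
  simp [sum_refBary]

lemma refCoord_simplexMap_facet {m : ℕ} (b : AffineBasis (Fin (m + 2)) ℝ (Pt (m + 1)))
    (l : Fin (m + 2)) (s : Pt m) :
    refCoord b (simplexMap (facetVert b l) s) = facetRef l s :=
  eq_of_refBary_eq fun i => by
    rw [refBary_refCoord, coord_simplexMap_facet, refBary_facetRef]

lemma exists_facetRef_eq {m : ℕ} (l : Fin (m + 2)) {x : Pt (m + 1)}
    (hx : refBary x.ofLp l = 0) : ∃ s, facetRef l s = x := by
  set s : Pt m := WithLp.toLp 2 fun i => refBary x.ofLp (l.succAbove i.succ) with hs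
  have h := sum_refBary x.ofLp
  rw [Fin.sum_univ_succAbove _ l, hx, Fin.sum_univ_succ] at h
  refine ⟨s, eq_of_refBary_eq fun i => ?_⟩
  rw [refBary_facetRef]
  rcases Fin.eq_self_or_eq_succAbove l i with rfl | ⟨i, rfl⟩
  · simp [hx]
  · rw [Fin.insertNth_apply_succAbove]
    refine Fin.cases ?_ (fun j => ?_) i
    · rw [refBary, Fin.cons_zero]
      simp only [hs]
      linarith
    · rw [refBary, Fin.cons_succ]

lemma analyticOnNhd_simplexMap {n d : ℕ} (v : Fin (n + 1) → Pt d) :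
    AnalyticOnNhd ℝ (simplexMap v) univ :=
  analyticOnNhd_const.add
    ((LinearMap.toContinuousLinearMap (edgeMap v)).analyticOnNhd univ)

lemma continuous_uncurry_simplexMap {n d : ℕ} :
    Continuous fun z : (Fin (n + 1) → Pt d) × Pt n => simplexMap z.1 z.2 := by
  simp only [simplexMap, edgeMap_apply]
  fun_prop

/-- The matrix form makes the determinant visibly continuous in the vertices. -/
lemma det_edgeMap {n : ℕ} (g : Fin (n + 1) → Pt n) :
    LinearMap.det (edgeMap g) = Matrix.det (Matrix.of fun i j => (g j.succ - g 0) i) := by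
  rw [← LinearMap.det_toMatrix (EuclideanSpace.basisFun (Fin n) ℝ).toBasis]
  congr 1
  ext i j
  simp [LinearMap.toMatrix_apply]

/-- A nonnegative continuous function with vanishing integral over the reference simplex vanishes
in its interior. -/
lemma eqOn_zero_of_integral_refSimplex {n : ℕ} {g : Pt n → ℝ} (hg : Continuous g)
    (h0 : ∀ x, 0 ≤ g x) (hint : ∫ x in refSimplex n, g x = 0) :
    EqOn g 0 (interior (refSimplex n)) := by
  have h1 := (setIntegral_eq_zero_iff_of_nonneg_ae (Filter.Eventually.of_forall h0)
    (hg.continuousOn.integrableOn_compact (isCompact_refSimplex n))).1 hint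
  exact Measure.eqOn_open_of_ae_eq
    (ae_restrict_of_ae_restrict_of_subset interior_subset h1) isOpen_interior
    hg.continuousOn continuousOn_const

lemma eq_zero_of_analytic_of_eqOn {n : ℕ} {g : Pt n → ℝ} (hg : AnalyticOnNhd ℝ g univ)
    (h : EqOn g 0 (interior (refSimplex n))) (x : Pt n) : g x = 0 := by
  obtain ⟨z, hz⟩ := interior_refSimplex_nonempty n
  exact hg.eqOn_zero_of_preconnected_of_eventuallyEq_zero isPreconnected_univ (mem_univ z)
    (Filter.eventuallyEq_of_mem (isOpen_interior.mem_nhds hz) h) (mem_univ x)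

lemma exists_pos_le_of_isCompact {X : Type*} [TopologicalSpace X] {Z : Set X} (hZ : IsCompact Z)
    {Q : X → ℝ} (hQ : Continuous Q) (hpos : ∀ z ∈ Z, 0 < Q z) :
    ∃ c, 0 < c ∧ ∀ z ∈ Z, c ≤ Q z := by
  rcases Z.eq_empty_or_nonempty with rfl | hne
  · exact ⟨1, one_pos, by simp⟩
  · obtain ⟨z, hz, hmin⟩ := hZ.exists_isMinOn hne hQ.continuousOn
    exact ⟨Q z, hpos z hz, fun y hy => hmin hy⟩

namespace RefElement

variable {d k : ℕ} (R : RefElement d k)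

/-- The function on the reference simplex with the coefficients `w`. -/
noncomputable def toFun (w : R.Idx → ℝ) (x : Pt d) : ℝ :=
  ∑ i, MvPolynomial.eval x.ofLp (R.shape i : MvPolynomial (Fin d) ℝ) * w i

lemma analyticOnNhd_shape (i : R.Idx) : AnalyticOnNhd ℝ
    (fun x : Pt d => MvPolynomial.eval x.ofLp (R.shape i : MvPolynomial (Fin d) ℝ)) univ :=
  (AnalyticOnNhd.eval_mvPolynomial (R.shape i : MvPolynomial (Fin d) ℝ)).comp
    ((EuclideanSpace.equiv (Fin d) ℝ).toContinuousLinearMap.analyticOnNhd univ)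
    (mapsTo_univ _ _)

lemma analyticOnNhd_toFun (w : R.Idx → ℝ) : AnalyticOnNhd ℝ (R.toFun w) univ := by
  have := Finset.univ.analyticOnNhd_fun_sum (f := fun i (x : Pt d) =>
    MvPolynomial.eval x.ofLp (R.shape i : MvPolynomial (Fin d) ℝ) * w i)
    fun i _ => (R.analyticOnNhd_shape i).mul analyticOnNhd_const
  exact this

lemma contDiff_toFun (w : R.Idx → ℝ) {n : WithTop ℕ∞} : ContDiff ℝ n (R.toFun w) :=
  (R.analyticOnNhd_toFun w).contDiff

lemma continuous_toFun_comp {X : Type*} [TopologicalSpace X] {w : X → R.Idx → ℝ} {x : X → Pt d}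
    (hw : Continuous w) (hx : Continuous x) : Continuous fun z => R.toFun (w z) (x z) := by
  simp only [toFun]
  refine continuous_finsetSum _ fun i _ => Continuous.mul ?_ ((continuous_apply _).comp hw)
  exact (MvPolynomial.continuous_eval _).comp ((PiLp.continuous_ofLp 2 _).comp hx)

lemma sum_eval_shape (x : Pt d) :
    ∑ i, MvPolynomial.eval x.ofLp (R.shape i : MvPolynomial (Fin d) ℝ) = 1 := by
  rw [← map_sum, R.sum_shape, map_one]

/-- Since the shape functions sum to one, subtracting a constant from a function means subtracting
it from all coefficients. -/
lemma toFun_sub_const (w : R.Idx → ℝ) (c : ℝ) (x : Pt d) :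
    R.toFun (fun i => w i - c) x = R.toFun w x - c := by
  simp only [toFun, mul_sub, Finset.sum_sub_distrib]
  rw [← Finset.sum_mul, R.sum_eval_shape, one_mul]

lemma toFun_smul (w : R.Idx → ℝ) (c : ℝ) (x : Pt d) :
    R.toFun (c • w) x = c * R.toFun w x := by
  simp only [toFun, Finset.mul_sum, Pi.smul_apply, smul_eq_mul]
  exact Finset.sum_congr rfl fun i _ => by ring

lemma eq_zero_of_toFun_eq_zero {w : R.Idx → ℝ} (h : ∀ x, R.toFun w x = 0) : w = 0 := by
  have h1 : ∑ i, w i • R.shape i = 0 := by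
    apply Subtype.ext
    refine MvPolynomial.funext fun ξ => ?_
    have h2 := h (WithLp.toLp 2 ξ)
    simp only [toFun] at h2
    simp only [Submodule.coe_sum, Submodule.coe_smul, map_sum, MvPolynomial.smul_eval,
      ZeroMemClass.coe_zero, map_zero]
    rw [← h2]
    exact Finset.sum_congr rfl fun i _ => mul_comm _ _
  funext i
  exact Fintype.linearIndependent_iff.1 R.shape.linearIndependent w h1 i

lemma fderiv_toFun (w : R.Idx → ℝ) (x : Pt d) : fderiv ℝ (R.toFun w) x =
    ∑ i, w i • fderiv ℝ (fun x : Pt d =>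
      MvPolynomial.eval x.ofLp (R.shape i : MvPolynomial (Fin d) ℝ)) x := by
  have h : HasFDerivAt (R.toFun w) (∑ i, w i • fderiv ℝ (fun x : Pt d =>
      MvPolynomial.eval x.ofLp (R.shape i : MvPolynomial (Fin d) ℝ)) x) x :=
    HasFDerivAt.fun_sum fun i _ =>
      ((R.analyticOnNhd_shape i x (mem_univ x)).differentiableAt.hasFDerivAt.mul_const (w i))
  exact h.fderiv

lemma continuous_uncurry_fderiv_toFun :
    Continuous fun z : (R.Idx → ℝ) × Pt d => fderiv ℝ (R.toFun z.1) z.2 := by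
  simp only [fderiv_toFun]
  refine continuous_finsetSum _ fun i _ =>
    Continuous.smul ((continuous_apply i).comp continuous_fst) ?_
  exact ((R.analyticOnNhd_shape i).contDiff.continuous_fderiv (n := 1) (by norm_num)).comp
    continuous_snd

/-- A Poincaré inequality: the coefficients deviate from the value at the first vertex at most by a
multiple of the `L²` norm of the gradient. -/
theorem exists_coeff_sub_sq_le : ∃ C : ℝ, 0 ≤ C ∧ ∀ (w : R.Idx → ℝ) (i : R.Idx),
    (w i - R.toFun w 0) ^ 2 ≤ C * ∫ x in refSimplex d, ‖fderiv ℝ (R.toFun w) x‖ ^ 2 := by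
  set Q : (R.Idx → ℝ) → ℝ := fun w => ∫ x in refSimplex d, ‖fderiv ℝ (R.toFun w) x‖ ^ 2 with hQ
  have hunc : Continuous (Function.uncurry fun (w : R.Idx → ℝ) (x : Pt d) =>
      ‖fderiv ℝ (R.toFun w) x‖ ^ 2) :=
    (continuous_pow 2).comp R.continuous_uncurry_fderiv_toFun.norm
  have hQc : Continuous Q :=
    continuous_parametric_integral_of_continuous hunc (isCompact_refSimplex d)
  have hQ0 : ∀ w, 0 ≤ Q w := fun w => integral_nonneg fun x => by positivity
  -- Normalised coefficient vectors whose function vanishes at the origin: on this compact set the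
  -- gradient energy is positive, hence bounded below, and the general case follows by homogeneity.
  set Z : Set (R.Idx → ℝ) := Metric.sphere 0 1 ∩ {w | R.toFun w 0 = 0} with hZ
  have hZc : IsCompact Z := (isCompact_sphere 0 1).inter_right <| isClosed_eq
    (R.continuous_toFun_comp continuous_id continuous_const)
    continuous_const
  have hpos : ∀ w ∈ Z, 0 < Q w := by
    rintro w ⟨hw1, hw0⟩
    refine lt_of_le_of_ne (hQ0 w) fun h => ?_
    have h1 := eqOn_zero_of_integral_refSimplex (g := fun x => ‖fderiv ℝ (R.toFun w) x‖ ^ 2)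
      (((R.contDiff_toFun w).continuous_fderiv (n := 1) (by norm_num)).norm.pow 2)
      (fun x => by positivity) h.symm
    obtain ⟨a, ha⟩ := isOpen_interior.exists_is_const_of_fderiv_eq_zero (𝕜 := ℝ) (f := R.toFun w)
      (convex_refSimplex d).interior.isPreconnected
      ((R.contDiff_toFun w).differentiable (n := 1) (by norm_num)).differentiableOn
      (fun x hx => by simpa using h1 hx)
    -- A function with zero gradient is a constant a. Independence of the shape functions makes all
    -- coefficients equal to a, and the value at the origin gives a = 0.
    have h2 := R.eq_zero_of_toFun_eq_zero (w := fun i => w i - a)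
      (eq_zero_of_analytic_of_eqOn (R.analyticOnNhd_toFun _) fun x hx => by
        rw [R.toFun_sub_const, ha x hx, sub_self]; rfl)
    have h3 : a = 0 := by
      have := R.toFun_sub_const w a 0
      rw [h2, hw0] at this
      simp [toFun] at this
      exact this
    rw [h3] at h2
    simp only [sub_zero] at h2
    have h4 : w = 0 := h2
    rw [h4] at hw1
    simp at hw1
  obtain ⟨c, hc, hcZ⟩ := exists_pos_le_of_isCompact hZc hQc hpos
  refine ⟨c⁻¹, by positivity, fun w i => ?_⟩
  set w' : R.Idx → ℝ := fun i => w i - R.toFun w 0 with hw'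
  have hQw : Q w' = Q w := by
    have : R.toFun w' = fun x => R.toFun w x - R.toFun w 0 :=
      funext fun x => R.toFun_sub_const w _ x
    simp only [hQ, this, fderiv_sub_const]
  change (w' i) ^ 2 ≤ c⁻¹ * Q w
  rw [← hQw]
  rcases eq_or_ne w' 0 with h0 | h0
  · rw [h0]
    simp only [Pi.zero_apply]
    rw [zero_pow two_ne_zero]
    exact mul_nonneg (by positivity) (hQ0 0)
  have hn : 0 < ‖w'‖ := norm_pos_iff.2 h0
  have hmem : ‖w'‖⁻¹ • w' ∈ Z := by
    refine ⟨?_, ?_⟩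
    · rw [mem_sphere_zero_iff_norm, norm_smul, norm_inv, norm_norm, inv_mul_cancel₀ hn.ne']
    · change R.toFun _ 0 = 0
      rw [toFun_smul, toFun_sub_const, sub_self, mul_zero]
  have h1 := hcZ _ hmem
  have h2 : Q (‖w'‖⁻¹ • w') = (‖w'‖⁻¹) ^ 2 * Q w' := by
    have : R.toFun (‖w'‖⁻¹ • w') = fun x => ‖w'‖⁻¹ * R.toFun w' x :=
      funext fun x => R.toFun_smul w' _ x
    simp only [hQ, this]
    rw [← integral_const_mul]
    congr 1
    ext x
    rw [fderiv_const_mul ((R.contDiff_toFun w').differentiable (n := 1) (by norm_num) x), norm_smul,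
      mul_pow, norm_inv, norm_norm]
  rw [h2] at h1
  have h3 : (w' i) ^ 2 ≤ ‖w'‖ ^ 2 := by
    rw [← sq_abs]
    gcongr
    exact norm_le_pi_norm w' i
  refine h3.trans ?_
  rw [inv_pow, inv_mul_eq_div, le_div_iff₀ (by positivity)] at h1
  rw [inv_mul_eq_div, le_div_iff₀ hc]
  linarith

/-- The shape functions are bounded on the reference simplex. -/
lemma exists_shape_bound : ∃ B : ℝ, 0 ≤ B ∧ ∀ x ∈ refSimplex d, ∀ i,
    |MvPolynomial.eval x.ofLp (R.shape i : MvPolynomial (Fin d) ℝ)| ≤ B := by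
  have h : ∀ i, ∃ B : ℝ, ∀ x ∈ refSimplex d,
      |MvPolynomial.eval x.ofLp (R.shape i : MvPolynomial (Fin d) ℝ)| ≤ B := fun i =>
    (isCompact_refSimplex d).exists_bound_of_continuousOn
      ((R.analyticOnNhd_shape i).continuousOn.mono (subset_univ _))
  choose B hB using h
  refine ⟨∑ i, |B i|, by positivity, fun x hx i => (hB i x hx).trans ((le_abs_self _).trans ?_)⟩
  exact Finset.single_le_sum (f := fun i => |B i|) (fun _ _ => abs_nonneg _) (Finset.mem_univ i)

end RefElement

/-! ### Traces on subsimplices of a facet -/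

namespace RefElement

variable {m k : ℕ} (R : RefElement (m + 1) k)

/-- The shape function `i` does not vanish identically on the facet opposite to `l`. -/
def IsOnFacet (l : Fin (m + 2)) (i : R.Idx) : Prop :=
  ∃ ξ : Fin (m + 1) → ℝ, refBary ξ l = 0 ∧
    MvPolynomial.eval ξ (R.shape i : MvPolynomial (Fin (m + 1)) ℝ) ≠ 0

lemma refBary_facetRef_self (l : Fin (m + 2)) (s : Pt m) :
    refBary (facetRef l s).ofLp l = 0 := by
  rw [refBary_facetRef]; simp

/-- The coefficients that live on a facet are bounded by the maximum of the function on any simplex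
in this facet whose area is not too small. -/
theorem exists_facet_coeff_le {c₀ : ℝ} (hc₀ : 0 < c₀) (l : Fin (m + 2)) :
    ∃ C : ℝ, 0 ≤ C ∧ ∀ g : Fin (m + 1) → Pt m, (∀ i, g i ∈ refSimplex m) →
      c₀ ≤ |LinearMap.det (edgeMap g)| → ∀ (w : R.Idx → ℝ) (M : ℝ),
      (∀ s ∈ refSimplex m, |R.toFun w (facetRef l (simplexMap g s))| ≤ M) →
      ∀ i, R.IsOnFacet l i → |w i| ≤ C * M := by
  classical
  set Q : (R.Idx → ℝ) × (Fin (m + 1) → Pt m) → ℝ := fun z =>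
    ∫ s in refSimplex m, R.toFun z.1 (facetRef l (simplexMap z.2 s)) ^ 2 with hQ
  have hcont : Continuous fun z : ((R.Idx → ℝ) × (Fin (m + 1) → Pt m)) × Pt m =>
      R.toFun z.1.1 (facetRef l (simplexMap z.1.2 z.2)) := by
    have h1 : Continuous fun z : ((R.Idx → ℝ) × (Fin (m + 1) → Pt m)) × Pt m =>
        simplexMap z.1.2 z.2 :=
      continuous_uncurry_simplexMap.comp
        ((continuous_snd.comp continuous_fst).prodMk continuous_snd)
    have h2 : Continuous fun z : ((R.Idx → ℝ) × (Fin (m + 1) → Pt m)) × Pt m =>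
        facetRef l (simplexMap z.1.2 z.2) := (continuous_simplexMap _).comp h1
    exact R.continuous_toFun_comp (continuous_fst.comp continuous_fst) h2
  have hunc : Continuous (Function.uncurry fun (z : (R.Idx → ℝ) × (Fin (m + 1) → Pt m)) s =>
      R.toFun z.1 (facetRef l (simplexMap z.2 s)) ^ 2) := (continuous_pow 2).comp hcont
  have hQc : Continuous Q :=
    continuous_parametric_integral_of_continuous hunc (isCompact_refSimplex m)
  -- Compactness is used in the coefficients and in the position of the subsimplex at once, so that
  -- one constant serves all faces. The lower bound on the determinant keeps degenerate subsimplices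
  -- out of the compact set.
  set Z : Set ((R.Idx → ℝ) × (Fin (m + 1) → Pt m)) :=
    ((Metric.sphere 0 1 ∩ ⋂ i : {i // ¬ R.IsOnFacet l i}, {w | w i = 0}) ×ˢ
      (univ.pi fun _ => refSimplex m)) ∩ {z | c₀ ≤ |LinearMap.det (edgeMap z.2)|} with hZ
  have hZc : IsCompact Z := by
    refine IsCompact.inter_right (IsCompact.prod ((isCompact_sphere 0 1).inter_right ?_)
      (isCompact_univ_pi fun _ => isCompact_refSimplex m)) ?_
    · exact isClosed_iInter fun i => isClosed_eq (continuous_apply _) continuous_const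
    · refine isClosed_le continuous_const (Continuous.abs ?_)
      simp only [det_edgeMap]
      refine Continuous.matrix_det ?_
      refine continuous_matrix fun i j => ?_
      simp only [Matrix.of_apply]
      fun_prop
  have hvanish : ∀ (w : R.Idx → ℝ) (x : Pt (m + 1)), refBary x.ofLp l = 0 →
      R.toFun (fun i => if R.IsOnFacet l i then w i else 0) x = R.toFun w x := by
    intro w x hx
    refine Finset.sum_congr rfl fun i _ => ?_
    simp only
    split_ifs with hi
    · rfl
    · have : MvPolynomial.eval x.ofLp (R.shape i : MvPolynomial (Fin (m + 1)) ℝ) = 0 := by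
        by_contra h; exact hi ⟨_, hx, h⟩
      rw [this, zero_mul, zero_mul]
  have hpos : ∀ z ∈ Z, 0 < Q z := by
    rintro ⟨w, g⟩ ⟨⟨⟨hw1, hw0⟩, -⟩, hdet⟩
    refine lt_of_le_of_ne (integral_nonneg fun s => by positivity) fun h => ?_
    have hcg : Continuous fun s => R.toFun w (facetRef l (simplexMap g s)) :=
      R.continuous_toFun_comp continuous_const
        ((continuous_simplexMap _).comp (continuous_simplexMap g))
    have h1 := eqOn_zero_of_integral_refSimplex (hcg.pow 2) (fun x => sq_nonneg _) h.symm
    have han : AnalyticOnNhd ℝ (fun s => R.toFun w (facetRef l (simplexMap g s))) univ :=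
      (R.analyticOnNhd_toFun w).comp ((analyticOnNhd_simplexMap _).comp
        (analyticOnNhd_simplexMap g) (mapsTo_univ _ _)) (mapsTo_univ _ _)
    -- Vanishing on the subsimplex extends by analyticity to all parameters. As the subsimplex is
    -- nondegenerate, these reach the whole hyperplane of the facet, where `facet_independent`
    -- applies.
    have h2 := eq_zero_of_analytic_of_eqOn han fun s hs => by
      have := h1 hs
      simpa using this
    have hd0 : LinearMap.det (edgeMap g) ≠ 0 := by
      intro h0
      change c₀ ≤ |LinearMap.det (edgeMap g)| at hdet
      rw [h0, abs_zero] at hdet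
      exact absurd hdet (not_le.2 hc₀)
    have hsurj : Function.Surjective (edgeMap g) :=
      (LinearMap.equivOfDetNeZero (edgeMap g) hd0).surjective
    have h3 : ∀ x : Pt (m + 1), refBary x.ofLp l = 0 → R.toFun w x = 0 := by
      intro x hx
      obtain ⟨s, rfl⟩ := exists_facetRef_eq l hx
      obtain ⟨t, ht⟩ := hsurj (s - g 0)
      have := h2 t
      rwa [simplexMap, ht, add_sub_cancel] at this
    have h4 : w = 0 := by
      funext i
      by_cases hi : R.IsOnFacet l i
      · refine R.facet_independent l w (fun ξ hξ => ?_) i hi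
        rw [← h3 (WithLp.toLp 2 ξ) hξ]
        exact Finset.sum_congr rfl fun i _ => mul_comm _ _
      · exact mem_iInter.1 hw0 ⟨i, hi⟩
    rw [h4] at hw1
    simp at hw1
  obtain ⟨c, hc, hcZ⟩ := exists_pos_le_of_isCompact hZc hQc hpos
  set V := (volume : Measure (Pt m)).real (refSimplex m) with hV
  have hVpos : 0 < V := volume_real_refSimplex_pos m
  refine ⟨Real.sqrt (V / c), Real.sqrt_nonneg _, fun g hg hdet w M hM i hi => ?_⟩
  obtain ⟨s₀, hs₀⟩ := interior_refSimplex_nonempty m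
  have hM0 : 0 ≤ M := (abs_nonneg _).trans (hM s₀ (interior_subset hs₀))
  -- Coefficients of shape functions that vanish on the facet do not affect the trace; setting them
  -- to zero brings the normalised vector into `Z`.
  set w' : R.Idx → ℝ := fun i => if R.IsOnFacet l i then w i else 0 with hw'
  have hwi : w i = w' i := by simp [hw', hi]
  rw [hwi]
  rcases eq_or_ne w' 0 with h0 | h0
  · rw [h0]; simp only [Pi.zero_apply, abs_zero]; positivity
  have hn : 0 < ‖w'‖ := norm_pos_iff.2 h0
  have hmem : (‖w'‖⁻¹ • w', g) ∈ Z := by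
    refine ⟨⟨⟨?_, ?_⟩, fun i _ => hg i⟩, hdet⟩
    · rw [mem_sphere_zero_iff_norm, norm_smul, norm_inv, norm_norm, inv_mul_cancel₀ hn.ne']
    · refine mem_iInter.2 fun j => ?_
      change ‖w'‖⁻¹ * w' j = 0
      simp [hw', j.2]
  have h1 := hcZ _ hmem
  have h2 : Q (‖w'‖⁻¹ • w', g) ≤ (‖w'‖⁻¹) ^ 2 * (M ^ 2 * V) := by
    have hle : ∀ s ∈ refSimplex m,
        R.toFun (‖w'‖⁻¹ • w') (facetRef l (simplexMap g s)) ^ 2 ≤ (‖w'‖⁻¹) ^ 2 * M ^ 2 := by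
      intro s hs
      rw [toFun_smul, hvanish w _ (refBary_facetRef_self l _), mul_pow, ← sq_abs (R.toFun w _)]
      have := hM s hs
      gcongr
    have hcg : Continuous fun s => R.toFun (‖w'‖⁻¹ • w') (facetRef l (simplexMap g s)) ^ 2 :=
      (continuous_pow 2).comp (R.continuous_toFun_comp continuous_const
        ((continuous_simplexMap _).comp (continuous_simplexMap g)))
    have := setIntegral_mono_on (hcg.continuousOn.integrableOn_compact (isCompact_refSimplex m))
      (integrableOn_const (volume_refSimplex_ne_top m)) (measurableSet_refSimplex m) hle
    rw [setIntegral_const, smul_eq_mul, ← hV] at this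
    linarith
  have h3 : ‖w'‖ ^ 2 ≤ V / c * M ^ 2 := by
    have h4 := h1.trans h2
    rw [inv_pow, inv_mul_eq_div, le_div_iff₀ (by positivity)] at h4
    rw [div_mul_eq_mul_div, le_div_iff₀ hc]
    linarith
  refine (norm_le_pi_norm w' i).trans ?_
  refine (Real.le_sqrt hn.le (by positivity)).2 h3 |>.trans (le_of_eq ?_)
  rw [Real.sqrt_mul (by positivity), Real.sqrt_sq hM0]

end RefElement

/-! ### Inequalities on the elements of a mesh -/

lemma norm_edgeMap_le {n d : ℕ} (v : Fin (n + 1) → Pt d) {h : ℝ} (hh : 0 ≤ h)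
    (hv : ∀ j : Fin n, ‖v j.succ - v 0‖ ≤ h) :
    ‖LinearMap.toContinuousLinearMap (edgeMap v)‖ ≤ n * h := by
  refine ContinuousLinearMap.opNorm_le_bound _ (by positivity) fun x => ?_
  rw [LinearMap.coe_toContinuousLinearMap', edgeMap_apply]
  calc ‖∑ j, x j • (v j.succ - v 0)‖ ≤ ∑ j : Fin n, ‖x‖ * h := by
        refine norm_sum_le_of_le _ fun j _ => ?_
        rw [norm_smul]
        exact mul_le_mul (PiLp.norm_apply_le x j) (hv j) (norm_nonneg _) (norm_nonneg _)
    _ = n * h * ‖x‖ := by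
        rw [Finset.sum_const, Finset.card_univ, Fintype.card_fin, nsmul_eq_mul]; ring

lemma contDiff_refCoord {d : ℕ} (b : AffineBasis (Fin (d + 1)) ℝ (Pt d)) {n : WithTop ℕ∞} :
    ContDiff ℝ n (refCoord b) := by
  refine contDiff_euclidean.2 fun j => ?_
  have h : ∀ x, refCoord b x j = b.coord j.succ 0 + (b.coord j.succ).linear x := fun x => by
    rw [← coord_add, zero_add]; rfl
  simp only [h]
  exact contDiff_const.add (LinearMap.toContinuousLinearMap (b.coord j.succ).linear).contDiff

lemma volume_simplexSet {d : ℕ} (v : Fin (d + 1) → Pt d) :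
    (volume : Measure (Pt d)).real (simplexSet v) =
      (edgeMap v).normDet * (volume : Measure (Pt d)).real (refSimplex d) := by
  rw [← hausdorff_simplexSet, EuclideanSpace.euclideanHausdorffMeasure_eq_volume]

namespace RefElement

variable {d k : ℕ} (R : RefElement d k)

/-- The coefficients on an element deviate from the value at the first vertex at most by a
multiple of the norm of the gradient. -/
theorem exists_coeff_sub_le {c : ℝ} (hc : 0 < c) : ∃ C : ℝ, 0 ≤ C ∧
    ∀ (b : AffineBasis (Fin (d + 1)) ℝ (Pt d)) (h : ℝ), 0 < h →
      (∀ j : Fin d, ‖b j.succ - b 0‖ ≤ h) →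
      c * h ^ d ≤ (volume : Measure (Pt d)).real (simplexSet b) →
      ∀ (w : R.Idx → ℝ) (i : R.Idx), |w i - R.toFun w 0| ≤ C * (h / Real.sqrt (h ^ d) *
        Real.sqrt (∫ x in simplexSet b, ‖fderiv ℝ (fun x => R.toFun w (refCoord b x)) x‖ ^ 2)) := by
  obtain ⟨C, hC, hCw⟩ := R.exists_coeff_sub_sq_le
  set V := (volume : Measure (Pt d)).real (refSimplex d) with hV
  have hVpos : 0 < V := volume_real_refSimplex_pos d
  refine ⟨Real.sqrt (C * (d ^ 2 * V / c)), Real.sqrt_nonneg _, fun b h hh hb hvol w i => ?_⟩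
  set ψ : Pt d → ℝ := fun x => R.toFun w (refCoord b x) with hψ
  have hψd : ContDiff ℝ 1 ψ := (R.contDiff_toFun w).comp (contDiff_refCoord b)
  set I := ∫ x in simplexSet b, ‖fderiv ℝ ψ x‖ ^ 2 with hI
  have hI0 : 0 ≤ I := integral_nonneg fun x => by positivity
  set δ := (edgeMap (b : Fin (d + 1) → Pt d)).normDet with hδ
  -- The density of the parametrisation is of order h^d from below; the volume bound enters only
  -- here.
  have hδV : c * h ^ d ≤ δ * V := by rw [← volume_simplexSet]; exact hvol
  have hδ0 : 0 < δ := by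
    have : 0 < δ * V := lt_of_lt_of_le (by positivity) hδV
    exact pos_of_mul_pos_left this hVpos.le
  have hcont : Continuous fun x => ‖fderiv ℝ ψ (simplexMap b x)‖ ^ 2 :=
    (continuous_pow 2).comp ((hψd.continuous_fderiv (by norm_num)).comp
      (continuous_simplexMap b)).norm
  have hIeq : I = δ * ∫ x in refSimplex d, ‖fderiv ℝ ψ (simplexMap b x)‖ ^ 2 := by
    have := integral_simplexSet b (simplexMap_injective b) (fun x => ‖fderiv ℝ ψ x‖ ^ 2)
    rw [EuclideanSpace.euclideanHausdorffMeasure_eq_volume] at this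
    rw [hI, this, smul_eq_mul]
  -- The chain rule: the differential of the parametrisation has norm at most d h.
  have hpt : ∀ x, ‖fderiv ℝ (R.toFun w) x‖ ^ 2 ≤
      (d * h) ^ 2 * ‖fderiv ℝ ψ (simplexMap b x)‖ ^ 2 := by
    intro x
    have h1 : R.toFun w = fun x => ψ (simplexMap b x) := by
      funext x; simp only [hψ, refCoord_simplexMap]
    have h2 : HasFDerivAt (simplexMap b)
        (LinearMap.toContinuousLinearMap (edgeMap (b : Fin (d + 1) → Pt d))) x :=
      ((LinearMap.toContinuousLinearMap (edgeMap b)).hasFDerivAt).const_add (b 0)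
    have h3 : HasFDerivAt (R.toFun w) ((fderiv ℝ ψ (simplexMap b x)).comp
        (LinearMap.toContinuousLinearMap (edgeMap (b : Fin (d + 1) → Pt d)))) x := by
      rw [h1]
      exact ((hψd.differentiable (by norm_num)) _).hasFDerivAt.comp x h2
    rw [h3.fderiv, ← mul_pow]
    gcongr
    refine (ContinuousLinearMap.opNorm_comp_le _ _).trans ?_
    rw [mul_comm]
    gcongr
    exact norm_edgeMap_le _ hh.le hb
  have hint : ∫ x in refSimplex d, ‖fderiv ℝ (R.toFun w) x‖ ^ 2 ≤ (d * h) ^ 2 * (I / δ) := by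
    rw [hIeq, mul_div_cancel_left₀ _ hδ0.ne', ← integral_const_mul]
    refine setIntegral_mono ?_ ?_ hpt
    · exact (((continuous_pow 2).comp ((R.contDiff_toFun w).continuous_fderiv (n := 1)
        (by norm_num)).norm).continuousOn).integrableOn_compact (isCompact_refSimplex d)
    · exact (continuous_const.mul hcont).continuousOn.integrableOn_compact (isCompact_refSimplex d)
  have hsq : (w i - R.toFun w 0) ^ 2 ≤ C * (d ^ 2 * V / c) * ((h / Real.sqrt (h ^ d)) ^ 2 * I) := by
    refine (hCw w i).trans ?_
    rw [mul_assoc]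
    refine mul_le_mul_of_nonneg_left (hint.trans ?_) hC
    rw [div_pow, Real.sq_sqrt (by positivity), mul_pow]
    have h1 : I / δ ≤ V / c * (I / h ^ d) := by
      rw [div_mul_div_comm, div_le_div_iff₀ hδ0 (by positivity)]
      nlinarith
    calc (d : ℝ) ^ 2 * h ^ 2 * (I / δ) ≤ (d : ℝ) ^ 2 * h ^ 2 * (V / c * (I / h ^ d)) := by gcongr
      _ = _ := by ring
  rw [← Real.sqrt_sq_eq_abs]
  refine (Real.sqrt_le_sqrt hsq).trans (le_of_eq ?_)
  have hCd : 0 ≤ C * (d ^ 2 * V / c) := by positivity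
  rw [Real.sqrt_mul hCd, Real.sqrt_mul (sq_nonneg _), Real.sqrt_sq (by positivity)]

lemma abs_toFun_le {B a : ℝ} {x : Pt d}
    (hx : ∀ i, |MvPolynomial.eval x.ofLp (R.shape i : MvPolynomial (Fin d) ℝ)| ≤ B)
    (hB : 0 ≤ B) {w : R.Idx → ℝ} (hw : ∀ i, |w i| ≤ a) :
    |R.toFun w x| ≤ Fintype.card R.Idx * B * a := by
  refine (Finset.abs_sum_le_sum_abs _ _).trans ?_
  calc ∑ i, |MvPolynomial.eval x.ofLp (R.shape i : MvPolynomial (Fin d) ℝ) * w i|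
      ≤ ∑ _i : R.Idx, B * a := Finset.sum_le_sum fun i _ => by
        rw [abs_mul]; exact mul_le_mul (hx i) (hw i) (abs_nonneg _) hB
    _ = _ := by rw [Finset.sum_const, Finset.card_univ, nsmul_eq_mul]; ring

end RefElement

/-! ### Finite element functions on a mesh -/

namespace Scheme

section General

variable {d k p : ℕ} {Ω : Set (Pt d)} {R : RefElement d k} (S : Scheme Ω R p)

/-- The coefficients on the element `K`. -/
def localCoeff (v : S.Dof → ℝ) (K : S.mesh.Elem) : R.Idx → ℝ := fun i => v (S.dof K i)

lemma eval_eq_toFun (v : S.Dof → ℝ) (K : S.mesh.Elem) (x : Pt d) :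
    S.eval v K x = R.toFun (S.localCoeff v K) (refCoord (S.mesh.vert K) x) := rfl

lemma mem_dofsElem {K : S.mesh.Elem} {σ : S.Dof} :
    σ ∈ S.dofsElem K ↔ ∃ i, S.dof K i = σ := by
  simp [dofsElem]

lemma card_dofsElem_le (K : S.mesh.Elem) : (S.dofsElem K).card ≤ Fintype.card R.Idx := by
  classical
  have : S.dofsElem K ⊆ Finset.univ.image (S.dof K) := by
    intro σ hσ
    obtain ⟨i, rfl⟩ := (S.mem_dofsElem).1 hσ
    exact Finset.mem_image_of_mem _ (Finset.mem_univ i)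
  exact (Finset.card_le_card this).trans Finset.card_image_le

lemma mem_dofsBdry {Γ : S.mesh.Face} {σ : S.Dof} :
    σ ∈ S.dofsBdry Γ ↔ ∃ i, S.dof (S.mesh.left Γ) i = σ ∧
      ∃ x ∈ S.mesh.face Γ, S.basisFun (S.mesh.left Γ) i x ≠ 0 := by
  simp [dofsBdry]

lemma dofsBdry_subset (Γ : S.mesh.Face) : S.dofsBdry Γ ⊆ S.dofsElem (S.mesh.left Γ) := by
  intro σ hσ
  obtain ⟨i, hi, -⟩ := (S.mem_dofsBdry).1 hσ
  exact (S.mem_dofsElem).2 ⟨i, hi⟩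

/-- The `L²` norm of the gradient on an element. -/
noncomputable def gradNorm (φ : Pt d → ℝ) (K : S.mesh.Elem) : ℝ :=
  Real.sqrt (∫ x in S.mesh.cell K, ‖fderiv ℝ φ x‖ ^ 2)

variable {S} {φ : Pt d → ℝ} {v : S.Dof → ℝ}

/-- In the open cell φ agrees with its local polynomial near every point, and the frontier of the
cell is null, so the derivative of φ across faces plays no role. -/
lemma IsContinuousFE.fderiv_eq (hφ : S.IsContinuousFE φ v) (K : S.mesh.Elem) :
    (fun x => ‖fderiv ℝ φ x‖ ^ 2) =ᵐ[volume.restrict (S.mesh.cell K)]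
      fun x => ‖fderiv ℝ
        (fun x => R.toFun (S.localCoeff v K) (refCoord (S.mesh.vert K) x)) x‖ ^ 2 := by
  have h : ∀ᵐ x : Pt d, x ∉ frontier (S.mesh.cell K) := by
    rw [ae_iff]; simpa using (S.mesh.convex_cell K).addHaar_frontier volume
  have h' := ae_restrict_of_ae (s := S.mesh.cell K) h
  filter_upwards [h', ae_restrict_mem (measurableSet_simplexSet _)] with x hx hxK
  have hxi : x ∈ interior (S.mesh.cell K) := by
    by_contra hn; exact hx ⟨subset_closure hxK, hn⟩
  congr 2
  refine Filter.EventuallyEq.fderiv_eq ?_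
  filter_upwards [isOpen_interior.mem_nhds hxi] with y hy
  rw [hφ K y (interior_subset hy), S.eval_eq_toFun]

lemma IsContinuousFE.gradNorm_eq (hφ : S.IsContinuousFE φ v) (K : S.mesh.Elem) :
    S.gradNorm φ K = Real.sqrt (∫ x in S.mesh.cell K, ‖fderiv ℝ
      (fun x => R.toFun (S.localCoeff v K) (refCoord (S.mesh.vert K) x)) x‖ ^ 2) := by
  rw [gradNorm, integral_congr_ae (hφ.fderiv_eq K)]

lemma IsContinuousFE.integrableOn (hφ : S.IsContinuousFE φ v) (K : S.mesh.Elem) :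
    IntegrableOn (fun x => ‖fderiv ℝ φ x‖ ^ 2) (S.mesh.cell K) := by
  refine Integrable.congr ?_ (hφ.fderiv_eq K).symm
  have hd : ContDiff ℝ 1 fun x => R.toFun (S.localCoeff v K) (refCoord (S.mesh.vert K) x) :=
    (R.contDiff_toFun _).comp (contDiff_refCoord _)
  exact ((continuous_pow 2).comp
    (hd.continuous_fderiv (by norm_num)).norm).continuousOn.integrableOn_compact
      (isCompact_simplexSet _)

/-- The first vertex of an element corresponds to the origin of the reference simplex, where the
Poincaré inequality is anchored. -/
lemma IsContinuousFE.vert_zero (hφ : S.IsContinuousFE φ v) (K : S.mesh.Elem) :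
    φ (S.mesh.vert K 0) = R.toFun (S.localCoeff v K) 0 := by
  rw [hφ K _ (S.mesh.vert_mem K 0), S.eval_eq_toFun]
  congr 1
  refine eq_of_refBary_eq fun i => ?_
  rw [refBary_refCoord]
  refine Fin.cases (by simp [refBary]) (fun j => ?_) i
  rw [(S.mesh.vert K).coord_apply_ne (Fin.succ_ne_zero j)]
  simp [refBary]

end General

section Succ

variable {m k p : ℕ} {Ω : Set (Pt (m + 1))} {R : RefElement (m + 1) k} {S : Scheme Ω R p}
  {φ : Pt (m + 1) → ℝ} {v : S.Dof → ℝ}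

lemma IsContinuousFE.sum_gradNorm_sq_le (hφ : S.IsContinuousFE φ v) :
    Real.sqrt (∑ K, S.gradNorm φ K ^ 2) ≤ h1Norm Ω φ := by
  have h1 : ∑ K, S.gradNorm φ K ^ 2 = ∫ x in Ω, ‖fderiv ℝ φ x‖ ^ 2 := by
    rw [S.mesh.integral_domain_eq_sum hφ.integrableOn]
    refine Finset.sum_congr rfl fun K _ => ?_
    rw [gradNorm, Real.sq_sqrt (integral_nonneg fun x => by positivity)]
  rw [h1, h1Norm]
  refine Real.sqrt_le_sqrt ?_
  have : 0 ≤ ∫ x in Ω, (φ x) ^ 2 := integral_nonneg fun x => by positivity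
  linarith

end Succ

end Scheme

/-- Simplices in a facet, in the coordinates of the facet. -/
lemma edgeMap_comp_facetCoord {m : ℕ} (b : AffineBasis (Fin (m + 2)) ℝ (Pt (m + 1)))
    (l : Fin (m + 2)) (v : Fin (m + 1) → Pt (m + 1)) (hv : ∀ i, b.coord l (v i) = 0) :
    edgeMap v = edgeMap (facetVert b l) ∘ₗ edgeMap fun i => facetCoord b l (v i) := by
  have h : ∀ i, edgeMap (facetVert b l) (facetCoord b l (v i)) = v i - facetVert b l 0 := by
    intro i
    have := simplexMap_facetCoord b l (hv i)
    rw [simplexMap] at this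
    exact eq_sub_of_add_eq' this
  refine LinearMap.ext fun x => ?_
  rw [LinearMap.comp_apply, edgeMap_apply v, edgeMap_apply (fun i => facetCoord b l (v i)),
    map_sum]
  refine Finset.sum_congr rfl fun j _ => ?_
  rw [map_smul, map_sub, h, h, sub_sub_sub_cancel_right]

lemma simplexMap_comp_facetCoord {m : ℕ} (b : AffineBasis (Fin (m + 2)) ℝ (Pt (m + 1)))
    (l : Fin (m + 2)) (v : Fin (m + 1) → Pt (m + 1)) (hv : ∀ i, b.coord l (v i) = 0) (s : Pt m) :
    simplexMap (facetVert b l) (simplexMap (fun i => facetCoord b l (v i)) s) =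
      simplexMap v s := by
  have h := simplexMap_facetCoord b l (hv 0)
  rw [simplexMap] at h
  rw [simplexMap, simplexMap, map_add, ← add_assoc, h, simplexMap,
    edgeMap_comp_facetCoord b l v hv, LinearMap.comp_apply]

namespace Scheme

variable {m k p : ℕ} {Ω : Set (Pt (m + 1))} (R : RefElement (m + 1) k)

open scoped MeasureTheory in
/-- On a boundary face, the coefficients are controlled by the values on this face. -/
theorem exists_bdry_coeff_le {c : ℝ} (hc : 0 < c) : ∃ C : ℝ, 0 ≤ C ∧
    ∀ (S : Scheme Ω R p), 0 < S.h →
    (∀ K, Metric.diam (S.mesh.cell K) ≤ S.h) →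
    (∀ e, c * S.h ^ m ≤ (Mesh.surface (m + 1)).real (S.mesh.face e)) →
    ∀ (φ : Pt (m + 1) → ℝ) (v : S.Dof → ℝ), S.IsContinuousFE φ v → ∀ (Γ : S.mesh.Face) (a M : ℝ),
      (∀ x ∈ S.mesh.face Γ, |φ x - a| ≤ M) → ∀ σ ∈ S.dofsBdry Γ, |v σ - a| ≤ C * M := by
  set V := (volume : Measure (Pt m)).real (refSimplex m) with hV
  have hVpos : 0 < V := volume_real_refSimplex_pos m
  have hfac : (0 : ℝ) < m.factorial := by exact_mod_cast m.factorial_pos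
  have hc₀ : 0 < c / (m.factorial * V) := by positivity
  choose C hC hCl using fun l => R.exists_facet_coeff_le hc₀ l
  refine ⟨∑ l, C l, Finset.sum_nonneg fun l _ => hC l, ?_⟩
  intro S hh hdiam hface φ v hφ Γ a M hM σ hσ
  obtain ⟨i, rfl, x, hx, hix⟩ := (S.mem_dofsBdry).1 hσ
  set K := S.mesh.left Γ with hK
  set b := S.mesh.vert K with hb
  have hpos : 0 < (Mesh.surface (m + 1)).real (S.mesh.face Γ) :=
    lt_of_lt_of_le (by positivity) (hface Γ)
  obtain ⟨l, hl, -⟩ := S.mesh.exists_facet (S.mesh.left_mem Γ) hpos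
  have hfv : ∀ i, S.mesh.faceVert Γ i ∈ simplexSet (facetVert b l) := fun i =>
    hl (S.mesh.faceVert_mem Γ i)
  have hv0 : ∀ i, b.coord l (S.mesh.faceVert Γ i) = 0 := fun i => ((mem_facet b).1 (hfv i)).2
  set g : Fin (m + 1) → Pt m := fun i => facetCoord b l (S.mesh.faceVert Γ i) with hg
  have hgmem : ∀ i, g i ∈ refSimplex m := by
    intro i
    rw [mem_refSimplex]
    intro j
    rw [refBary_facetCoord b l (hv0 i)]
    exact (mem_cell b).1 ((mem_facet b).1 (hfv i)).1 _
  -- The area of the face is the density of the facet times this determinant times the reference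
  -- volume. The face has area at least c h^m and the facet density is at most m! h^m, so h cancels.
  have hdet : c / (m.factorial * V) ≤ |LinearMap.det (edgeMap g)| := by
    have h1 : (Mesh.surface (m + 1)).real (S.mesh.face Γ) =
        (edgeMap (facetVert b l)).normDet * |LinearMap.det (edgeMap g)| * V := by
      have h2 := hausdorff_simplexSet (n := m) (S.mesh.faceVert Γ)
      rw [edgeMap_comp_facetCoord b l _ hv0, LinearMap.normDet_comp_of_finrank_eq _ _ rfl,
        LinearMap.normDet_eq_abs_det] at h2
      exact h2
    have h3 : (edgeMap (facetVert b l)).normDet ≤ m.factorial * S.h ^ m :=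
      normDet_edgeMap_le _ hh.le fun j =>
        (S.mesh.norm_sub_le_diam (S.mesh.vert_mem K _) (S.mesh.vert_mem K _)).trans (hdiam K)
    have h4 := hface Γ
    rw [h1] at h4
    have h5 : c * S.h ^ m ≤ (m.factorial * S.h ^ m) * |LinearMap.det (edgeMap g)| * V :=
      h4.trans (by gcongr)
    rw [div_le_iff₀ (by positivity)]
    refine le_of_mul_le_mul_right ?_ (by positivity : 0 < S.h ^ m)
    calc _ ≤ _ := h5
      _ = _ := by ring
  have hon : R.IsOnFacet l i := by
    refine ⟨fun j => b.coord j.succ x, ?_, hix⟩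
    have := refBary_refCoord b x l
    rw [((mem_facet b).1 (hl hx)).2] at this
    exact this
  -- The trace inequality is applied to φ - a, whose local coefficients are those of φ minus a.
  have key := hCl l g hgmem hdet (fun i => S.localCoeff v K i - a) M (by
    intro s hs
    rw [R.toFun_sub_const, ← refCoord_simplexMap_facet b, simplexMap_comp_facetCoord b l _ hv0]
    have hmem : simplexMap (S.mesh.faceVert Γ) s ∈ S.mesh.face Γ := by
      rw [Mesh.face, simplexSet_eq_image]; exact mem_image_of_mem _ hs
    have := hM _ hmem
    rwa [hφ K _ (S.mesh.face_subset_cell (S.mesh.left_mem Γ) hmem), S.eval_eq_toFun] at this) i hon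
  refine key.trans ?_
  have hM0 : 0 ≤ M := (abs_nonneg _).trans (hM x hx)
  exact mul_le_mul_of_nonneg_right
    (Finset.single_le_sum (fun l _ => hC l) (Finset.mem_univ l)) hM0

end Scheme

/-! ### Consistency of the fluxes -/

lemma QuadRule.norm_apply_le {d : ℕ} {s : Set (Pt d)} (Q : QuadRule s) {F : Type*}
    [NormedAddCommGroup F] [NormedSpace ℝ F] {g : Pt d → F} {B W : ℝ} (hB : 0 ≤ B)
    (hW : ∑ q, |Q.weight q| ≤ W) (hg : ∀ x ∈ s, ‖g x‖ ≤ B) : ‖Q.apply g‖ ≤ W * B := by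
  refine (norm_sum_le _ _).trans ?_
  calc ∑ q, ‖Q.weight q • g (Q.node q)‖ ≤ ∑ q, |Q.weight q| * B := by
        refine Finset.sum_le_sum fun q _ => ?_
        rw [norm_smul, Real.norm_eq_abs]
        exact mul_le_mul_of_nonneg_left (hg _ (Q.node_mem q)) (abs_nonneg _)
    _ ≤ W * B := by rw [← Finset.sum_mul]; exact mul_le_mul_of_nonneg_right hW hB

lemma QuadRule.apply_congr {d : ℕ} {s : Set (Pt d)} (Q : QuadRule s) {F : Type*}
    [AddCommGroup F] [Module ℝ F] {g g' : Pt d → F} (h : ∀ x ∈ s, g x = g' x) :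
    Q.apply g = Q.apply g' :=
  Finset.sum_congr rfl fun q _ => by rw [h _ (Q.node_mem q)]

/-- By consistency the exact flux is the numerical flux at equal states, so the Lipschitz bound
applies. -/
lemma IsNumericalFlux.norm_normalFlux_sub_le {d p : ℕ} {D : Set (St p)} {f : Fin d → St p → St p}
    {fhat : Pt d → St p → St p → St p} (hf : IsNumericalFlux D f fhat) :
    ∃ L : ℝ, 0 ≤ L ∧ (∀ n : Pt d, ‖n‖ = 1 → ∀ a ∈ D, ∀ b ∈ D, ∀ a' ∈ D,
      ‖fhat n a b - normalFlux f n a'‖ ≤ L * (‖a - a'‖ + ‖b - a'‖)) := by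
  obtain ⟨L, hL⟩ := hf.lipschitz
  refine ⟨|L|, abs_nonneg _, fun n hn a ha b hb a' ha' => ?_⟩
  rw [← hf.consistent n hn a' ha']
  exact (hL n hn a ha b hb a' ha' a' ha').trans
    (mul_le_mul_of_nonneg_right (le_abs_self L) (by positivity))

namespace Scheme

section Faces

variable {d k p : ℕ} {Ω : Set (Pt d)} {R : RefElement d k} (S : Scheme Ω R p)

lemma norm_faceInt_le {F : Type*} [NormedAddCommGroup F] [NormedSpace ℝ F] {e : S.mesh.Face}
    {g : Pt d → F} {A B W : ℝ} (hB : 0 ≤ B)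
    (hW : ∑ q, |(S.faceQuad e).weight q| ≤ W)
    (hA : (Mesh.surface d).real (S.mesh.face e) ≤ A)
    (hg : ∀ x ∈ S.mesh.face e, ‖g x‖ ≤ B) : ‖S.faceInt e g‖ ≤ A * (W * B) := by
  have hW0 : 0 ≤ W := (Finset.sum_nonneg fun q _ => abs_nonneg _).trans hW
  rw [faceInt, norm_smul, Real.norm_eq_abs, abs_of_nonneg measureReal_nonneg]
  exact mul_le_mul hA ((S.faceQuad e).norm_apply_le hB hW hg) (norm_nonneg _)
    (measureReal_nonneg.trans hA)

lemma faceInt_sub {F : Type*} [AddCommGroup F] [Module ℝ F] (e : S.mesh.Face)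
    (g g' : Pt d → F) :
    S.faceInt e (fun x => g x - g' x) = S.faceInt e g - S.faceInt e g' := by
  simp only [faceInt, QuadRule.apply, smul_sub, Finset.sum_sub_distrib]

lemma faceInt_neg {F : Type*} [AddCommGroup F] [Module ℝ F] (e : S.mesh.Face)
    (g : Pt d → F) : S.faceInt e (fun x => -g x) = -S.faceInt e g := by
  simp only [faceInt, QuadRule.apply, smul_neg, Finset.sum_neg_distrib]

lemma faceInt_congr {F : Type*} [AddCommGroup F] [Module ℝ F] (e : S.mesh.Face)
    {g g' : Pt d → F} (h : ∀ x ∈ S.mesh.face e, g x = g' x) : S.faceInt e g = S.faceInt e g' := by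
  rw [faceInt, faceInt, (S.faceQuad e).apply_congr h]

lemma faceInt_sum_smul {F : Type*} [AddCommGroup F] [Module ℝ F] {ι : Type*} (s : Finset ι)
    (e : S.mesh.Face) (c : ι → ℝ) (g : ι → Pt d → F) :
    S.faceInt e (fun x => ∑ j ∈ s, c j • g j x) = ∑ j ∈ s, c j • S.faceInt e (g j) := by
  simp only [faceInt, QuadRule.apply, Finset.smul_sum]
  rw [Finset.sum_comm]
  refine Finset.sum_congr rfl fun j _ => Finset.sum_congr rfl fun q _ => ?_
  rw [smul_comm (c j), smul_comm (c j)]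

lemma faceInt_apply (e : S.mesh.Face) (g : Pt d → St p) (c : Fin p) :
    (S.faceInt e g) c = S.faceInt e (fun x => g x c) := by
  simp [faceInt, QuadRule.apply]

end Faces

end Scheme

lemma norm_le_sum_abs {p : ℕ} (y : St p) : ‖y‖ ≤ ∑ c, |y c| := by
  have h : y = ∑ c, y c • EuclideanSpace.single c (1 : ℝ) := by
    ext i; simp [Pi.single_apply]
  conv_lhs => rw [h]
  refine norm_sum_le_of_le _ fun c _ => ?_
  simp [norm_smul]

section Consistency

variable {m k p : ℕ} {Ω : Set (Pt (m + 1))} {R : RefElement (m + 1) k} {ι : Type*}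

lemma Mesh.face_subset_closure (M : Mesh Ω) (e : M.Face) : M.face e ⊆ closure Ω :=
  (M.face_subset_cell (M.left_mem e)).trans (M.cell_subset_closure _)

lemma Mesh.integrableOn_face {E : Type*} [NormedAddCommGroup E] (M : Mesh Ω) (e : M.Face)
    {g : Pt (m + 1) → E} (hg : ContinuousOn g (closure Ω)) :
    IntegrableOn g (M.face e) (Mesh.surface (m + 1)) :=
  integrableOn_simplexSet (n := m) _ (hg.mono (M.face_subset_closure e))

/-- The quadrature error for a smooth vector field on a face. -/
lemma HasQuadratureOrder.exists_vector_bound {S : ι → Scheme Ω R p} (hquad : HasQuadratureOrder S)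
    (hh : ∀ i, 0 < (S i).h) {g : Pt (m + 1) → St p}
    (hg : ContDiffOn ℝ ((k + 1 : ℕ) : WithTop ℕ∞) g (closure Ω)) :
    ∃ C : ℝ, 0 ≤ C ∧ ∀ i e, ‖(∫ x in (S i).mesh.face e, g x ∂(Mesh.surface (m + 1)))
      - (S i).faceInt e g‖ ≤ C * (S i).h ^ (m + 1 + k) := by
  have h : ∀ c : Fin p, ∃ C : ℝ, ∀ i e,
      |(∫ x in (S i).mesh.face e, g x c ∂(Mesh.surface (m + 1))) -
        (S i).faceInt e (fun x => g x c)| ≤ C * (S i).h ^ (m + 1 + k) := by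
    intro c
    obtain ⟨C, hC⟩ := hquad (fun x => g x c) ((contDiffOn_euclidean.1 hg) c)
    exact ⟨C, fun i e => (hC i).2 e⟩
  choose C hC using h
  have key : ∀ i e, ‖(∫ x in (S i).mesh.face e, g x ∂(Mesh.surface (m + 1)))
      - (S i).faceInt e g‖ ≤ ∑ c, C c * (S i).h ^ (m + 1 + k) := by
    intro i e
    refine (norm_le_sum_abs _).trans (Finset.sum_le_sum fun c _ => ?_)
    have hint := (S i).mesh.integrableOn_face e hg.continuousOn
    have h1 : (∫ x in (S i).mesh.face e, g x ∂(Mesh.surface (m + 1))) c =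
        ∫ x in (S i).mesh.face e, g x c ∂(Mesh.surface (m + 1)) :=
      ((EuclideanSpace.proj (𝕜 := ℝ) c).integral_comp_comm hint).symm
    rw [PiLp.sub_apply, Scheme.faceInt_apply, h1]
    exact hC c i e
  refine ⟨|∑ c, C c|, abs_nonneg _, fun i e => ?_⟩
  have hk := key i e
  rw [← Finset.sum_mul] at hk
  exact hk.trans (mul_le_mul_of_nonneg_right (le_abs_self _) (pow_nonneg (hh i).le _))

/-- The quadrature error for the normal flux of the exact solution. -/
lemma HasQuadratureOrder.exists_normalFlux_bound {S : ι → Scheme Ω R p}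
    (hquad : HasQuadratureOrder S) (hh : ∀ i, 0 < (S i).h) {f : Fin (m + 1) → St p → St p}
    {u : Pt (m + 1) → St p}
    (hfu : ∀ j, ContDiffOn ℝ ((k + 1 : ℕ) : WithTop ℕ∞) (fun x => f j (u x)) (closure Ω)) :
    ∃ C : ℝ, 0 ≤ C ∧ ∀ i e (n : Pt (m + 1)), ‖n‖ = 1 →
      ‖(S i).faceInt e (fun x => normalFlux f n (u x)) -
        ∫ x in (S i).mesh.face e, normalFlux f n (u x) ∂(Mesh.surface (m + 1))‖ ≤
          C * (S i).h ^ (m + 1 + k) := by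
  -- Quadrature is estimated for each f_j(u) separately and combined with |n_j| ≤ 1, which keeps the
  -- constant independent of the normal.
  choose C hC hCb using fun j => hquad.exists_vector_bound hh (hfu j)
  refine ⟨∑ j, C j, Finset.sum_nonneg fun j _ => hC j, fun i e n hn => ?_⟩
  have hint : ∀ j ∈ Finset.univ, IntegrableOn (fun x => n j • f j (u x)) ((S i).mesh.face e)
      (Mesh.surface (m + 1)) := fun j _ =>
    ((S i).mesh.integrableOn_face e (hfu j).continuousOn).smul (n j)
  simp only [normalFlux]
  rw [Scheme.faceInt_sum_smul, integral_finsetSum _ hint, ← Finset.sum_sub_distrib,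
    Finset.sum_mul]
  refine norm_sum_le_of_le _ fun j _ => ?_
  rw [integral_smul, ← smul_sub, norm_smul, norm_sub_rev]
  have h1 : ‖n j‖ ≤ 1 := hn ▸ PiLp.norm_apply_le n j
  calc _ ≤ 1 * (C j * (S i).h ^ (m + 1 + k)) := by
        gcongr
        · exact hCb j i e
    _ = _ := one_mul _

/-- The total flux of a steady solution through the boundary of an element vanishes. -/
lemma IsSteadySolution.sum_face_integral_eq_zero {f : Fin (m + 1) → St p → St p}
    {u : Pt (m + 1) → St p} (hsol : IsSteadySolution Ω f u)
    (hfu : ∀ j, ContDiffOn ℝ ((k + 1 : ℕ) : WithTop ℕ∞) (fun x => f j (u x)) (closure Ω))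
    (M : Mesh Ω) (hpos : ∀ e, 0 < (Mesh.surface (m + 1)).real (M.face e)) (K : M.Elem) :
    ∑ e ∈ M.facesOf K, ∫ x in M.face e, normalFlux f (M.outNormal K e) (u x)
      ∂(Mesh.surface (m + 1)) = 0 := by
  have hc : ∀ j, ContDiffOn ℝ 1 (fun x => f j (u x)) (M.cell K) := fun j =>
    ((hfu j).mono (M.cell_subset_closure K)).of_le (by exact_mod_cast Nat.le_add_left 1 k)
  -- The fluxes are smooth only on a closed set, so derivatives within the cell are used; they are
  -- continuous up to the frontier and are ordinary derivatives inside.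
  have hud : UniqueDiffOn ℝ (M.cell K) :=
    uniqueDiffOn_convex (M.convex_cell K) (interior_cell_nonempty (M.vert K))
  have hd : ∀ j, ∀ x ∈ interior (M.cell K), HasFDerivAt (fun x => f j (u x))
      (fderivWithin ℝ (fun x => f j (u x)) (M.cell K) x) x := fun j x hx =>
    (((hc j).differentiableOn (by norm_num) x (interior_subset hx)).hasFDerivWithinAt).hasFDerivAt
      (mem_interior_iff_mem_nhds.1 hx)
  refine M.sum_face_integral_eq_zero hpos K (fun j x => f j (u x))
    (fun j => fderivWithin ℝ (fun x => f j (u x)) (M.cell K)) (fun j => (hc j).continuousOn)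
    (fun j => (hc j).continuousOn_fderivWithin hud (by norm_num)) hd fun x hx => ?_
  rw [← hsol x (M.interior_cell_subset K hx)]
  exact Finset.sum_congr rfl fun j _ => by rw [(hd j x hx).fderiv]

/-- The difference of the numerical flux of `U` and the exact flux of `u` through a face. -/
noncomputable def Scheme.fluxDefect (S : Scheme Ω R p) (f : Fin (m + 1) → St p → St p)
    (fhat : Pt (m + 1) → St p → St p → St p) (u : Pt (m + 1) → St p) (U : S.Dof → St p)
    (K : S.mesh.Elem) (e : S.mesh.Face) : St p :=
  S.faceInt e (fun x =>
    fhat (S.mesh.outNormal K e) (S.eval U K x) (S.eval U (S.mesh.across K e) x)) -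
  ∫ x in S.mesh.face e, normalFlux f (S.mesh.outNormal K e) (u x) ∂(Mesh.surface (m + 1))

lemma normalFlux_neg {d : ℕ} (f : Fin d → St p → St p) (n : Pt d) (a : St p) :
    normalFlux f (-n) a = -normalFlux f n a := by
  simp [normalFlux]

/-- The defects from both sides of an inner face cancel. -/
lemma Scheme.fluxDefect_right (S : Scheme Ω R p) {D : Set (St p)}
    {f : Fin (m + 1) → St p → St p} {fhat : Pt (m + 1) → St p → St p → St p}
    (hfhat : IsNumericalFlux D f fhat) (u : Pt (m + 1) → St p) {U : S.Dof → St p}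
    (hUD : S.ValuesIn D U) {K : S.mesh.Elem} {e : S.mesh.Face} (h : S.mesh.right e = some K) :
    S.fluxDefect f fhat u U K e = -S.fluxDefect f fhat u U (S.mesh.left e) e := by
  have hK : e ∈ S.mesh.facesOf K := (S.mesh.mem_facesOf).2 (Or.inr h)
  rw [fluxDefect, fluxDefect, S.mesh.outNormal_right h, S.mesh.across_right h,
    S.mesh.outNormal_left, S.mesh.across_left_of_right h]
  rw [S.faceInt_congr e (g' := fun x => -fhat (S.mesh.normal e) (S.eval U (S.mesh.left e) x)
    (S.eval U K x)) fun x hx => hfhat.conservative _ (S.mesh.norm_normal e) _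
      (hUD _ x (S.mesh.face_subset_cell (S.mesh.left_mem e) hx)) _
      (hUD _ x (S.mesh.face_subset_cell hK hx)), S.faceInt_neg]
  simp only [normalFlux_neg, integral_neg]
  abel

/-- Inserting the numerical integral of the exact flux splits the defect in two. The flux difference
is O(h^(k+1)) at the nodes by accuracy of U on both sides and is multiplied by an area O(h^m); the
other part is the quadrature error for a smooth flux. -/
lemma exists_fluxDefect_bound {S : ι → Scheme Ω R p} {D : Set (St p)}
    {f : Fin (m + 1) → St p → St p} {fhat : Pt (m + 1) → St p → St p → St p}
    (hfhat : IsNumericalFlux D f fhat) {u : Pt (m + 1) → St p} (huD : ∀ x ∈ closure Ω, u x ∈ D)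
    (hfu : ∀ j, ContDiffOn ℝ ((k + 1 : ℕ) : WithTop ℕ∞) (fun x => f j (u x)) (closure Ω))
    (hh : ∀ i, 0 < (S i).h) (hdiam : ∀ i K, Metric.diam ((S i).mesh.cell K) ≤ (S i).h)
    (hweights : HasBoundedWeights S) (hquad : HasQuadratureOrder S)
    {U : ∀ i, (S i).Dof → St p} (hUD : ∀ i, (S i).ValuesIn D (U i)) (hacc : IsAccurate S u U) :
    ∃ C : ℝ, 0 ≤ C ∧ ∀ i K, ∀ e ∈ (S i).mesh.facesOf K,
      ‖(S i).fluxDefect f fhat u (U i) K e‖ ≤ C * (S i).h ^ (m + 1 + k) := by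
  obtain ⟨L, hL, hLb⟩ := hfhat.norm_normalFlux_sub_le
  obtain ⟨Q, hQ, hQb⟩ := hquad.exists_normalFlux_bound hh hfu
  obtain ⟨W, hW⟩ := hweights
  obtain ⟨A, hA⟩ := hacc
  set V := (m.factorial : ℝ) * (volume : Measure (Pt m)).real (refSimplex m) with hV
  refine ⟨V * (|W| * (L * (|A| + |A|))) + Q, by positivity, fun i K e he => ?_⟩
  have hi := hh i
  have hA' : ∀ K, ∀ x ∈ (S i).mesh.cell K,
      ‖(S i).eval (U i) K x - u x‖ ≤ |A| * (S i).h ^ (k + 1) := fun K x hx =>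
    (hA i K x hx).trans (mul_le_mul_of_nonneg_right (le_abs_self A) (by positivity))
  have he' := (S i).mesh.mem_facesOf_across he
  set n := (S i).mesh.outNormal K e with hn
  have hn1 : ‖n‖ = 1 := (S i).mesh.norm_outNormal K e
  have h1 := (S i).norm_faceInt_le (e := e)
    (g := fun x => fhat n ((S i).eval (U i) K x) ((S i).eval (U i) ((S i).mesh.across K e) x) -
      normalFlux f n (u x)) (B := L * (|A| * (S i).h ^ (k + 1) + |A| * (S i).h ^ (k + 1)))
    (by positivity) (((hW i).2 e).trans (le_abs_self W))
    ((S i).mesh.surface_face_le e (hdiam i _)) fun x hx => by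
      have hxK := (S i).mesh.face_subset_cell he hx
      have hxK' := (S i).mesh.face_subset_cell he' hx
      refine (hLb n hn1 _ (hUD i _ x hxK) _ (hUD i _ x hxK') _
        (huD x ((S i).mesh.face_subset_closure e hx))).trans ?_
      exact mul_le_mul_of_nonneg_left (add_le_add (hA' _ x hxK) (hA' _ x hxK')) hL
  have h2 := hQb i e n hn1
  rw [Scheme.faceInt_sub] at h1
  rw [Scheme.fluxDefect, ← sub_add_sub_cancel _ ((S i).faceInt e fun x => normalFlux f n (u x))]
  refine (norm_add_le_of_le h1 h2).trans (le_of_eq ?_)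
  ring

/-- The boundary residuals of a face sum up to a small quantity. -/
lemma exists_bdryRes_sum_bound {S : ι → Scheme Ω R p} {D : Set (St p)}
    {f : Fin (m + 1) → St p → St p} {fhat fbd : Pt (m + 1) → St p → St p → St p}
    (hfhat : IsNumericalFlux D f fhat) (hfbd : IsUpwindBoundaryFlux D f fbd)
    {u ub : Pt (m + 1) → St p} (huD : ∀ x ∈ closure Ω, u x ∈ D)
    (hubD : ∀ x ∈ frontier Ω, ub x ∈ D) (hbc : SatisfiesBoundaryCondition S f u ub)
    (hcons : ∀ i, (S i).IsConservative D f fhat fbd ub)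
    (hh : ∀ i, 0 < (S i).h) (hdiam : ∀ i K, Metric.diam ((S i).mesh.cell K) ≤ (S i).h)
    (hweights : HasBoundedWeights S)
    {U : ∀ i, (S i).Dof → St p} (hUD : ∀ i, (S i).ValuesIn D (U i)) (hacc : IsAccurate S u U) :
    ∃ C : ℝ, 0 ≤ C ∧ ∀ i, ∀ Γ ∈ (S i).mesh.bdryFaces,
      ‖∑ σ ∈ (S i).dofsBdry Γ, (S i).bdryRes (U i) Γ σ‖ ≤ C * (S i).h ^ (m + 1 + k) := by
  obtain ⟨L, hL, hLb⟩ := hfhat.norm_normalFlux_sub_le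
  obtain ⟨L', hL'⟩ := hfbd.lipschitz
  obtain ⟨W, hW⟩ := hweights
  obtain ⟨A, hA⟩ := hacc
  set V := (m.factorial : ℝ) * (volume : Measure (Pt m)).real (refSimplex m) with hV
  refine ⟨V * (|W| * (|L'| * |A| + L * (|A| + |A|))), by positivity, fun i Γ hΓ => ?_⟩
  have hi := hh i
  set n := (S i).mesh.normal Γ with hn
  have hn1 : ‖n‖ = 1 := (S i).mesh.norm_normal Γ
  rw [((hcons i) (U i) (hUD i)).2 Γ hΓ]
  refine ((S i).norm_faceInt_le (e := Γ)
    (B := (|L'| * |A| + L * (|A| + |A|)) * (S i).h ^ (k + 1)) (by positivity)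
    (((hW i).2 Γ).trans (le_abs_self W)) ((S i).mesh.surface_face_le Γ (hdiam i _))
    fun x hx => ?_).trans (le_of_eq (by ring))
  have hxK := (S i).mesh.face_subset_cell ((S i).mesh.left_mem Γ) hx
  have hxu := huD x ((S i).mesh.face_subset_closure Γ hx)
  have hxb := hubD x ((S i).mesh.face_subset_domain_frontier hΓ hx)
  have hUx := hUD i _ x hxK
  have hAx : ‖(S i).eval (U i) ((S i).mesh.left Γ) x - u x‖ ≤ |A| * (S i).h ^ (k + 1) :=
    (hA i _ x hxK).trans (mul_le_mul_of_nonneg_right (le_abs_self A) (by positivity))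
  obtain ⟨B, hB, hB0⟩ := hbc i Γ hΓ x hx
  have h1 := hfbd.upwind n hn1 _ hxu _ hxb B hB hB0
  have h2 := hL' n hn1 _ hUx _ hxu _ hxb
  have h3 := hLb n hn1 _ hUx _ hUx _ hxu
  rw [hfhat.consistent n hn1 _ hUx, norm_sub_rev] at h3
  rw [h1] at h2
  -- By the upwind property the boundary flux at u is f(u)·n, so the integrand is the sum of two
  -- Lipschitz differences between U and u.
  rw [← sub_add_sub_cancel _ (normalFlux f n (u x))]
  refine (norm_add_le_of_le (h2.trans (mul_le_mul (le_abs_self L') hAx (norm_nonneg _)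
    (abs_nonneg _))) (h3.trans (mul_le_mul_of_nonneg_left (add_le_add hAx hAx) hL))).trans
    (le_of_eq ?_)
  ring

end Consistency

/-! ### The truncation error -/

namespace Mesh

variable {d : ℕ} {Ω : Set (Pt d)} (M : Mesh Ω)

lemma sum_facesOf_eq {E : Type*} [AddCommGroup E] (g : M.Elem → M.Face → E) :
    ∑ K, ∑ e ∈ M.facesOf K, g K e =
      ∑ e, (g (M.left e) e + (M.right e).elim 0 fun K => g K e) := by
  classical
  rw [Finset.sum_comm' (t' := Finset.univ)
    (s' := fun e => Finset.univ.filter fun K => e ∈ M.facesOf K) (by simp)]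
  refine Finset.sum_congr rfl fun e _ => ?_
  rcases hr : M.right e with _ | K
  · have : (Finset.univ.filter fun K => e ∈ M.facesOf K) = {M.left e} := by
      ext K; simp [M.mem_facesOf, hr, eq_comm]
    simp [this]
  · have h1 : M.left e ≠ K := fun h' => M.left_ne_right e (h' ▸ hr)
    have : (Finset.univ.filter fun K => e ∈ M.facesOf K) = {M.left e, K} := by
      ext K'; simp [M.mem_facesOf, hr, eq_comm]
    simp [this, Finset.sum_pair h1]

/-- Fluxes that are antisymmetric on the inner faces sum up to those on the boundary faces. -/
lemma sum_facesOf_eq_sum_bdryFaces {E : Type*} [AddCommGroup E] (g : M.Elem → M.Face → E)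
    (hg : ∀ e K, M.right e = some K → g K e = -g (M.left e) e) :
    ∑ K, ∑ e ∈ M.facesOf K, g K e = ∑ Γ ∈ M.bdryFaces, g (M.left Γ) Γ := by
  classical
  rw [M.sum_facesOf_eq, bdryFaces, Finset.sum_filter]
  refine Finset.sum_congr rfl fun e _ => ?_
  rcases hr : M.right e with _ | K
  · simp
  · simp [hg e K hr]

end Mesh

namespace Scheme

section General

variable {d k p : ℕ} {Ω : Set (Pt d)} {R : RefElement d k} (S : Scheme Ω R p)

lemma truncationError_eq (U : S.Dof → St p) (v : S.Dof → ℝ) :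
    S.truncationError U v = ∑ K, ∑ σ ∈ S.dofsElem K, v σ • S.elemRes U K σ +
      ∑ Γ ∈ S.mesh.bdryFaces, ∑ σ ∈ S.dofsBdry Γ, v σ • S.bdryRes U Γ σ := by
  classical
  rw [truncationError]
  simp only [smul_add, Finset.smul_sum, Finset.sum_add_distrib]
  congr 1
  · exact Finset.sum_comm' (by simp)
  · exact Finset.sum_comm' (by simp [and_comm])

/-- The truncation error in terms of the variation of the test function on the elements and on the
boundary faces. -/
lemma truncationError_eq_sum {U : S.Dof → St p} (v : S.Dof → ℝ)
    (r : S.mesh.Elem → S.mesh.Face → St p)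
    (hr : ∀ K, ∑ σ ∈ S.dofsElem K, S.elemRes U K σ = ∑ e ∈ S.mesh.facesOf K, r K e)
    (hr' : ∀ e K, S.mesh.right e = some K → r K e = -r (S.mesh.left e) e)
    (c : S.mesh.Elem → ℝ) (a : S.mesh.Face → ℝ) :
    S.truncationError U v =
      ∑ K, (∑ σ ∈ S.dofsElem K, (v σ - c K) • S.elemRes U K σ +
        ∑ e ∈ S.mesh.facesOf K, (c K - a e) • r K e) +
      ∑ Γ ∈ S.mesh.bdryFaces, (∑ σ ∈ S.dofsBdry Γ, (v σ - a Γ) • S.bdryRes U Γ σ +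
        a Γ • r (S.mesh.left Γ) Γ + a Γ • ∑ σ ∈ S.dofsBdry Γ, S.bdryRes U Γ σ) := by
  -- The weight a_e depends on the face only, so the weighted defects still cancel on inner faces.
  have h := S.mesh.sum_facesOf_eq_sum_bdryFaces (fun K e => a e • r K e)
    (fun e K h => by rw [hr' e K h, smul_neg])
  have h1 : ∀ K, ∑ σ ∈ S.dofsElem K, v σ • S.elemRes U K σ =
      (∑ σ ∈ S.dofsElem K, (v σ - c K) • S.elemRes U K σ +
        ∑ e ∈ S.mesh.facesOf K, (c K - a e) • r K e) + ∑ e ∈ S.mesh.facesOf K, a e • r K e := by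
    intro K
    simp only [sub_smul, Finset.sum_sub_distrib, ← Finset.smul_sum, hr K]
    abel
  have h2 : ∀ Γ, ∑ σ ∈ S.dofsBdry Γ, v σ • S.bdryRes U Γ σ =
      ∑ σ ∈ S.dofsBdry Γ, (v σ - a Γ) • S.bdryRes U Γ σ +
        a Γ • ∑ σ ∈ S.dofsBdry Γ, S.bdryRes U Γ σ := by
    intro Γ
    simp only [sub_smul, Finset.sum_sub_distrib, ← Finset.smul_sum]
    abel
  rw [truncationError_eq]
  simp only [h1, h2, Finset.sum_add_distrib, h]
  abel

end General

section Succ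

variable {m k p : ℕ} {Ω : Set (Pt (m + 1))} {R : RefElement (m + 1) k} (S : Scheme Ω R p)

lemma norm_sum_smul_le {α : Type*} (s : Finset α) (c : α → ℝ) (y : α → St p) {A B N : ℝ}
    (hA : 0 ≤ A) (hB : 0 ≤ B)
    (hN : (s.card : ℝ) ≤ N) (hc : ∀ i ∈ s, |c i| ≤ A) (hy : ∀ i ∈ s, ‖y i‖ ≤ B) :
    ‖∑ i ∈ s, c i • y i‖ ≤ N * (A * B) := by
  calc ‖∑ i ∈ s, c i • y i‖ ≤ ∑ _i ∈ s, A * B := norm_sum_le_of_le _ fun i hi => by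
        rw [norm_smul, Real.norm_eq_abs]
        exact mul_le_mul (hc i hi) (hy i hi) (norm_nonneg _) hA
    _ = s.card * (A * B) := by rw [Finset.sum_const, nsmul_eq_mul]
    _ ≤ N * (A * B) := by gcongr

/-- Summation of the gradients over the elements. -/
lemma sum_gradNorm_le {φ : Pt (m + 1) → ℝ} {v : S.Dof → ℝ} (hφ : S.IsContinuousFE φ v) {c : ℝ}
    (hc : 0 < c) (hh : 0 < S.h)
    (hvol : ∀ K, c * S.h ^ (m + 1) ≤ (volume : Measure (Pt (m + 1))).real (S.mesh.cell K)) :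
    ∑ K, Real.sqrt (S.h ^ (m + 1)) * S.gradNorm φ K ≤
      Real.sqrt ((volume : Measure (Pt (m + 1))).real (closure Ω) / c) * h1Norm Ω φ := by
  have h1 : (Fintype.card S.mesh.Elem : ℝ) * S.h ^ (m + 1) ≤
      (volume : Measure (Pt (m + 1))).real (closure Ω) / c := by
    rw [le_div_iff₀ hc, ← S.mesh.sum_volume_cell]
    calc _ = ∑ _K : S.mesh.Elem, c * S.h ^ (m + 1) := by
          rw [Finset.sum_const, Finset.card_univ, nsmul_eq_mul]; ring
      _ ≤ _ := Finset.sum_le_sum fun K _ => hvol K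
  -- Cauchy–Schwarz; the squared weights add up to the number of elements times h^d, which the total
  -- volume bounds.
  refine (Real.sum_mul_le_sqrt_mul_sqrt _ _ _).trans ?_
  refine mul_le_mul (Real.sqrt_le_sqrt ?_) hφ.sum_gradNorm_sq_le (Real.sqrt_nonneg _)
    (Real.sqrt_nonneg _)
  refine le_of_eq_of_le ?_ h1
  rw [Finset.sum_const, Finset.card_univ, nsmul_eq_mul, Real.sq_sqrt (by positivity)]

/-- The oscillation of a finite element function on an element. -/
lemma abs_vert_zero_sub_le {φ : Pt (m + 1) → ℝ} {v : S.Dof → ℝ} (hφ : S.IsContinuousFE φ v)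
    {B t : ℝ} (hB : 0 ≤ B)
    (hBb : ∀ i, ∀ x ∈ refSimplex (m + 1),
      |MvPolynomial.eval x.ofLp (R.shape i : MvPolynomial (Fin (m + 1)) ℝ)| ≤ B)
    {K : S.mesh.Elem} (ht : ∀ i, |v (S.dof K i) - φ (S.mesh.vert K 0)| ≤ t)
    {x : Pt (m + 1)} (hx : x ∈ S.mesh.cell K) :
    |φ (S.mesh.vert K 0) - φ x| ≤ Fintype.card R.Idx * B * t := by
  rw [abs_sub_comm, hφ K x hx, S.eval_eq_toFun, ← R.toFun_sub_const]
  exact R.abs_toFun_le (fun i => hBb i _ (refCoord_mem _ hx)) hB ht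

end Succ

end Scheme

theorem mainTheorem4 {d k p : ℕ} (hd : 1 ≤ d)
    (Ω : Set (Pt d)) (hΩ : IsOpen Ω) (hΩb : Bornology.IsBounded Ω)
    (D : Set (St p)) (hD : IsOpen D)
    (f : Fin d → St p → St p) (hf : ∀ j, ContDiffOn ℝ 1 (f j) D)
    (hfL : ∃ L : NNReal, ∀ j, LipschitzOnWith L (f j) D)
    (fhat fbd : Pt d → St p → St p → St p)
    (hfhat : IsNumericalFlux D f fhat) (hfbd : IsUpwindBoundaryFlux D f fbd)
    (u ub : Pt d → St p)
    (huD : ∀ x ∈ closure Ω, u x ∈ D) (hubD : ∀ x ∈ frontier Ω, ub x ∈ D)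
    (hu : ContDiffOn ℝ ((k + 1 : ℕ) : WithTop ℕ∞) u (closure Ω))
    (hfu : ∀ j, ContDiffOn ℝ ((k + 1 : ℕ) : WithTop ℕ∞) (fun x => f j (u x)) (closure Ω))
    (hsol : IsSteadySolution Ω f u)
    (R : RefElement d k) {ι : Type*} (S : ι → Scheme Ω R p)
    (hreg : IsRegularFamily S)
    (hbc : SatisfiesBoundaryCondition S f u ub)
    (hcons : ∀ i, (S i).IsConservative D f fhat fbd ub)
    (hweights : HasBoundedWeights S) (hquad : HasQuadratureOrder S)
    (U : ∀ i, (S i).Dof → St p) (hUD : ∀ i, (S i).ValuesIn D (U i))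
    (hacc : IsAccurate S u U) (hres : HasResidualOrder S U) :
    ∃ C : ℝ, 0 ≤ C ∧ ∀ (i : ι) (φ : Pt d → ℝ) (v : (S i).Dof → ℝ), (S i).IsContinuousFE φ v →
      ((∀ x ∈ frontier Ω, φ x = 0) →
        ‖(S i).truncationError (U i) v‖ ≤ C * h1Norm Ω φ * (S i).h ^ (k + 1)) ∧
      (∀ M : ℝ, (S i).IsBoundaryBound φ M →
        ‖(S i).truncationError (U i) v‖ ≤ C * (h1Norm Ω φ + M) * (S i).h ^ (k + 1)) := by
  obtain ⟨m, rfl⟩ : ∃ m, d = m + 1 := ⟨d - 1, by omega⟩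
  obtain ⟨c, hc, hreg⟩ := hreg
  have hh : ∀ i, 0 < (S i).h := fun i => (hreg i).1
  have hdiam : ∀ i K, Metric.diam ((S i).mesh.cell K) ≤ (S i).h := fun i K => ((hreg i).2.1 K).1
  have hvol : ∀ i K, c * (S i).h ^ (m + 1) ≤
      (volume : Measure (Pt (m + 1))).real ((S i).mesh.cell K) := fun i K => ((hreg i).2.1 K).2
  have harea : ∀ i e, c * (S i).h ^ m ≤ (Mesh.surface (m + 1)).real ((S i).mesh.face e) :=
    fun i e => (hreg i).2.2 e
  have hpos : ∀ i e, 0 < (Mesh.surface (m + 1)).real ((S i).mesh.face e) := fun i e =>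
    lt_of_lt_of_le (mul_pos hc (pow_pos (hh i) m)) (harea i e)
  obtain ⟨C₁, hC₁, hcoeff⟩ := R.exists_coeff_sub_le hc
  obtain ⟨B, hB, hBb⟩ := R.exists_shape_bound
  obtain ⟨C₂, hC₂, hbdry⟩ := Scheme.exists_bdry_coeff_le (p := p) (Ω := Ω) R hc
  obtain ⟨C₃, hC₃⟩ := hres
  obtain ⟨C₄, hC₄, hdefect⟩ := exists_fluxDefect_bound hfhat huD hfu hh hdiam hweights hquad hUD hacc
  obtain ⟨C₅, hC₅, hbres⟩ :=
    exists_bdryRes_sum_bound hfhat hfbd huD hubD hbc hcons hh hdiam hweights hUD hacc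
  set N : ℝ := ((Fintype.card R.Idx : ℕ) : ℝ) with hN
  set V : ℝ := m.factorial * (volume : Measure (Pt m)).real (refSimplex m) with hV
  set N' : ℝ := (m + 2) * V / c with hN'
  have hV0 : 0 ≤ V := by positivity
  -- `A` and `A'` are the constants for one element and one boundary face; `E` and `E'` also contain
  -- the counts of elements and of boundary faces.
  set A : ℝ := N * (C₁ * |C₃|) + N' * (N * B * C₁ * C₄) with hA
  set A' : ℝ := N * (C₂ * |C₃|) + C₄ + C₅ with hA'
  set E : ℝ := A * Real.sqrt ((volume : Measure (Pt (m + 1))).real (closure Ω) / c) with hE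
  set E' : ℝ := (Mesh.surface (m + 1)).real (frontier Ω) / c * A' with hE'
  have hA0 : 0 ≤ A := by positivity
  have hA'0 : 0 ≤ A' := by positivity
  have hE0 : 0 ≤ E := by positivity
  have hE'0 : 0 ≤ E' := by positivity
  have main : ∀ (i : ι) (φ : Pt (m + 1) → ℝ) (v : (S i).Dof → ℝ), (S i).IsContinuousFE φ v →
      ∀ M : ℝ, (S i).IsBoundaryBound φ M →
        ‖(S i).truncationError (U i) v‖ ≤ (E + E') * (h1Norm Ω φ + M) * (S i).h ^ (k + 1) := by
    rintro i φ v hφ M ⟨hM, hMb, hML⟩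
    have hi := hh i
    set h := (S i).h with hhdef
    have hsum : ∀ K, ∑ σ ∈ (S i).dofsElem K, (S i).elemRes (U i) K σ =
        ∑ e ∈ (S i).mesh.facesOf K, (S i).fluxDefect f fhat u (U i) K e := by
      intro K
      simp only [Scheme.fluxDefect, Finset.sum_sub_distrib]
      rw [(hcons i (U i) (hUD i)).1 K,
        hsol.sum_face_integral_eq_zero hfu (S i).mesh (hpos i) K, sub_zero]
    -- The subtracted constants are the values of φ at the first vertex of each element and of each
    -- face. A face value is the same from both sides because φ is single-valued.
    rw [(S i).truncationError_eq_sum v _ hsum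
      (fun e K h => (S i).fluxDefect_right hfhat u (hUD i) h)
      (fun K => φ ((S i).mesh.vert K 0)) (fun e => φ ((S i).mesh.faceVert e 0))]
    have hsq : Real.sqrt (h ^ (m + 1)) * Real.sqrt (h ^ (m + 1)) = h ^ (m + 1) :=
      Real.mul_self_sqrt (by positivity)
    have hsq0 : 0 < Real.sqrt (h ^ (m + 1)) := Real.sqrt_pos.2 (by positivity)
    have hR : ∀ K, ∀ σ ∈ (S i).dofsElem K,
        ‖(S i).elemRes (U i) K σ‖ ≤ |C₃| * h ^ (m + 1 + k) := fun K σ hσ => by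
      rw [add_comm (m + 1) k]
      exact ((hC₃ i).1 K σ hσ).trans (mul_le_mul_of_nonneg_right (le_abs_self _) (by positivity))
    -- The exponent k + (m + 1) - 1 is k + m, one power of h short of the element rate; the factor M
    -- h from the coefficients supplies it.
    have hRb : ∀ Γ ∈ (S i).mesh.bdryFaces, ∀ σ ∈ (S i).dofsBdry Γ,
        ‖(S i).bdryRes (U i) Γ σ‖ ≤ |C₃| * h ^ (k + m) := fun Γ hΓ σ hσ =>
      ((hC₃ i).2 Γ hΓ σ hσ).trans (mul_le_mul_of_nonneg_right (le_abs_self _) (by positivity))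
    have helem : ∀ K, ‖∑ σ ∈ (S i).dofsElem K,
          (v σ - φ ((S i).mesh.vert K 0)) • (S i).elemRes (U i) K σ +
        ∑ e ∈ (S i).mesh.facesOf K,
          (φ ((S i).mesh.vert K 0) - φ ((S i).mesh.faceVert e 0)) •
            (S i).fluxDefect f fhat u (U i) K e‖ ≤
        A * h ^ (k + 1) * (Real.sqrt (h ^ (m + 1)) * (S i).gradNorm φ K) := by
      intro K
      set t := h / Real.sqrt (h ^ (m + 1)) * (S i).gradNorm φ K with ht
      have ht0 : 0 ≤ t := mul_nonneg (by positivity) (Real.sqrt_nonneg _)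
      have hcK : ∀ j, |v ((S i).dof K j) - φ ((S i).mesh.vert K 0)| ≤ C₁ * t := by
        intro j
        rw [hφ.vert_zero K, ht, hφ.gradNorm_eq K]
        exact hcoeff ((S i).mesh.vert K) h hi (fun j =>
          ((S i).mesh.norm_sub_le_diam ((S i).mesh.vert_mem K _) ((S i).mesh.vert_mem K _)).trans
            (hdiam i K)) (hvol i K) ((S i).localCoeff v K) j
      have h1 := Scheme.norm_sum_smul_le ((S i).dofsElem K)
        (fun σ => v σ - φ ((S i).mesh.vert K 0)) (fun σ => (S i).elemRes (U i) K σ)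
        (N := N) (A := C₁ * t) (by positivity) (by positivity)
        (Nat.cast_le.2 ((S i).card_dofsElem_le K)) (fun σ hσ => by
          obtain ⟨j, rfl⟩ := ((S i).mem_dofsElem).1 hσ
          exact hcK j) (hR K)
      have h2 := Scheme.norm_sum_smul_le ((S i).mesh.facesOf K)
        (fun e => φ ((S i).mesh.vert K 0) - φ ((S i).mesh.faceVert e 0))
        (fun e => (S i).fluxDefect f fhat u (U i) K e)
        (N := N') (A := N * B * (C₁ * t)) (by positivity) (by positivity)
        ((S i).mesh.card_facesOf_le hi hc K (hdiam i K) (harea i))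
        (fun e he => (S i).abs_vert_zero_sub_le hφ hB (fun i x hx => hBb x hx i) hcK
          ((S i).mesh.face_subset_cell he ((S i).mesh.faceVert_mem e 0)))
        (fun e he => hdefect i K e he)
      refine (norm_add_le_of_le h1 h2).trans (le_of_eq ?_)
      -- The count of powers: h^(1-d/2) · h^(d+k) = h^(k+1) · h^(d/2).
      have ht' : t * h ^ (m + 1 + k) =
          h ^ (k + 1) * (Real.sqrt (h ^ (m + 1)) * (S i).gradNorm φ K) := by
        have : t * h ^ (m + 1) = h * (Real.sqrt (h ^ (m + 1)) * (S i).gradNorm φ K) := by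
          calc t * h ^ (m + 1) = h / Real.sqrt (h ^ (m + 1)) * (S i).gradNorm φ K *
                (Real.sqrt (h ^ (m + 1)) * Real.sqrt (h ^ (m + 1))) := by rw [hsq]
            _ = _ := by
              generalize Real.sqrt (h ^ (m + 1)) = s at hsq0
              field_simp
        rw [pow_add h (m + 1) k, ← mul_assoc, this]
        ring
      calc _ = A * (t * h ^ (m + 1 + k)) := by rw [hA]; ring
        _ = _ := by rw [ht']; ring
    have hface : ∀ Γ ∈ (S i).mesh.bdryFaces, ‖∑ σ ∈ (S i).dofsBdry Γ,
          (v σ - φ ((S i).mesh.faceVert Γ 0)) • (S i).bdryRes (U i) Γ σ +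
        φ ((S i).mesh.faceVert Γ 0) • (S i).fluxDefect f fhat u (U i) ((S i).mesh.left Γ) Γ +
        φ ((S i).mesh.faceVert Γ 0) • ∑ σ ∈ (S i).dofsBdry Γ, (S i).bdryRes (U i) Γ σ‖ ≤
        A' * M * h ^ (m + 1 + k) := by
      intro Γ hΓ
      have hΓv := (S i).mesh.faceVert_mem Γ 0
      have haM : |φ ((S i).mesh.faceVert Γ 0)| ≤ M :=
        hMb _ ((S i).mesh.face_subset_domain_frontier hΓ hΓv)
      have hcell := (S i).mesh.face_subset_cell ((S i).mesh.left_mem Γ)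
      have h1 := Scheme.norm_sum_smul_le ((S i).dofsBdry Γ)
        (fun σ => v σ - φ ((S i).mesh.faceVert Γ 0)) (fun σ => (S i).bdryRes (U i) Γ σ)
        (N := N) (A := C₂ * (M * h)) (by positivity) (by positivity)
        (Nat.cast_le.2 ((Finset.card_le_card ((S i).dofsBdry_subset Γ)).trans
          ((S i).card_dofsElem_le _)))
        (hbdry (S i) hi (hdiam i) (harea i) φ v hφ Γ _ (M * h) fun x hx =>
          (hML Γ hΓ x hx _ hΓv).trans (mul_le_mul_of_nonneg_left
            (((S i).mesh.norm_sub_le_diam (hcell hx) (hcell hΓv)).trans (hdiam i _)) hM))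
        (hRb Γ hΓ)
      have h2 : ‖φ ((S i).mesh.faceVert Γ 0) •
          (S i).fluxDefect f fhat u (U i) ((S i).mesh.left Γ) Γ‖ ≤ M * (C₄ * h ^ (m + 1 + k)) := by
        rw [norm_smul]
        exact mul_le_mul haM (hdefect i _ Γ ((S i).mesh.left_mem Γ)) (norm_nonneg _) hM
      have h3 : ‖φ ((S i).mesh.faceVert Γ 0) •
          ∑ σ ∈ (S i).dofsBdry Γ, (S i).bdryRes (U i) Γ σ‖ ≤ M * (C₅ * h ^ (m + 1 + k)) := by
        rw [norm_smul]
        exact mul_le_mul haM (hbres i Γ hΓ) (norm_nonneg _) hM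
      refine (norm_add_le_of_le (norm_add_le_of_le h1 h2) h3).trans (le_of_eq ?_)
      rw [hA']
      ring
    have hH0 : 0 ≤ h1Norm Ω φ := Real.sqrt_nonneg _
    have hT1 : ∑ K, A * h ^ (k + 1) * (Real.sqrt (h ^ (m + 1)) * (S i).gradNorm φ K) ≤
        E * h1Norm Ω φ * h ^ (k + 1) := by
      rw [← Finset.mul_sum]
      calc _ ≤ A * h ^ (k + 1) *
            (Real.sqrt ((volume : Measure (Pt (m + 1))).real (closure Ω) / c) * h1Norm Ω φ) :=
            mul_le_mul_of_nonneg_left ((S i).sum_gradNorm_le hφ hc hi (hvol i)) (by positivity)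
        _ = _ := by rw [hE]; ring
    have hT2 : ∑ _Γ ∈ (S i).mesh.bdryFaces, A' * M * h ^ (m + 1 + k) ≤
        E' * M * h ^ (k + 1) := by
      rw [Finset.sum_const, nsmul_eq_mul]
      have hcard : ((S i).mesh.bdryFaces.card : ℝ) * h ^ m ≤
          (Mesh.surface (m + 1)).real (frontier Ω) / c := by
        rw [le_div_iff₀ hc]
        exact le_of_eq_of_le (by ring) ((S i).mesh.card_bdryFaces_mul_le (harea i))
      calc _ = (((S i).mesh.bdryFaces.card : ℝ) * h ^ m) * (A' * M * h ^ (k + 1)) := by ring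
        _ ≤ (Mesh.surface (m + 1)).real (frontier Ω) / c * (A' * M * h ^ (k + 1)) :=
            mul_le_mul_of_nonneg_right hcard (by positivity)
        _ = _ := by rw [hE']; ring
    calc _ ≤ E * h1Norm Ω φ * h ^ (k + 1) + E' * M * h ^ (k + 1) :=
          norm_add_le_of_le ((norm_sum_le_of_le _ fun K _ => helem K).trans hT1)
            ((norm_sum_le_of_le _ hface).trans hT2)
      -- Adding the nonnegative cross terms completes the product of E + E' and the sum of both
      -- norms, which gives a single constant.
      _ ≤ E * h1Norm Ω φ * h ^ (k + 1) + E' * M * h ^ (k + 1) +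
          (E * M * h ^ (k + 1) + E' * h1Norm Ω φ * h ^ (k + 1)) :=
          le_add_of_nonneg_right (by positivity)
      _ = _ := by ring
  refine ⟨E + E', by positivity, fun i φ v hφ => ⟨fun h0 => ?_, main i φ v hφ⟩⟩
  have h1 := main i φ v hφ 0 ⟨le_rfl, fun x hx => by rw [h0 x hx, abs_zero],
    fun Γ hΓ x hx y hy => by
      have hΓ' := (S i).mesh.face_subset_domain_frontier hΓ
      rw [h0 x (hΓ' hx), h0 y (hΓ' hy), sub_self, abs_zero, zero_mul]⟩
  rwa [add_zero] at h1
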